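/- For a regular plane curve $c:[0,1]\to\mathbb R^2$ (i.e. $\partial_x c\neq 0$ on $[0,1]$) let $\partial_s=|\partial_x c|^{-1}\partial_x$ be the arclength derivative, $\tau=\partial_s c$ the unit tangent, $\nu$ the counterclockwise rotation of $\tau$ by $\pi/2$, $\boldsymbol\kappa=\partial_s^2c=k\nu$ the curvature vector with oriented curvature $k$, and, for $\mu>0$, let $$\mathcal E_\mu(c)=\int_c (k^2+\mu)\,\mathrm ds$$ be the elastic energy. Fix one of the following two sets of boundary conditions, with given data $P,Q,\tau_0,\tau_1\in\mathbb R^2$: - *Navier*: $c(0)=P$, $c(1)=Q$, $\boldsymbol\kappa(0)=\boldsymbol\kappa(1)=0$; - *clamped*: $c(0)=P$, $c(1)=Q$, $\tau(0)=\tau_0$, $\tau(1)=\tau_1$. A *global elastic flow* with these boundary conditions is a map $\gamma:[0,\infty)\times[0,1]\to\mathbb R^2$ which, for some $\alpha\in(0,1)$, belongs to the parabolic Hölder space $C^{\frac{4+\alpha}{4},4+\alpha}([0,T]\times[0,1];\mathbb R^2)$ for every $T>0$, which is of class $C^\infty$ on $[\varepsilon,\infty)\times[0,1]$ for every $\varepsilon>0$,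 and such that for every $t\ge 0$ the curve $\gamma(t,\cdot)$ is regular, satisfies the boundary conditions, and $$(\partial_t\gamma)^\perp=\left(-2\partial_s^2k-k^3+\mu k\right)\nu\qquad\text{on }[0,1],$$ where $(\partial_t\gamma)^\perp=\partial_t\gamma-\langle\partial_t\gamma,\tau\rangle\tau$ is the normal component of the velocity. An *elastica* with these boundary conditions is a smooth regular curve $c:[0,1]\to\mathbb R^2$ that satisfies them, solves $2\partial_s^2k+k^3-\mu k=0$ on $[0,1]$, and is a critical point of $\mathcal E_\mu$, in the sense that $\frac{d}{d\varepsilon}\mathcal E_\mu(c+\varepsilon\psi)\big|_{\varepsilon=0}=0$ for all $\psi\in C^2([0,1];\mathbb R^2)$ with $\psi(0)=\psi(1)=0$ and, in the clamped case, also $\partial_x\psi(0)=\partial_x\psi(1)=0$. **Proposition.** Let $\mu>0$ and let $\gamma$ be a global elastic flow with Navier or clamped boundary conditions. Then, up to subsequences and reparametrization, $\gamma(t,\cdot)$ converges smoothly to an elastica as $t\to\infty$. That is, for every sequence of times $t_n\to\infty$ there are a subsequence $(t_{n_j})_j$, smooth diffeomorphisms $\varphi_j:[0,1]\to[0,1]$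 with $\varphi_j(0)=0$, $\varphi_j(1)=1$ and $\partial_x\varphi_j>0$, and an elastica $\gamma_\infty$ with the same boundary conditions (same data), such that for every $m\in\mathbb N$ $$\partial_x^m\big(\gamma(t_{n_j},\varphi_j(\cdot))\big)\longrightarrow\partial_x^m\gamma_\infty\qquad\text{uniformly on }[0,1]\text{ as }j\to\infty.$$ -/

import Mathlib

open Set Filter
open scoped ContDiff

noncomputable section

namespace ElasticFlow

/-- The Euclidean plane. -/
abbrev Plane : Type := EuclideanSpace ℝ (Fin 2)

/-- The parameter interval `[0,1]`. -/
abbrev I : Set ℝ := Icc 0 1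

/-- The counterclockwise rotation by `π / 2`. -/
def rot (v : Plane) : Plane := !₂[-(v 1), v 0]

/-- Derivative with respect to the arclength of the curve `c` (one-sided at the endpoints). -/
def arcDeriv {F : Type*} [NormedAddCommGroup F] [NormedSpace ℝ F]
    (c : ℝ → Plane) (f : ℝ → F) (x : ℝ) : F :=
  ‖derivWithin c I x‖⁻¹ • derivWithin f I x

/-- Unit tangent vector `τ = ∂ₛ c`. -/
def tangent (c : ℝ → Plane) : ℝ → Plane := arcDeriv c c

/-- Unit normal vector `ν`. -/
def normal (c : ℝ → Plane) (x : ℝ) : Plane := rot (tangent c x)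

/-- Curvature vector `∂ₛ² c`. -/
def curvatureVector (c : ℝ → Plane) : ℝ → Plane := arcDeriv c (tangent c)

/-- Oriented curvature `k`, so that the curvature vector is `k ν`. -/
def curvature (c : ℝ → Plane) (x : ℝ) : ℝ := inner ℝ (curvatureVector c x) (normal c x)

/-- The elastic energy `∫ (k² + μ) ds`. -/
def elasticEnergy (μ : ℝ) (c : ℝ → Plane) : ℝ :=
  ∫ x in (0 : ℝ)..1, (curvature c x ^ 2 + μ) * ‖derivWithin c I x‖

/-- The (scalar) gradient `2 ∂ₛ² k + k³ - μ k` of the elastic energy. -/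
def elasticGradient (μ : ℝ) (c : ℝ → Plane) (x : ℝ) : ℝ :=
  2 * arcDeriv c (arcDeriv c (curvature c)) x + curvature c x ^ 3 - μ * curvature c x

/-- The two kinds of boundary conditions for an open curve, with their data. -/
inductive BoundaryCondition : Type
  | navier (P Q : Plane)
  | clamped (P Q τ₀ τ₁ : Plane)

/-- The curve `c` satisfies the boundary conditions. -/
def BoundaryCondition.Holds : BoundaryCondition → (ℝ → Plane) → Prop
  | .navier P Q, c =>
      c 0 = P ∧ c 1 = Q ∧ curvatureVector c 0 = 0 ∧ curvatureVector c 1 = 0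
  | .clamped P Q τ₀ τ₁, c =>
      c 0 = P ∧ c 1 = Q ∧ tangent c 0 = τ₀ ∧ tangent c 1 = τ₁

/-- The variation fields that preserve the geometric constraints: the endpoints in the Navier case,
the endpoints and the tangents there in the clamped case. -/
def BoundaryCondition.Admits : BoundaryCondition → (ℝ → Plane) → Prop
  | .navier _ _, ψ => ψ 0 = 0 ∧ ψ 1 = 0
  | .clamped _ _ _ _, ψ =>
      ψ 0 = 0 ∧ ψ 1 = 0 ∧ derivWithin ψ I 0 = 0 ∧ derivWithin ψ I 1 = 0

/-- `c` is a smooth regular curve `[0,1] → ℝ²`. -/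
structure IsSmoothRegular (c : ℝ → Plane) : Prop where
  smooth : ContDiffOn ℝ ∞ c I
  regular : ∀ x ∈ I, derivWithin c I x ≠ 0

/-- An elastica subject to the boundary conditions `b`: a smooth regular curve which satisfies `b`,
solves the Euler-Lagrange equation, and is a critical point of the elastic energy among the
curves with the same constraints. -/
structure IsElastica (μ : ℝ) (b : BoundaryCondition) (c : ℝ → Plane) : Prop
    extends IsSmoothRegular c where
  boundary : b.Holds c
  eulerLagrange : ∀ x ∈ I, elasticGradient μ c x = 0
  critical : ∀ ψ : ℝ → Plane, ContDiffOn ℝ 2 ψ I → b.Admits ψ →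
    HasDerivAt (fun ε : ℝ => elasticEnergy μ (fun x => c x + ε • ψ x)) 0 0

/-- Time derivative on `[0,∞)` (one-sided at `t = 0`). -/
def timeDeriv (u : ℝ → ℝ → Plane) (t x : ℝ) : Plane := derivWithin (fun r => u r x) (Ici 0) t

/-- Spatial derivative of order `j` on `[0,1]`. -/
def spaceDeriv (j : ℕ) (u : ℝ → ℝ → Plane) (t x : ℝ) : Plane := iteratedDerivWithin j (u t) I x

/-- Finiteness of the Hölder seminorm in time of exponent `ρ` on `[0,T] × [0,1]`. -/
def TimeHolder (ρ T : ℝ) (u : ℝ → ℝ → Plane) : Prop :=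
  ∃ C : ℝ, ∀ t ∈ Icc 0 T, ∀ r ∈ Icc 0 T, ∀ x ∈ I, ‖u t x - u r x‖ ≤ C * |t - r| ^ ρ

/-- Finiteness of the Hölder seminorm in space of exponent `ρ` on `[0,T] × [0,1]`. -/
def SpaceHolder (ρ T : ℝ) (u : ℝ → ℝ → Plane) : Prop :=
  ∃ C : ℝ, ∀ t ∈ Icc 0 T, ∀ x ∈ I, ∀ y ∈ I, ‖u t x - u t y‖ ≤ C * |x - y| ^ ρ

/-- `u : [0,∞) × [0,1] → ℝ²` is of class `C^{(4+α)/4, 4+α}` on `[0,T] × [0,1]` for every `T > 0`.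
The sup norms of the derivatives are finite because the derivatives are continuous. -/
structure IsParabolicHolder (α : ℝ) (u : ℝ → ℝ → Plane) : Prop where
  contDiff_space : ∀ t, 0 ≤ t → ContDiffOn ℝ 4 (u t) I
  differentiable_time : ∀ x ∈ I, DifferentiableOn ℝ (fun t => u t x) (Ici 0)
  continuous_space : ∀ j ≤ 4, ContinuousOn (fun p : ℝ × ℝ => spaceDeriv j u p.1 p.2) (Ici 0 ×ˢ I)
  continuous_time : ContinuousOn (fun p : ℝ × ℝ => timeDeriv u p.1 p.2) (Ici 0 ×ˢ I)
  spaceHolder_space : ∀ T > 0, SpaceHolder α T (spaceDeriv 4 u)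
  spaceHolder_time : ∀ T > 0, SpaceHolder α T (timeDeriv u)
  timeHolder_space : ∀ T > 0, ∀ j : ℕ, 1 ≤ j → j ≤ 4 →
    TimeHolder ((4 + α - (j : ℝ)) / 4) T (spaceDeriv j u)
  timeHolder_time : ∀ T > 0, TimeHolder (α / 4) T (timeDeriv u)

/-- `γ : [0,∞) × [0,1] → ℝ²` is a global solution of the elastic flow of open curves subject to the
boundary conditions `b`: it is of class `C^{(4+α)/4, 4+α}` up to the initial time for some
`α ∈ (0,1)`, smooth on `(0,∞) × [0,1]`, regular, its normal velocity is
`(-2 ∂ₛ² k - k³ + μ k) ν`, and `b` holds at all times. The tangential velocity is arbitrary. -/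
structure IsGlobalElasticFlow (μ : ℝ) (b : BoundaryCondition) (γ : ℝ → ℝ → Plane) : Prop where
  holder : ∃ α ∈ Ioo (0 : ℝ) 1, IsParabolicHolder α γ
  smooth : ContDiffOn ℝ ∞ (fun p : ℝ × ℝ => γ p.1 p.2) (Ioi 0 ×ˢ I)
  regular : ∀ t, 0 ≤ t → ∀ x ∈ I, derivWithin (γ t) I x ≠ 0
  evolution : ∀ t, 0 ≤ t → ∀ x ∈ I,
    timeDeriv γ t x - inner ℝ (timeDeriv γ t x) (tangent (γ t) x) • tangent (γ t) x =
      (-elasticGradient μ (γ t) x) • normal (γ t) x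
  boundary : ∀ t, 0 ≤ t → b.Holds (γ t)

/-- `φ` is a smooth orientation-preserving diffeomorphism of `[0,1]`. -/
structure IsReparametrization (φ : ℝ → ℝ) : Prop where
  smooth : ContDiffOn ℝ ∞ φ I
  map_zero : φ 0 = 0
  map_one : φ 1 = 1
  deriv_pos : ∀ x ∈ I, 0 < derivWithin φ I x

/-- Smooth convergence on `[0,1]`: uniform convergence of the derivatives of every order. -/
def SmoothlyConverges (c : ℕ → ℝ → Plane) (c' : ℝ → Plane) : Prop :=
  ∀ m : ℕ, TendstoUniformlyOn (fun n => iteratedDerivWithin m (c n) I)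
    (iteratedDerivWithin m c' I) atTop I

end ElasticFlow

end

/-! The elastic flow is the normal L² gradient flow of the energy, so the energy decreases at the
rate `∫ V² ds`, where `V` is the normal velocity. Since `μ > 0`, this bounds both the length and `∫
k² ds`. The length is also bounded below: by the distance of the end points, or, if they coincide,
because the tangent of a closed arc must turn. With these bounds the Sobolev and interpolation
inequalities hold with constants independent of time (`exists_sq_le`, `exists_Ds_le`,
`exists_kap_le`).

The tangential velocity is arbitrary, so all evolution equations are written with `Dt = ∂ₜ - T ∂ₛ`,
whose commutator with `∂ₛ` is `k V ∂ₛ` (`Dt_Ds`). Integration by parts must not leave boundary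
terms. This is secured by the class `Bd` of functions with homogeneous hinged or clamped conditions:
`V` belongs to it, `Dt` preserves it, and `∂ₛ⁴` is symmetric on it (`bd_nvel`, `bd_Dt`,
`J_parts_four`).

Energy dissipation makes `∫ V² ds` small in mean over unit time intervals. Its own evolution
inequality (`exists_nvel_evolution_le`) turns this into boundedness by a uniform Gronwall lemma, and
then into convergence to zero. One more estimate of this kind, for `∂ₛ² V` (`Ds_Ds_nvel_bounds`),
bounds the derivatives of `k` of order less than four. From there a bootstrap alternates between
`Dt^j V` and `∂ₛ² Dt^j V`; each step is the parabolic estimate `smoothing` and gains two orders. The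
nonlinear terms are handled by counting weights: if enough derivatives of `k` are already bounded, a
polynomial of limited weight contains at most two unbounded factors, one of them of the lowest
unbounded order (`W.abs_le_mul`). The outcome is `evBdd_kap`: every `∂ₛ^i k` is bounded for large
times. Interpolation between `∫ V² ds → 0` and the bound for `∂ₛ² V` makes `V` tend to zero
uniformly (`nvel_tendsto_zero`).

Finally the curves are reparametrized by constant speed, so that arclength bounds become bounds for
all parameter derivatives, and Arzelà-Ascoli gives smooth subsequential limits
(`exists_smooth_limit`). The limit has constant positive speed, inherits the boundary conditions,
and solves the Euler-Lagrange equation because the elastic gradient equals `-V`. Criticality follows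
since, on solutions, the integrand of the first variation is an exact derivative whose end values
vanish (`hasDerivAt_elasticEnergy`). -/

noncomputable section

namespace ElasticFlow

section

/-! ### Calculus on the space-time domain -/

/-- The space-time domain `(0,∞) × [0,1]`. -/
abbrev U : Set (ℝ × ℝ) := Ioi 0 ×ˢ I

lemma uniqueDiffOn_I : UniqueDiffOn ℝ I := uniqueDiffOn_Icc zero_lt_one

lemma uniqueDiffOn_U : UniqueDiffOn ℝ U := (uniqueDiffOn_Ioi 0).prod uniqueDiffOn_I

lemma mem_closure_interior_U {p : ℝ × ℝ} (hp : p ∈ U) : p ∈ closure (interior U) := by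
  rw [interior_prod_eq, closure_prod_eq, interior_Ioi, interior_Icc, closure_Ioo zero_ne_one]
  exact ⟨subset_closure hp.1, hp.2⟩

variable {F G : Type*} [NormedAddCommGroup F] [NormedSpace ℝ F]
  [NormedAddCommGroup G] [InnerProductSpace ℝ G]

/-- Smoothness on the space-time domain. -/
abbrev Sm (f : ℝ × ℝ → F) : Prop := ContDiffOn ℝ ∞ f U

/-- Derivative of `f` along the vector field `w`. -/
def der (w : ℝ × ℝ → ℝ × ℝ) (f : ℝ × ℝ → F) (p : ℝ × ℝ) : F := fderivWithin ℝ f U p (w p)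

lemma Sm.diff {f : ℝ × ℝ → F} (hf : Sm f) {p : ℝ × ℝ} (hp : p ∈ U) :
    DifferentiableWithinAt ℝ f U p := hf.differentiableOn (by simp) p hp

lemma Sm.fd {f : ℝ × ℝ → F} (hf : Sm f) : ContDiffOn ℝ ∞ (fderivWithin ℝ f U) U :=
  hf.fderivWithin uniqueDiffOn_U (by simp)

lemma Sm.der {f : ℝ × ℝ → F} (hf : Sm f) {w : ℝ × ℝ → ℝ × ℝ} (hw : Sm w) : Sm (der w f) :=
  hf.fd.clm_apply hw

lemma Sm.smul {a : ℝ × ℝ → ℝ} {f : ℝ × ℝ → F} (ha : Sm a) (hf : Sm f) : Sm (fun p => a p • f p) :=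
  ContDiffOn.smul ha hf

lemma Sm.mul {a b : ℝ × ℝ → ℝ} (ha : Sm a) (hb : Sm b) : Sm (fun p => a p * b p) :=
  ContDiffOn.mul ha hb

lemma Sm.add {f g : ℝ × ℝ → F} (hf : Sm f) (hg : Sm g) : Sm (fun p => f p + g p) :=
  ContDiffOn.add hf hg

lemma Sm.sub {f g : ℝ × ℝ → F} (hf : Sm f) (hg : Sm g) : Sm (fun p => f p - g p) :=
  ContDiffOn.sub hf hg

lemma Sm.neg {f : ℝ × ℝ → F} (hf : Sm f) : Sm (fun p => -f p) := ContDiffOn.neg hf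

lemma Sm.pow {a : ℝ × ℝ → ℝ} (ha : Sm a) (n : ℕ) : Sm (fun p => a p ^ n) := ContDiffOn.pow ha n

lemma Sm.const (c : F) : Sm (fun _ => c) := contDiffOn_const

lemma Sm.congr' {f g : ℝ × ℝ → F} (hf : Sm f) (h : EqOn f g U) : Sm g :=
  ContDiffOn.congr hf fun _ hp => (h hp).symm

section rules

variable {w : ℝ × ℝ → ℝ × ℝ} {p : ℝ × ℝ}

lemma der_congr {f g : ℝ × ℝ → F} (h : EqOn f g U) : EqOn (der w f) (der w g) U := fun p hp => by
  simp only [der]; rw [fderivWithin_congr h (h hp)]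

lemma der_const (c : F) : der w (fun _ => c) p = 0 := by
  simp [der]

lemma der_add {f g : ℝ × ℝ → F} (hf : Sm f) (hg : Sm g) (hp : p ∈ U) :
    der w (fun q => f q + g q) p = der w f p + der w g p := by
  simp only [der]
  rw [fderivWithin_fun_add (uniqueDiffOn_U p hp) (hf.diff hp) (hg.diff hp)]; rfl

lemma der_smul {a : ℝ × ℝ → ℝ} {f : ℝ × ℝ → F} (ha : Sm a) (hf : Sm f) (hp : p ∈ U) :
    der w (fun q => a q • f q) p = a p • der w f p + der w a p • f p := by
  simp only [der]
  rw [fderivWithin_fun_smul (uniqueDiffOn_U p hp) (ha.diff hp) (hf.diff hp)]; simp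

lemma der_mul {a f : ℝ × ℝ → ℝ} (ha : Sm a) (hf : Sm f) (hp : p ∈ U) :
    der w (fun q => a q * f q) p = a p * der w f p + der w a p * f p :=
  der_smul ha hf hp

lemma der_pow {a : ℝ × ℝ → ℝ} (ha : Sm a) (n : ℕ) (hp : p ∈ U) :
    der w (fun q => a q ^ n) p = n * a p ^ (n - 1) * der w a p := by
  simp only [der]
  rw [((ha.diff hp).hasFDerivWithinAt.pow n).fderivWithin (uniqueDiffOn_U p hp)]; simp

lemma der_const_mul {f : ℝ × ℝ → ℝ} (c : ℝ) (hf : Sm f) (hp : p ∈ U) :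
    der w (fun q => c * f q) p = c * der w f p := by
  rw [der_mul contDiffOn_const hf hp, der_const]; ring

lemma der_inner {f g : ℝ × ℝ → G} (hf : Sm f) (hg : Sm g) (hp : p ∈ U) :
    der w (fun q => inner ℝ (f q) (g q)) p = inner ℝ (f p) (der w g p) + inner ℝ (der w f p) (g p) := by
  simp only [der]
  rw [((hf.diff hp).hasFDerivWithinAt.inner ℝ (hg.diff hp).hasFDerivWithinAt).fderivWithin
    (uniqueDiffOn_U p hp)]
  simp

lemma der_clm {H : Type*} [NormedAddCommGroup H] [NormedSpace ℝ H] (A : F →L[ℝ] H) {f : ℝ × ℝ → F}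
    (hf : Sm f) (hp : p ∈ U) : der w (fun q => A (f q)) p = A (der w f p) := by
  simp only [der]
  have := (A.hasFDerivAt.comp_hasFDerivWithinAt p (hf.diff hp).hasFDerivWithinAt).fderivWithin
    (uniqueDiffOn_U p hp)
  exact congrArg (fun B : ℝ × ℝ →L[ℝ] H => B (w p)) this

/-- The commutator of two derivatives, in terms of the Lie bracket of the vector fields. -/
lemma der_der_sub {f : ℝ × ℝ → F} (hf : Sm f) {v : ℝ × ℝ → ℝ × ℝ} (hv : Sm v) (hw : Sm w)
    (hp : p ∈ U) :
    der v (der w f) p - der w (der v f) p = fderivWithin ℝ f U p (der v w p - der w v p) := by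
  have key : ∀ {a b : ℝ × ℝ → ℝ × ℝ}, Sm b →
      der a (der b f) p =
        fderivWithin ℝ (fderivWithin ℝ f U) U p (a p) (b p) + fderivWithin ℝ f U p (der a b p) := by
    intro a b hb
    have := ((Sm.diff hf.fd hp).hasFDerivWithinAt.clm_apply (hb.diff hp).hasFDerivWithinAt).fderivWithin
      (uniqueDiffOn_U p hp)
    change fderivWithin ℝ (fun q => fderivWithin ℝ f U q (b q)) U p (a p) = _
    rw [this]
    simp [der, add_comm]
  -- `U` is not open, but each of its points is a limit of interior points, which is enough for
  -- second derivatives within `U` to be symmetric.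
  have hsymm : IsSymmSndFDerivWithinAt ℝ f U p :=
    (hf p hp).isSymmSndFDerivWithinAt (by rw [minSmoothness_of_isRCLikeNormedField]; exact WithTop.coe_le_coe.2 (le_top : (2 : ℕ∞) ≤ ⊤)) uniqueDiffOn_U
      (mem_closure_interior_U hp) hp
  rw [key hw, key hv, hsymm.eq (v p) (w p), map_sub]
  abel

end rules

/-- Derivative in time. -/
abbrev dT (f : ℝ × ℝ → F) : ℝ × ℝ → F := der (fun _ => (1, 0)) f

/-- Derivative in space. -/
abbrev dX (f : ℝ × ℝ → F) : ℝ × ℝ → F := der (fun _ => (0, 1)) f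

lemma Sm.dT {f : ℝ × ℝ → F} (hf : Sm f) : Sm (dT f) := hf.der contDiffOn_const
lemma Sm.dX {f : ℝ × ℝ → F} (hf : Sm f) : Sm (dX f) := hf.der contDiffOn_const

lemma dT_dX {f : ℝ × ℝ → F} (hf : Sm f) {p : ℝ × ℝ} (hp : p ∈ U) : dT (dX f) p = dX (dT f) p := by
  have := der_der_sub hf (v := fun _ => (1, 0)) (w := fun _ => (0, 1)) contDiffOn_const
    contDiffOn_const hp
  rw [der_const, der_const, sub_zero, map_zero] at this
  exact sub_eq_zero.1 this

lemma hasDerivWithinAt_dX {f : ℝ × ℝ → F} (hf : Sm f) {t x : ℝ} (ht : 0 < t) (hx : x ∈ I) :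
    HasDerivWithinAt (fun y => f (t, y)) (dX f (t, x)) I x := by
  have hp : (t, x) ∈ U := ⟨ht, hx⟩
  have h1 : HasDerivWithinAt (fun y : ℝ => (t, y)) ((0 : ℝ), (1 : ℝ)) I x :=
    (hasDerivWithinAt_const _ _ _).prodMk (hasDerivWithinAt_id _ _)
  exact (hf.diff hp).hasFDerivWithinAt.comp_hasDerivWithinAt x h1
    (t := U) (fun y hy => ⟨ht, hy⟩)

lemma hasDerivAt_dT {f : ℝ × ℝ → F} (hf : Sm f) {t x : ℝ} (ht : 0 < t) (hx : x ∈ I) :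
    HasDerivAt (fun s => f (s, x)) (dT f (t, x)) t := by
  have hp : (t, x) ∈ U := ⟨ht, hx⟩
  have h1 : HasDerivWithinAt (fun s : ℝ => (s, x)) ((1 : ℝ), (0 : ℝ)) (Ioi 0) t :=
    (hasDerivWithinAt_id _ _).prodMk (hasDerivWithinAt_const _ _ _)
  exact ((hf.diff hp).hasFDerivWithinAt.comp_hasDerivWithinAt t h1
    (t := U) (fun s hs => ⟨hs, hx⟩)).hasDerivAt (Ioi_mem_nhds ht)

lemma derivWithin_eq_dX {f : ℝ × ℝ → F} (hf : Sm f) {t x : ℝ} (ht : 0 < t) (hx : x ∈ I) :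
    derivWithin (fun y => f (t, y)) I x = dX f (t, x) :=
  (hasDerivWithinAt_dX hf ht hx).derivWithin (uniqueDiffOn_I x hx)

lemma slice_continuousOn {X : Type*} [TopologicalSpace X] {f : ℝ × ℝ → X} (hf : ContinuousOn f U) {t : ℝ} (ht : 0 < t) :
    ContinuousOn (fun x => f (t, x)) I :=
  hf.comp (by fun_prop) fun _ hx => ⟨ht, hx⟩

/-- Differentiation under the integral sign. -/
lemma hasDerivAt_integral {f : ℝ × ℝ → ℝ} (hf : Sm f) {t : ℝ} (ht : 0 < t) :
    HasDerivAt (fun s => ∫ x in (0 : ℝ)..1, f (s, x)) (∫ x in (0 : ℝ)..1, dT f (t, x)) t := by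
  have hI : uIoc (0 : ℝ) 1 ⊆ I := by
    rw [uIoc_of_le zero_le_one]; exact Ioc_subset_Icc_self
  have hII : uIcc (0 : ℝ) 1 = I := uIcc_of_le zero_le_one
  have hs : Icc (t / 2) (2 * t) ∈ nhds t := Icc_mem_nhds (by linarith) (by linarith)
  have hpos : ∀ s ∈ Icc (t / 2) (2 * t), 0 < s := fun s hs => by linarith [hs.1]
  have hint : ∀ {h : ℝ × ℝ → ℝ}, ContinuousOn h U → ∀ s, 0 < s →
      IntervalIntegrable (fun x => h (s, x)) MeasureTheory.volume 0 1 := fun hh s hs =>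
    ContinuousOn.intervalIntegrable (by rw [hII]; exact slice_continuousOn hh hs)
  obtain ⟨C, hC⟩ := (isCompact_Icc.prod isCompact_Icc).exists_bound_of_continuousOn
    (s := Icc (t / 2) (2 * t) ×ˢ I) (f := dT f)
    (hf.dT.continuousOn.mono (prod_mono (fun s hs => hpos s hs) le_rfl))
  refine (intervalIntegral.hasDerivAt_integral_of_dominated_loc_of_deriv_le
    (bound := fun _ => C) (F := fun s x => f (s, x)) (F' := fun s x => dT f (s, x)) hs ?_ ?_ ?_ ?_
    intervalIntegrable_const ?_).2
  · filter_upwards [hs] with s hs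
    exact (hint hf.continuousOn s (hpos s hs)).def'.aestronglyMeasurable
  · exact hint hf.continuousOn t ht
  · exact (hint hf.dT.continuousOn t ht).def'.aestronglyMeasurable
  · exact Eventually.of_forall fun x hx s hs => hC (s, x) ⟨hs, hI hx⟩
  · exact Eventually.of_forall fun x hx s hs => hasDerivAt_dT hf (hpos s hs) (hI hx)

/-! ### The moving frame -/

/-- The counterclockwise rotation as a continuous linear map. -/
def rotL : Plane →L[ℝ] Plane :=
  LinearMap.toContinuousLinearMap
    { toFun := rot
      map_add' := fun v w => by ext i; fin_cases i <;> simp [rot]; ring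
      map_smul' := fun c v => by ext i; fin_cases i <;> simp [rot] }

lemma plane_inner (v w : Plane) : inner ℝ v w = v 0 * w 0 + v 1 * w 1 := by
  simp [PiLp.inner_apply, Fin.sum_univ_two]; ring

lemma plane_norm_sq (v : Plane) : ‖v‖ ^ 2 = v 0 ^ 2 + v 1 ^ 2 := by
  rw [← real_inner_self_eq_norm_sq, plane_inner]; ring

@[simp] lemma rot_zero (v : Plane) : rot v 0 = -(v 1) := rfl
@[simp] lemma rot_one (v : Plane) : rot v 1 = v 0 := rfl

lemma rot_rot (v : Plane) : rot (rot v) = -v := by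
  ext i; fin_cases i <;> simp

lemma rot_smul (a : ℝ) (v : Plane) : rot (a • v) = a • rot v := rotL.map_smul a v

lemma norm_rot (v : Plane) : ‖rot v‖ = ‖v‖ := by
  rw [← sq_eq_sq₀ (norm_nonneg _) (norm_nonneg _), plane_norm_sq, plane_norm_sq]; simp; ring

lemma inner_rot_self (v : Plane) : inner ℝ v (rot v) = 0 := by
  rw [plane_inner]; simp; ring

lemma inner_rot_rot (v w : Plane) : inner ℝ (rot v) (rot w) = inner ℝ v w := by
  rw [plane_inner, plane_inner]; simp; ring

lemma frame_expand {e : Plane} (he : ‖e‖ = 1) (v : Plane) :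
    v = (inner ℝ v e : ℝ) • e + (inner ℝ v (rot e) : ℝ) • rot e := by
  have h : e 0 ^ 2 + e 1 ^ 2 = 1 := by rw [← plane_norm_sq, he]; norm_num
  rw [plane_inner, plane_inner]
  ext i
  fin_cases i
  · simp; linear_combination (-(v 0)) * h
  · simp; linear_combination (-(v 1)) * h

end

section

/-! ### Geometry of a family of regular curves -/

section geometry

variable {F : Type*} [NormedAddCommGroup F] [NormedSpace ℝ F]

/-- The speed `|∂ₓ Γ|`. -/
def speed (Γ : ℝ × ℝ → Plane) (p : ℝ × ℝ) : ℝ := ‖dX Γ p‖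

/-- The derivative with respect to arclength. -/
def Ds (Γ : ℝ × ℝ → Plane) (f : ℝ × ℝ → F) : ℝ × ℝ → F := der (fun p => (0, (speed Γ p)⁻¹)) f

/-- Unit tangent of the family `Γ`. -/
def tau (Γ : ℝ × ℝ → Plane) : ℝ × ℝ → Plane := Ds Γ Γ

/-- Unit normal of the family `Γ`. -/
def nu (Γ : ℝ × ℝ → Plane) (p : ℝ × ℝ) : Plane := rot (tau Γ p)

/-- The arclength derivatives of the curvature of the family `Γ`. -/
def kap (Γ : ℝ × ℝ → Plane) : ℕ → ℝ × ℝ → ℝ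
  | 0 => fun p => inner ℝ (Ds Γ (tau Γ) p) (nu Γ p)
  | i + 1 => Ds Γ (kap Γ i)

/-- Normal velocity. -/
def nvel (Γ : ℝ × ℝ → Plane) (p : ℝ × ℝ) : ℝ := inner ℝ (dT Γ p) (nu Γ p)

/-- Tangential velocity. -/
def tvel (Γ : ℝ × ℝ → Plane) (p : ℝ × ℝ) : ℝ := inner ℝ (dT Γ p) (tau Γ p)

/-- Time derivative along the normal direction, `∂ₜ - T ∂ₛ` with `T` the tangential velocity. -/
def Dt (Γ : ℝ × ℝ → Plane) (f : ℝ × ℝ → F) : ℝ × ℝ → F :=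
  der (fun p => (1, -(tvel Γ p * (speed Γ p)⁻¹))) f

/-- A smooth family of regular curves. -/
structure RegularFamily (Γ : ℝ × ℝ → Plane) : Prop where
  smooth : Sm Γ
  regular : ∀ p ∈ U, dX Γ p ≠ 0

variable {Γ : ℝ × ℝ → Plane} {p : ℝ × ℝ}

lemma Ds_eq (f : ℝ × ℝ → F) (p : ℝ × ℝ) : Ds Γ f p = (speed Γ p)⁻¹ • dX f p := by
  simp only [Ds, der]
  rw [← map_smul]
  congr 1
  simp

lemma Dt_eq (f : ℝ × ℝ → F) (p : ℝ × ℝ) : Dt Γ f p = dT f p - tvel Γ p • Ds Γ f p := by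
  rw [Ds_eq, smul_smul]
  simp only [Dt, der]
  rw [← map_smul, ← map_sub]
  congr 1
  ext <;> simp

lemma Ds_congr {f g : ℝ × ℝ → F} (hfg : EqOn f g U) : EqOn (Ds Γ f) (Ds Γ g) U := der_congr hfg

lemma Ds_const (c : F) : Ds Γ (fun _ => c) p = 0 := der_const c

lemma Ds_add {f g : ℝ × ℝ → F} (hf : Sm f) (hg : Sm g) (hp : p ∈ U) :
    Ds Γ (fun q => f q + g q) p = Ds Γ f p + Ds Γ g p := der_add hf hg hp

lemma Ds_smul {a : ℝ × ℝ → ℝ} {f : ℝ × ℝ → F} (ha : Sm a) (hf : Sm f) (hp : p ∈ U) :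
    Ds Γ (fun q => a q • f q) p = a p • Ds Γ f p + Ds Γ a p • f p := der_smul ha hf hp

lemma Ds_mul {a f : ℝ × ℝ → ℝ} (ha : Sm a) (hf : Sm f) (hp : p ∈ U) :
    Ds Γ (fun q => a q * f q) p = a p * Ds Γ f p + Ds Γ a p * f p := der_mul ha hf hp

lemma Ds_const_mul {f : ℝ × ℝ → ℝ} (c : ℝ) (hf : Sm f) (hp : p ∈ U) :
    Ds Γ (fun q => c * f q) p = c * Ds Γ f p := der_const_mul c hf hp

lemma Ds_pow {a : ℝ × ℝ → ℝ} (ha : Sm a) (n : ℕ) (hp : p ∈ U) :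
    Ds Γ (fun q => a q ^ n) p = n * a p ^ (n - 1) * Ds Γ a p := der_pow ha n hp

lemma Dt_congr {f g : ℝ × ℝ → F} (hfg : EqOn f g U) : EqOn (Dt Γ f) (Dt Γ g) U := der_congr hfg

lemma Dt_const (c : F) : Dt Γ (fun _ => c) p = 0 := der_const c

lemma Dt_add {f g : ℝ × ℝ → F} (hf : Sm f) (hg : Sm g) (hp : p ∈ U) :
    Dt Γ (fun q => f q + g q) p = Dt Γ f p + Dt Γ g p := der_add hf hg hp

lemma Dt_mul {a f : ℝ × ℝ → ℝ} (ha : Sm a) (hf : Sm f) (hp : p ∈ U) :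
    Dt Γ (fun q => a q * f q) p = a p * Dt Γ f p + Dt Γ a p * f p := der_mul ha hf hp

lemma Dt_const_mul {f : ℝ × ℝ → ℝ} (c : ℝ) (hf : Sm f) (hp : p ∈ U) :
    Dt Γ (fun q => c * f q) p = c * Dt Γ f p := der_const_mul c hf hp

lemma Dt_pow {a : ℝ × ℝ → ℝ} (ha : Sm a) (n : ℕ) (hp : p ∈ U) :
    Dt Γ (fun q => a q ^ n) p = n * a p ^ (n - 1) * Dt Γ a p := der_pow ha n hp

namespace RegularFamily

variable (h : RegularFamily Γ)
include h

lemma speed_pos (hp : p ∈ U) : 0 < speed Γ p := norm_pos_iff.2 (h.regular p hp)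

lemma sm_speed : Sm (speed Γ) := h.smooth.dX.norm ℝ h.regular

lemma sm_inv_speed : Sm (fun p => (speed Γ p)⁻¹) := h.sm_speed.inv fun _ hp => (h.speed_pos hp).ne'

lemma sm_Ds {f : ℝ × ℝ → F} (hf : Sm f) : Sm (Ds Γ f) :=
  hf.der (contDiffOn_const.prodMk h.sm_inv_speed)

lemma sm_tau : Sm (tau Γ) := h.sm_Ds h.smooth

lemma sm_nu : Sm (nu Γ) := rotL.contDiff.comp_contDiffOn h.sm_tau

lemma sm_kap : ∀ i, Sm (kap Γ i)
  | 0 => (h.sm_Ds h.sm_tau).inner ℝ h.sm_nu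
  | i + 1 => h.sm_Ds (sm_kap i)

lemma sm_nvel : Sm (nvel Γ) := h.smooth.dT.inner ℝ h.sm_nu

lemma sm_tvel : Sm (tvel Γ) := h.smooth.dT.inner ℝ h.sm_tau

lemma sm_Dt {f : ℝ × ℝ → F} (hf : Sm f) : Sm (Dt Γ f) :=
  hf.der (contDiffOn_const.prodMk (h.sm_tvel.mul h.sm_inv_speed).neg)

lemma dX_eq (f : ℝ × ℝ → F) (hp : p ∈ U) : dX f p = speed Γ p • Ds Γ f p := by
  rw [Ds_eq, smul_smul, mul_inv_cancel₀ (h.speed_pos hp).ne', one_smul]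

lemma norm_tau (hp : p ∈ U) : ‖tau Γ p‖ = 1 := by
  rw [tau, Ds_eq, norm_smul, norm_inv, Real.norm_of_nonneg (h.speed_pos hp).le]
  exact inv_mul_cancel₀ (h.speed_pos hp).ne'

lemma norm_nu (hp : p ∈ U) : ‖nu Γ p‖ = 1 := by rw [nu, norm_rot, h.norm_tau hp]

lemma inner_tau_tau (hp : p ∈ U) : inner ℝ (tau Γ p) (tau Γ p) = (1 : ℝ) := by
  rw [real_inner_self_eq_norm_sq, h.norm_tau hp, one_pow]

lemma inner_nu_nu (hp : p ∈ U) : inner ℝ (nu Γ p) (nu Γ p) = (1 : ℝ) := by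
  rw [real_inner_self_eq_norm_sq, h.norm_nu hp, one_pow]

omit h in
lemma inner_tau_nu : inner ℝ (tau Γ p) (nu Γ p) = (0 : ℝ) := inner_rot_self _

omit h in
lemma inner_nu_tau : inner ℝ (nu Γ p) (tau Γ p) = (0 : ℝ) := by
  rw [real_inner_comm]; exact inner_tau_nu

lemma expand (hp : p ∈ U) (v : Plane) :
    v = (inner ℝ v (tau Γ p) : ℝ) • tau Γ p + (inner ℝ v (nu Γ p) : ℝ) • nu Γ p :=
  frame_expand (h.norm_tau hp) v

lemma inner_der_tau (w : ℝ × ℝ → ℝ × ℝ) (hp : p ∈ U) :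
    inner ℝ (der w (tau Γ) p) (tau Γ p) = (0 : ℝ) := by
  have h1 : der w (fun q => inner ℝ (tau Γ q) (tau Γ q) : ℝ × ℝ → ℝ) p = 0 := by
    rw [der_congr (g := fun _ => (1 : ℝ)) (fun q hq => h.inner_tau_tau hq) hp, der_const]
  rw [der_inner h.sm_tau h.sm_tau hp, real_inner_comm] at h1
  linarith

lemma Ds_tau (hp : p ∈ U) : Ds Γ (tau Γ) p = kap Γ 0 p • nu Γ p := by
  have := h.expand hp (Ds Γ (tau Γ) p)
  rwa [show inner ℝ (Ds Γ (tau Γ) p) (tau Γ p) = (0 : ℝ) from h.inner_der_tau _ hp, zero_smul,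
    zero_add] at this

lemma der_nu (w : ℝ × ℝ → ℝ × ℝ) (hp : p ∈ U) : der w (nu Γ) p = rot (der w (tau Γ) p) :=
  der_clm rotL h.sm_tau hp

omit h in
lemma rot_nu : rot (nu Γ p) = -tau Γ p := rot_rot _

lemma Ds_nu (hp : p ∈ U) : Ds Γ (nu Γ) p = -(kap Γ 0 p) • tau Γ p := by
  rw [Ds, h.der_nu _ hp]
  change rot (Ds Γ (tau Γ) p) = _
  rw [h.Ds_tau hp, rot_smul, rot_nu, smul_neg, neg_smul]

lemma dT_eq (hp : p ∈ U) : dT Γ p = nvel Γ p • nu Γ p + tvel Γ p • tau Γ p := by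
  rw [add_comm]; exact h.expand hp _

lemma Dt_self (hp : p ∈ U) : Dt Γ Γ p = nvel Γ p • nu Γ p := by
  rw [Dt_eq, h.dT_eq hp]; simp [tau]

/-- Evolution of the speed. -/
lemma dT_speed (hp : p ∈ U) :
    dT (speed Γ) p = speed Γ p * (Ds Γ (tvel Γ) p - kap Γ 0 p * nvel Γ p) := by
  have h0 := h.speed_pos hp
  have hX : dX Γ p = speed Γ p • tau Γ p := h.dX_eq Γ hp
  -- The square of the speed is an inner product, so differentiating it in time and exchanging `∂ₜ`
  -- with `∂ₓ` reduces everything to the Frenet formulas.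
  have h1 : dT (fun q => speed Γ q * speed Γ q) p = 2 * inner ℝ (dT (dX Γ) p) (dX Γ p) := by
    rw [dT, der_congr (f := fun q => speed Γ q * speed Γ q) (g := fun q => inner ℝ (dX Γ q) (dX Γ q))
      (fun q _ => (real_inner_self_eq_norm_mul_norm _).symm) hp,
      der_inner h.smooth.dX h.smooth.dX hp, real_inner_comm]
    ring
  rw [dT, der_mul h.sm_speed h.sm_speed hp, dT_dX h.smooth hp, h.dX_eq _ hp, hX,
    Ds, der_congr (g := fun q => nvel Γ q • nu Γ q + tvel Γ q • tau Γ q)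
      (fun q hq => h.dT_eq hq) hp,
    der_add (h.sm_nvel.smul h.sm_nu) (h.sm_tvel.smul h.sm_tau) hp,
    der_smul h.sm_nvel h.sm_nu hp, der_smul h.sm_tvel h.sm_tau hp] at h1
  change _ = 2 * inner ℝ (speed Γ p • (_ • Ds Γ (nu Γ) p + Ds Γ (nvel Γ) p • _ +
    (_ • Ds Γ (tau Γ) p + Ds Γ (tvel Γ) p • _))) _ at h1
  rw [h.Ds_nu hp, h.Ds_tau hp] at h1
  simp only [inner_smul_left, inner_smul_right, inner_add_left, h.inner_tau_tau hp, inner_nu_tau,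
    conj_trivial] at h1
  apply mul_left_cancel₀ h0.ne'
  linear_combination h1 / 2

/-- The commutator of the time derivative and the arclength derivative. -/
lemma Dt_Ds {f : ℝ × ℝ → F} (hf : Sm f) (hp : p ∈ U) :
    Dt Γ (Ds Γ f) p = Ds Γ (Dt Γ f) p + (kap Γ 0 p * nvel Γ p) • Ds Γ f p := by
  have h0 := h.speed_pos hp
  -- Both operators are derivatives along vector fields on space-time, so the commutator is the
  -- derivative along their Lie bracket. The bracket has no time component, and the evolution of the
  -- speed identifies it as `k V ∂ₛ`.
  have hprod : ∀ {a b : ℝ × ℝ → ℝ}, Sm a → Sm b → ∀ w, der w (fun q => (a q, b q)) p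
      = (der w a p, der w b p) := by
    intro a b ha hb w
    simp only [der]
    rw [((ha.diff hp).hasFDerivWithinAt.prodMk (hb.diff hp).hasFDerivWithinAt).fderivWithin
      (uniqueDiffOn_U p hp)]
    rfl
  have hi := h.sm_inv_speed
  have hti : Sm (fun q => -(tvel Γ q * (speed Γ q)⁻¹)) := (h.sm_tvel.mul hi).neg
  have key := der_der_sub hf (v := fun q => (1, -(tvel Γ q * (speed Γ q)⁻¹)))
    (w := fun q => (0, (speed Γ q)⁻¹)) (contDiffOn_const.prodMk hti) (contDiffOn_const.prodMk hi) hp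
  rw [hprod contDiffOn_const hi, hprod contDiffOn_const hti, der_const, der_const] at key
  rw [← sub_eq_iff_eq_add']
  refine key.trans ?_
  have hnum : ∀ w, der w (fun q => (speed Γ q)⁻¹) p = -((speed Γ p)⁻¹ ^ 2 * der w (speed Γ) p) := by
    intro w
    have : der w (fun q => speed Γ q * (speed Γ q)⁻¹) p = 0 := by
      rw [der_congr (g := fun _ => (1 : ℝ)) (fun q hq => mul_inv_cancel₀ (h.speed_pos hq).ne') hp,
        der_const]
    rw [der_mul h.sm_speed hi hp] at this
    field_simp at this ⊢
    linarith
  have hneg : ∀ w, der w (fun q => -(tvel Γ q * (speed Γ q)⁻¹)) p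
      = -(tvel Γ p * der w (fun q => (speed Γ q)⁻¹) p + der w (tvel Γ) p * (speed Γ p)⁻¹) := by
    intro w
    rw [← der_mul h.sm_tvel hi hp, ← neg_one_mul, ← der_const_mul _ (h.sm_tvel.mul hi) hp]
    simp
  have e1 : der (fun q => (1, -(tvel Γ q * (speed Γ q)⁻¹))) (speed Γ) p
      = dT (speed Γ) p - tvel Γ p * Ds Γ (speed Γ) p := Dt_eq (Γ := Γ) (speed Γ) p
  have e2 : der (fun q => (0, (speed Γ q)⁻¹)) (speed Γ) p = Ds Γ (speed Γ) p := rfl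
  have e3 : der (fun q => (0, (speed Γ q)⁻¹)) (tvel Γ) p = Ds Γ (tvel Γ) p := rfl
  rw [hneg, hnum, hnum, e1, e2, e3, h.dT_speed hp]
  simp only [Ds, der]
  rw [← map_smul]
  congr 1
  ext
  · simp
  · simp only [Prod.snd_sub, Prod.smul_snd, smul_eq_mul]
    field_simp
    ring

lemma Dt_tau (hp : p ∈ U) : Dt Γ (tau Γ) p = Ds Γ (nvel Γ) p • nu Γ p := by
  rw [tau, h.Dt_Ds h.smooth hp, Ds, der_congr (g := fun q => nvel Γ q • nu Γ q)
    (fun q hq => h.Dt_self hq) hp, der_smul h.sm_nvel h.sm_nu hp]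
  change nvel Γ p • Ds Γ (nu Γ) p + Ds Γ (nvel Γ) p • nu Γ p + (kap Γ 0 p * nvel Γ p) • tau Γ p = _
  rw [h.Ds_nu hp]
  module

lemma Dt_nu (hp : p ∈ U) : Dt Γ (nu Γ) p = -(Ds Γ (nvel Γ) p) • tau Γ p := by
  rw [Dt, h.der_nu _ hp]
  change rot (Dt Γ (tau Γ) p) = _
  rw [h.Dt_tau hp, rot_smul, rot_nu, smul_neg, neg_smul]

/-- Evolution of the curvature. -/
lemma Dt_curv (hp : p ∈ U) :
    Dt Γ (kap Γ 0) p = Ds Γ (Ds Γ (nvel Γ)) p + kap Γ 0 p ^ 2 * nvel Γ p := by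
  have h1 : Dt Γ (Ds Γ (tau Γ)) p = Dt Γ (fun q => kap Γ 0 q • nu Γ q) p :=
    der_congr (fun q hq => h.Ds_tau hq) hp
  have h2 : Ds Γ (Dt Γ (tau Γ)) p = Ds Γ (fun q => Ds Γ (nvel Γ) q • nu Γ q) p :=
    der_congr (fun q hq => h.Dt_tau hq) hp
  have h3 : Dt Γ (fun q => kap Γ 0 q • nu Γ q) p
      = kap Γ 0 p • Dt Γ (nu Γ) p + Dt Γ (kap Γ 0) p • nu Γ p := der_smul (h.sm_kap 0) h.sm_nu hp
  have h4 : Ds Γ (fun q => Ds Γ (nvel Γ) q • nu Γ q) p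
      = Ds Γ (nvel Γ) p • Ds Γ (nu Γ) p + Ds Γ (Ds Γ (nvel Γ)) p • nu Γ p :=
    der_smul (h.sm_Ds h.sm_nvel) h.sm_nu hp
  rw [h.Dt_Ds h.sm_tau hp, h2, h3, h4, h.Dt_nu hp, h.Ds_nu hp, h.Ds_tau hp] at h1
  have h5 := congrArg (fun v => inner ℝ v (nu Γ p)) h1
  simp only [inner_add_left, inner_smul_left, inner_tau_nu, h.inner_nu_nu hp, conj_trivial] at h5
  linear_combination -h5

end RegularFamily

end geometry

end

section

/-! ### Integration along the curves -/

/-- The integral of `f` with respect to arclength along the curve `Γ (t, ·)`. -/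
def J (Γ : ℝ × ℝ → Plane) (f : ℝ × ℝ → ℝ) (t : ℝ) : ℝ :=
  ∫ x in (0 : ℝ)..1, f (t, x) * speed Γ (t, x)

lemma integral_dX {F : Type*} [NormedAddCommGroup F] [NormedSpace ℝ F] [CompleteSpace F]
    {f : ℝ × ℝ → F} (hf : Sm f) (ht : 0 < t) {x y : ℝ} (hx : x ∈ I) (hy : y ∈ I) (hxy : x ≤ y) :
    ∫ z in x..y, dX f (t, z) = f (t, y) - f (t, x) := by
  have hsub : Icc x y ⊆ I := Icc_subset_Icc hx.1 hy.2
  refine intervalIntegral.integral_eq_sub_of_hasDerivAt_of_le (f := fun z => f (t, z)) hxy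
    ((slice_continuousOn hf.continuousOn ht).mono hsub) (fun z hz => ?_) ?_
  · exact (hasDerivWithinAt_dX hf ht (hsub (Ioo_subset_Icc_self hz))).hasDerivAt
      (Icc_mem_nhds (hx.1.trans_lt hz.1) (hz.2.trans_le hy.2))
  · apply ContinuousOn.intervalIntegrable
    rw [uIcc_of_le hxy]
    exact (slice_continuousOn hf.dX.continuousOn ht).mono hsub

namespace RegularFamily

variable {Γ : ℝ × ℝ → Plane} (h : RegularFamily Γ) {f g f₁ f₂ f₃ : ℝ × ℝ → ℝ} {t : ℝ}
include h

lemma integrable_J (ht : 0 < t) (hf : ContinuousOn f U) :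
    IntervalIntegrable (fun x => f (t, x) * speed Γ (t, x)) MeasureTheory.volume 0 1 := by
  apply ContinuousOn.intervalIntegrable
  rw [uIcc_of_le zero_le_one]
  exact slice_continuousOn (hf.mul h.sm_speed.continuousOn) ht

lemma J_add (ht : 0 < t) (hf : ContinuousOn f U) (hg : ContinuousOn g U) :
    J Γ (fun p => f p + g p) t = J Γ f t + J Γ g t := by
  simp only [J, add_mul]
  exact intervalIntegral.integral_add (h.integrable_J ht hf) (h.integrable_J ht hg)

omit h in
lemma J_const_mul (c : ℝ) : J Γ (fun p => c * f p) t = c * J Γ f t := by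
  simp only [J, mul_assoc, intervalIntegral.integral_const_mul]

omit h in
lemma J_congr (ht : 0 < t) (hfg : EqOn f g U) : J Γ f t = J Γ g t := by
  refine intervalIntegral.integral_congr fun x hx => ?_
  rw [uIcc_of_le zero_le_one] at hx
  simp only [hfg (show (t, x) ∈ U from ⟨ht, hx⟩)]

lemma J_mono (ht : 0 < t) (hf : ContinuousOn f U) (hg : ContinuousOn g U)
    (hfg : ∀ x ∈ I, f (t, x) ≤ g (t, x)) : J Γ f t ≤ J Γ g t :=
  intervalIntegral.integral_mono_on zero_le_one (h.integrable_J ht hf) (h.integrable_J ht hg)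
    fun x hx => mul_le_mul_of_nonneg_right (hfg x hx) (norm_nonneg _)

omit h in
lemma J_nonneg (hf : ∀ x ∈ I, 0 ≤ f (t, x)) : 0 ≤ J Γ f t :=
  intervalIntegral.integral_nonneg zero_le_one fun x hx => mul_nonneg (hf x hx) (norm_nonneg _)

omit h in
lemma J_sq_nonneg : 0 ≤ J Γ (fun p => f p ^ 2) t := J_nonneg fun _ _ => sq_nonneg _

lemma J_le₂ (ht : 0 < t) (hf : ContinuousOn f U) (h₁ : ContinuousOn f₁ U) (h₂ : ContinuousOn f₂ U)
    {a₁ a₂ : ℝ} (hfg : ∀ x ∈ I, f (t, x) ≤ a₁ * f₁ (t, x) + a₂ * f₂ (t, x)) :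
    J Γ f t ≤ a₁ * J Γ f₁ t + a₂ * J Γ f₂ t := by
  rw [← J_const_mul, ← J_const_mul, ← h.J_add ht (by fun_prop) (by fun_prop)]
  exact h.J_mono ht hf ((continuousOn_const.mul h₁).add (continuousOn_const.mul h₂)) hfg

lemma J_le₃ (ht : 0 < t) (hf : ContinuousOn f U) (h₁ : ContinuousOn f₁ U) (h₂ : ContinuousOn f₂ U)
    (h₃ : ContinuousOn f₃ U) {a₁ a₂ a₃ : ℝ}
    (hfg : ∀ x ∈ I, f (t, x) ≤ a₁ * f₁ (t, x) + a₂ * f₂ (t, x) + a₃ * f₃ (t, x)) :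
    J Γ f t ≤ a₁ * J Γ f₁ t + a₂ * J Γ f₂ t + a₃ * J Γ f₃ t := by
  rw [← J_const_mul, ← J_const_mul, ← J_const_mul, ← h.J_add ht (by fun_prop) (by fun_prop),
    ← h.J_add ht (by fun_prop) (by fun_prop)]
  exact h.J_mono ht hf (((continuousOn_const.mul h₁).add (continuousOn_const.mul h₂)).add
    (continuousOn_const.mul h₃)) hfg

/-- The Cauchy-Schwarz inequality. -/
lemma J_mul_sq_le (ht : 0 < t) (hf : ContinuousOn f U) (hg : ContinuousOn g U) :
    J Γ (fun p => f p * g p) t ^ 2 ≤ J Γ (fun p => f p ^ 2) t * J Γ (fun p => g p ^ 2) t := by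
  have key : ∀ a : ℝ, 0 ≤ J Γ (fun p => f p ^ 2) t * (a * a) + (2 * J Γ (fun p => f p * g p) t) * a
      + J Γ (fun p => g p ^ 2) t := by
    intro a
    have h0 : 0 ≤ J Γ (fun p => (a * f p + g p) ^ 2) t := J_sq_nonneg
    have h1 := h.J_le₃ ht (f := fun p => (a * f p + g p) ^ 2) (f₁ := fun p => f p ^ 2)
      (f₂ := fun p => f p * g p) (f₃ := fun p => g p ^ 2) (by fun_prop) (by fun_prop)
      (by fun_prop) (by fun_prop) (a₁ := a ^ 2) (a₂ := 2 * a) (a₃ := 1)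
      (fun x _ => le_of_eq (by ring))
    linarith
  have := discrim_le_zero key
  rw [discrim] at this
  linarith

lemma J_Ds (hf : Sm f) (ht : 0 < t) : J Γ (Ds Γ f) t = f (t, 1) - f (t, 0) := by
  rw [← integral_dX hf ht (left_mem_Icc.2 zero_le_one) (right_mem_Icc.2 zero_le_one) zero_le_one]
  refine intervalIntegral.integral_congr fun x hx => ?_
  rw [uIcc_of_le zero_le_one] at hx
  rw [h.dX_eq f (p := (t, x)) ⟨ht, hx⟩, smul_eq_mul, mul_comm]

/-- Integration by parts. -/
lemma J_parts (hf : Sm f) (hg : Sm g) (ht : 0 < t) :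
    J Γ (fun p => f p * Ds Γ g p) t =
      f (t, 1) * g (t, 1) - f (t, 0) * g (t, 0) - J Γ (fun p => Ds Γ f p * g p) t := by
  rw [eq_sub_iff_add_eq, ← h.J_add ht (hf.mul (h.sm_Ds hg)).continuousOn
    ((h.sm_Ds hf).mul hg).continuousOn, ← h.J_Ds (hf.mul hg) ht]
  exact J_congr ht fun p hp => (der_mul hf hg hp).symm

lemma norm_sub_le_J {F : Type*} [NormedAddCommGroup F] [NormedSpace ℝ F] [CompleteSpace F]
    {f : ℝ × ℝ → F} (hf : Sm f) (ht : 0 < t) {x y : ℝ} (hx : x ∈ I) (hy : y ∈ I) :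
    ‖f (t, x) - f (t, y)‖ ≤ J Γ (fun p => ‖Ds Γ f p‖) t := by
  wlog hxy : y ≤ x generalizing x y
  · rw [norm_sub_rev]; exact this hy hx (le_of_not_ge hxy)
  have hsub : Icc y x ⊆ I := Icc_subset_Icc hy.1 hx.2
  have hc := slice_continuousOn hf.dX.continuousOn ht
  rw [← integral_dX hf ht hy hx hxy]
  have e : J Γ (fun p => ‖Ds Γ f p‖) t = ∫ x in (0 : ℝ)..1, ‖dX f (t, x)‖ := by
    refine intervalIntegral.integral_congr fun x hx => ?_
    rw [uIcc_of_le zero_le_one] at hx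
    have hp : (t, x) ∈ U := ⟨ht, hx⟩
    simp only
    rw [h.dX_eq f hp, norm_smul, Real.norm_of_nonneg (h.speed_pos hp).le, mul_comm]
  rw [e]
  refine (intervalIntegral.norm_integral_le_integral_norm hxy).trans ?_
  exact intervalIntegral.integral_mono_interval hy.1 hxy hx.2
    (Eventually.of_forall fun _ => norm_nonneg _)
    (ContinuousOn.intervalIntegrable (by rw [uIcc_of_le zero_le_one]; exact hc.norm))

/-- Evolution of integrals along curves with fixed end points. -/
lemma hasDerivAt_J (hv : ∀ t > 0, tvel Γ (t, 0) = 0 ∧ tvel Γ (t, 1) = 0) (hf : Sm f) (ht : 0 < t) :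
    HasDerivAt (J Γ f) (J Γ (fun p => Dt Γ f p - kap Γ 0 p * nvel Γ p * f p) t) t := by
  have h1 := hasDerivAt_integral (hf.mul h.sm_speed) ht
  -- The whole contribution of the tangential velocity is the exact derivative `∂ₛ (f T)`, which
  -- integrates to zero because `T` vanishes at both ends.
  have h2 : (∫ x in (0 : ℝ)..1, dT (fun p => f p * speed Γ p) (t, x)) =
      J Γ (fun p => (Dt Γ f p - kap Γ 0 p * nvel Γ p * f p)
        + Ds Γ (fun q => f q * tvel Γ q) p) t := by
    refine intervalIntegral.integral_congr fun x hx => ?_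
    rw [uIcc_of_le zero_le_one] at hx
    have hp : (t, x) ∈ U := ⟨ht, hx⟩
    simp only
    have e1 : dT (fun p => f p * speed Γ p) (t, x) = f (t, x) * dT (speed Γ) (t, x)
      + dT f (t, x) * speed Γ (t, x) := der_mul hf h.sm_speed hp
    rw [e1, h.dT_speed hp, Dt_eq, Ds_mul hf h.sm_tvel hp, smul_eq_mul]
    ring
  rw [h2, h.J_add ht ((h.sm_Dt hf).sub (((h.sm_kap 0).mul h.sm_nvel).mul hf)).continuousOn
    (h.sm_Ds (hf.mul h.sm_tvel)).continuousOn, h.J_Ds (hf.mul h.sm_tvel) ht, (hv t ht).1,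
    (hv t ht).2, mul_zero, mul_zero, sub_zero, add_zero] at h1
  exact h1

end RegularFamily

/-! ### Elastic families -/

/-- The end points of the parameter interval. -/
abbrev ends : Set ℝ := {0, 1}

/-- The curvature vanishes at the end points at all times. -/
def Hinged (Γ : ℝ × ℝ → Plane) : Prop := ∀ e ∈ ends, ∀ t > 0, kap Γ 0 (t, e) = 0

/-- A smooth family of curves that moves by the elastic flow, with fixed end points, and with either
vanishing curvature or fixed tangents at the end points. -/
structure ElasticFamily (μ : ℝ) (Γ : ℝ × ℝ → Plane) : Prop extends RegularFamily Γ where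
  pos : 0 < μ
  law : ∀ p ∈ U, nvel Γ p = -(2 * kap Γ 2 p + kap Γ 0 p ^ 3 - μ * kap Γ 0 p)
  fixed : ∀ e ∈ ends, ∃ P, ∀ t > 0, Γ (t, e) = P
  clamped : ¬ Hinged Γ → ∀ e ∈ ends, ∃ v, ∀ t > 0, tau Γ (t, e) = v

/-- The homogeneous boundary conditions: a function that vanishes at the end points together with
its second derivative (hinged case) or its first derivative (clamped case). -/
structure Bd (Γ : ℝ × ℝ → Plane) (f : ℝ × ℝ → ℝ) : Prop where
  zero : ∀ e ∈ ends, ∀ t > 0, f (t, e) = 0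
  hinged : Hinged Γ → ∀ e ∈ ends, ∀ t > 0, Ds Γ (Ds Γ f) (t, e) = 0
  clamped : ¬ Hinged Γ → ∀ e ∈ ends, ∀ t > 0, Ds Γ f (t, e) = 0

lemma ends_subset {e : ℝ} (he : e ∈ ends) : e ∈ I := by
  rcases he with rfl | rfl <;> simp

lemma zero_mem_ends : (0 : ℝ) ∈ ends := by simp
lemma one_mem_ends : (1 : ℝ) ∈ ends := by simp

lemma dT_eq_zero {F : Type*} [NormedAddCommGroup F] [NormedSpace ℝ F] {f : ℝ × ℝ → F} (hf : Sm f)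
    {x : ℝ} (hx : x ∈ I) {c : F} (hc : ∀ t > 0, f (t, x) = c) {t : ℝ} (ht : 0 < t) :
    dT f (t, x) = 0 := by
  have h1 := hasDerivAt_dT hf ht hx
  have h2 : (fun s => f (s, x)) =ᶠ[nhds t] fun _ => c := by
    filter_upwards [Ioi_mem_nhds ht] with s hs using hc s hs
  exact (h1.congr_of_eventuallyEq h2.symm).unique (hasDerivAt_const t c)

namespace ElasticFamily

variable {μ : ℝ} {Γ : ℝ × ℝ → Plane} (h : ElasticFamily μ Γ) {t : ℝ} {e : ℝ}
include h

lemma nvel_end (he : e ∈ ends) (ht : 0 < t) : nvel Γ (t, e) = 0 := by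
  obtain ⟨P, hP⟩ := h.fixed e he
  rw [nvel, dT_eq_zero h.smooth (ends_subset he) hP ht, inner_zero_left]

lemma tvel_end (he : e ∈ ends) (ht : 0 < t) : tvel Γ (t, e) = 0 := by
  obtain ⟨P, hP⟩ := h.fixed e he
  rw [tvel, dT_eq_zero h.smooth (ends_subset he) hP ht, inner_zero_left]

lemma Dt_end {F : Type*} [NormedAddCommGroup F] [NormedSpace ℝ F] {f : ℝ × ℝ → F} (hf : Sm f)
    (he : e ∈ ends) {c : F} (hc : ∀ t > 0, f (t, e) = c) (ht : 0 < t) : Dt Γ f (t, e) = 0 := by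
  rw [Dt_eq, dT_eq_zero hf (ends_subset he) hc ht, h.tvel_end he ht, zero_smul, sub_zero]

lemma commute_end {f : ℝ × ℝ → ℝ} (hf : Sm f) (he : e ∈ ends) (ht : 0 < t) :
    Ds Γ (Dt Γ f) (t, e) = Dt Γ (Ds Γ f) (t, e) := by
  rw [h.Dt_Ds hf (p := (t, e)) ⟨ht, ends_subset he⟩, h.nvel_end he ht, mul_zero, zero_smul, add_zero]

/-- The commutator of the time derivative and the second arclength derivative. -/
lemma Dt_Ds_Ds {f : ℝ × ℝ → ℝ} (hf : Sm f) {p : ℝ × ℝ} (hp : p ∈ U) :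
    Dt Γ (Ds Γ (Ds Γ f)) p = Ds Γ (Ds Γ (Dt Γ f)) p +
      (2 * (kap Γ 0 p * nvel Γ p * Ds Γ (Ds Γ f) p) +
        (kap Γ 0 p * Ds Γ (nvel Γ) p + kap Γ 1 p * nvel Γ p) * Ds Γ f p) := by
  have hk := h.sm_kap 0
  have hV := h.sm_nvel
  have hD : Ds Γ (Dt Γ (Ds Γ f)) p =
      Ds Γ (fun q => Ds Γ (Dt Γ f) q + (kap Γ 0 q * nvel Γ q) * Ds Γ f q) p :=
    der_congr (fun q hq => h.Dt_Ds hf hq) hp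
  have h2 : Ds Γ (fun q => Ds Γ (Dt Γ f) q + (kap Γ 0 q * nvel Γ q) * Ds Γ f q) p =
      Ds Γ (Ds Γ (Dt Γ f)) p + ((kap Γ 0 p * nvel Γ p) * Ds Γ (Ds Γ f) p
        + (kap Γ 0 p * Ds Γ (nvel Γ) p + Ds Γ (kap Γ 0) p * nvel Γ p) * Ds Γ f p) := by
    rw [Ds_add (h.sm_Ds (h.sm_Dt hf)) ((hk.mul hV).mul (h.sm_Ds hf)) hp,
      Ds_mul (hk.mul hV) (h.sm_Ds hf) hp, Ds_mul hk hV hp]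
  rw [h.Dt_Ds (h.sm_Ds hf) hp, hD, h2]
  change _ + ((kap Γ 0 p * nvel Γ p) * Ds Γ (Ds Γ f) p
        + (kap Γ 0 p * Ds Γ (nvel Γ) p + kap Γ 1 p * nvel Γ p) * Ds Γ f p) + _ = _
  simp only [smul_eq_mul]
  ring

/-- The end points are at rest, so there `Dt` is the plain time derivative and annihilates
quantities that are constant in time. The commutators with `∂ₛ` and, in the hinged case, `∂ₛ²` also
vanish there, since `V = 0` and, in the hinged case, `k = 0`. -/
lemma bd_Dt {f : ℝ × ℝ → ℝ} (hf : Sm f) (hb : Bd Γ f) : Bd Γ (Dt Γ f) where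
  zero e he t ht := h.Dt_end hf he (hb.zero e he) ht
  hinged hh e he t ht := by
    have h1 := h.Dt_Ds_Ds hf (p := (t, e)) ⟨ht, ends_subset he⟩
    rw [h.Dt_end (h.sm_Ds (h.sm_Ds hf)) he (hb.hinged hh e he) ht, hh e he t ht,
      h.nvel_end he ht] at h1
    simpa using h1.symm
  clamped hh e he t ht := by
    rw [h.commute_end hf he ht, h.Dt_end (h.sm_Ds hf) he (hb.clamped hh e he) ht]

/-- The conditions on `V` are the time derivatives of the geometric ones: `Dt k = ∂ₛ² V + k² V`
gives the hinged condition and `Dt τ = ∂ₛ V ν` the clamped one. -/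
lemma bd_nvel : Bd Γ (nvel Γ) where
  zero e he t ht := h.nvel_end he ht
  hinged hh e he t ht := by
    have h1 := h.Dt_curv (p := (t, e)) ⟨ht, ends_subset he⟩
    rw [h.Dt_end (h.sm_kap 0) he (hh e he) ht, hh e he t ht] at h1
    simpa using h1.symm
  clamped hh e he t ht := by
    obtain ⟨v, hv⟩ := h.clamped hh e he
    have hp : (t, e) ∈ U := ⟨ht, ends_subset he⟩
    have h1 := h.Dt_tau hp
    rw [h.Dt_end h.sm_tau he hv ht] at h1
    have h2 := congrArg (fun v => inner ℝ v (nu Γ (t, e))) h1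
    simp only [inner_zero_left, inner_smul_left, h.inner_nu_nu hp, conj_trivial] at h2
    linarith

/-- Of the boundary terms, `f ∂ₛ³ g` vanishes with `f`, and `∂ₛ f ∂ₛ² g` vanishes by the second
factor in the hinged case and by the first in the clamped case. -/
lemma J_parts_four {f g : ℝ × ℝ → ℝ} (hf : Sm f) (hg : Sm g) (hbf : Bd Γ f) (hbg : Bd Γ g)
    (ht : 0 < t) :
    J Γ (fun p => f p * Ds Γ (Ds Γ (Ds Γ (Ds Γ g))) p) t =
      J Γ (fun p => Ds Γ (Ds Γ f) p * Ds Γ (Ds Γ g) p) t := by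
  have hb : ∀ e ∈ ends, Ds Γ f (t, e) * Ds Γ (Ds Γ g) (t, e) = 0 := fun e he => by
    by_cases hh : Hinged Γ
    · rw [hbg.hinged hh e he t ht, mul_zero]
    · rw [hbf.clamped hh e he t ht, zero_mul]
  rw [h.J_parts hf (h.sm_Ds (h.sm_Ds (h.sm_Ds hg))) ht,
    h.J_parts (h.sm_Ds hf) (h.sm_Ds (h.sm_Ds hg)) ht, hb 0 zero_mem_ends, hb 1 one_mem_ends,
    hbf.zero 0 zero_mem_ends t ht, hbf.zero 1 one_mem_ends t ht]
  ring

lemma hasDerivAt_J' {f : ℝ × ℝ → ℝ} (hf : Sm f) (ht : 0 < t) :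
    HasDerivAt (J Γ f) (J Γ (fun p => Dt Γ f p - kap Γ 0 p * nvel Γ p * f p) t) t :=
  h.hasDerivAt_J (fun _ hs => ⟨h.tvel_end zero_mem_ends hs, h.tvel_end one_mem_ends hs⟩) hf ht

/-- The dissipation of the elastic energy. -/
lemma hasDerivAt_energy (ht : 0 < t) :
    HasDerivAt (J Γ (fun p => kap Γ 0 p ^ 2 + μ)) (-J Γ (fun p => nvel Γ p ^ 2) t) t := by
  have hk := h.sm_kap 0
  have hV := h.sm_nvel
  have h1 := h.hasDerivAt_J' ((hk.pow 2).add (Sm.const μ)) ht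
  convert h1 using 1
  have hb : ∀ e ∈ ends, kap Γ 0 (t, e) * Ds Γ (nvel Γ) (t, e) = 0 := fun e he => by
    by_cases hh : Hinged Γ
    · rw [hh e he t ht, zero_mul]
    · rw [h.bd_nvel.clamped hh e he t ht, mul_zero]
  have p1 := h.J_parts hk (h.sm_Ds hV) ht
  have p2 := h.J_parts (h.sm_kap 1) hV ht
  rw [hb 0 zero_mem_ends, hb 1 one_mem_ends] at p1
  rw [h.nvel_end zero_mem_ends ht, h.nvel_end one_mem_ends ht] at p2
  change _ = _ - J Γ (fun p => kap Γ 1 p * Ds Γ (nvel Γ) p) t at p1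
  change _ = _ - J Γ (fun p => kap Γ 2 p * nvel Γ p) t at p2
  have h2 : J Γ (fun p => Dt Γ (fun p => kap Γ 0 p ^ 2 + μ) p
      - kap Γ 0 p * nvel Γ p * (kap Γ 0 p ^ 2 + μ)) t =
      J Γ (fun p => 2 * (kap Γ 0 p * Ds Γ (Ds Γ (nvel Γ)) p) +
        ((-1) * nvel Γ p ^ 2 + (-2) * (kap Γ 2 p * nvel Γ p))) t := by
    refine RegularFamily.J_congr ht fun p hp => ?_
    have e1 : Dt Γ (fun p => kap Γ 0 p ^ 2 + μ) p = 2 * kap Γ 0 p * Dt Γ (kap Γ 0) p := by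
      rw [Dt_add (hk.pow 2) (Sm.const μ) hp, Dt_pow hk 2 hp, Dt_const]
      simp
    have e2 : nvel Γ p ^ 2 = -(2 * kap Γ 2 p + kap Γ 0 p ^ 3 - μ * kap Γ 0 p) * nvel Γ p := by
      rw [← h.law p hp]; ring
    simp only [e1, h.Dt_curv hp, e2]
    ring
  have c1 := (h.sm_Ds (h.sm_Ds hV)).continuousOn
  have c2 := hk.continuousOn
  have c3 := hV.continuousOn
  have c4 := (h.sm_kap 2).continuousOn
  rw [h2, h.J_add ht (by fun_prop) (by fun_prop), h.J_add ht (by fun_prop) (by fun_prop),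
    RegularFamily.J_const_mul, RegularFamily.J_const_mul, RegularFamily.J_const_mul]
  linarith

end ElasticFamily

end

/-! ### Interpolation inequalities and bounds from the energy -/

section

namespace RegularFamily

variable {Γ : ℝ × ℝ → Plane} (h : RegularFamily Γ) {f : ℝ × ℝ → ℝ} {t : ℝ}
include h

lemma length_pos (ht : 0 < t) : 0 < J Γ (fun _ => 1) t := by
  have hc := h.integrable_J ht (f := fun _ => (1 : ℝ)) continuousOn_const
  refine intervalIntegral.intervalIntegral_pos_of_pos_on hc (fun x hx => ?_) zero_lt_one
  rw [one_mul]
  exact h.speed_pos (p := (t, x)) ⟨ht, Ioo_subset_Icc_self hx⟩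

/-- A weighted Sobolev inequality. -/
lemma sq_le_J (hf : Sm f) (ht : 0 < t) {a : ℝ} (ha : 0 < a) {x : ℝ} (hx : x ∈ I) :
    f (t, x) ^ 2 ≤ ((J Γ (fun _ => 1) t)⁻¹ + a) * J Γ (fun p => f p ^ 2) t
      + a⁻¹ * J Γ (fun p => Ds Γ f p ^ 2) t := by
  have hL := h.length_pos ht
  have cf := hf.continuousOn
  have cs := (h.sm_Ds hf).continuousOn
  set R := J Γ (fun p => ‖Ds Γ (fun q => f q ^ 2) p‖) t with hR
  -- `R` bounds the oscillation of `f²`, and `|∂ₛ (f²)| = 2 |f ∂ₛ f|` is split with weight `a`.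
  -- Comparing `f(x)²` with the mean of `f²` then gives the claim.
  have h1 : R ≤ a * J Γ (fun p => f p ^ 2) t + a⁻¹ * J Γ (fun p => Ds Γ f p ^ 2) t := by
    refine h.J_le₂ ht ((h.sm_Ds (hf.pow 2)).continuousOn.norm) (by fun_prop) (by fun_prop)
      fun y hy => ?_
    rw [Ds_pow hf 2 (p := (t, y)) ⟨ht, hy⟩]
    set u := f (t, y)
    set v := Ds Γ f (t, y)
    have e1 : 0 ≤ a⁻¹ * (a * u - v) ^ 2 := by positivity
    have e2 : 0 ≤ a⁻¹ * (a * u + v) ^ 2 := by positivity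
    have e3 : a⁻¹ * (a * u - v) ^ 2 = a * u ^ 2 - 2 * (u * v) + a⁻¹ * v ^ 2 := by
      field_simp; ring
    have e4 : a⁻¹ * (a * u + v) ^ 2 = a * u ^ 2 + 2 * (u * v) + a⁻¹ * v ^ 2 := by
      field_simp; ring
    rw [Real.norm_eq_abs, abs_le]
    constructor <;> norm_num <;> linarith
  have h2 : f (t, x) ^ 2 * J Γ (fun _ => 1) t
      ≤ J Γ (fun p => f p ^ 2) t + R * J Γ (fun _ => 1) t := by
    rw [← RegularFamily.J_const_mul, ← one_mul (J Γ (fun p => f p ^ 2) t)]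
    refine h.J_le₂ ht continuousOn_const (by fun_prop) (by fun_prop) fun y hy => ?_
    have := (Real.norm_eq_abs _ ▸ h.norm_sub_le_J (hf.pow 2) ht hx hy)
    have := (le_abs_self _).trans this
    linarith
  have h3 : f (t, x) ^ 2 ≤ (J Γ (fun _ => 1) t)⁻¹ * J Γ (fun p => f p ^ 2) t + R := by
    rw [inv_mul_eq_div, ← sub_le_iff_le_add, le_div_iff₀ hL]
    linarith
  linarith

/-- If the length is bounded below, first derivatives are controlled by second derivatives. -/
lemma J_Ds_sq_le {f : ℝ × ℝ → ℝ} (hf : Sm f) (ht : 0 < t) {C η a : ℝ} (hη : 0 < η) (ha : 0 < a)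
    (hC : (J Γ (fun _ => 1) t)⁻¹ ≤ C) :
    J Γ (fun p => Ds Γ f p ^ 2) t ≤
      (2 * η * (C + 1) + 1 / (2 * η * a)) * J Γ (fun p => Ds Γ f p ^ 2) t
      + 3 * η * J Γ (fun p => Ds Γ (Ds Γ f) p ^ 2) t
      + ((C + a) / (2 * η) + 1 / (4 * η)) * J Γ (fun p => f p ^ 2) t := by
  have cf := hf.continuousOn
  have c1 := (h.sm_Ds hf).continuousOn
  have c2 := (h.sm_Ds (h.sm_Ds hf)).continuousOn
  set X := J Γ (fun p => f p ^ 2) t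
  set Y := J Γ (fun p => Ds Γ f p ^ 2) t
  set Z := J Γ (fun p => Ds Γ (Ds Γ f) p ^ 2) t
  have hX : 0 ≤ X := J_sq_nonneg
  have hY : 0 ≤ Y := J_sq_nonneg
  have amgm : ∀ u v : ℝ, |u * v| ≤ η * v ^ 2 + 1 / (4 * η) * u ^ 2 := by
    intro u v
    have e1 : 0 ≤ η * (v - u / (2 * η)) ^ 2 := by positivity
    have e2 : 0 ≤ η * (v + u / (2 * η)) ^ 2 := by positivity
    have e3 : η * (v - u / (2 * η)) ^ 2 = η * v ^ 2 - u * v + 1 / (4 * η) * u ^ 2 := by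
      field_simp; ring
    have e4 : η * (v + u / (2 * η)) ^ 2 = η * v ^ 2 + u * v + 1 / (4 * η) * u ^ 2 := by
      field_simp; ring
    rw [abs_le]; constructor <;> linarith
  -- No boundary condition is imposed on `f`, so the boundary terms of the integration by parts
  -- remain; they are estimated by the Sobolev inequality for `f` with weight `a` and for `∂ₛ f`
  -- with weight `1`.
  have hb : ∀ e ∈ I, |f (t, e) * Ds Γ f (t, e)| ≤
      η * ((C + 1) * Y + Z) + 1 / (4 * η) * ((C + a) * X + a⁻¹ * Y) := by
    intro e he
    have b1 := h.sq_le_J hf ht ha he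
    have b2 := h.sq_le_J (h.sm_Ds hf) ht one_pos he
    have b1' : f (t, e) ^ 2 ≤ (C + a) * X + a⁻¹ * Y := b1.trans (by gcongr)
    have b2' : Ds Γ f (t, e) ^ 2 ≤ (C + 1) * Y + Z := b2.trans (by rw [inv_one, one_mul]; gcongr)
    exact (amgm _ _).trans (by gcongr)
  have hp := h.J_parts hf (h.sm_Ds hf) ht
  have e1 : J Γ (fun p => Ds Γ f p * Ds Γ f p) t = Y :=
    congrArg (fun F => J Γ F t) (funext fun p => (sq (Ds Γ f p)).symm)
  rw [e1] at hp
  have hq : J Γ (fun p => (-1) * (f p * Ds Γ (Ds Γ f) p)) t ≤ η * Z + 1 / (4 * η) * X :=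
    h.J_le₂ ht (by fun_prop) (by fun_prop) (by fun_prop) fun x _ => by
      have := (abs_le.1 (amgm (f (t, x)) (Ds Γ (Ds Γ f) (t, x)))).1
      linarith
  rw [J_const_mul] at hq
  have hb0 := (abs_le.1 (hb 0 (left_mem_Icc.2 zero_le_one))).1
  have hb1 := (abs_le.1 (hb 1 (right_mem_Icc.2 zero_le_one))).2
  have e2 : (2 * η * (C + 1) + 1 / (2 * η * a)) * Y + 3 * η * Z
      + ((C + a) / (2 * η) + 1 / (4 * η)) * X =
    2 * (η * ((C + 1) * Y + Z) + 1 / (4 * η) * ((C + a) * X + a⁻¹ * Y))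
      + (η * Z + 1 / (4 * η) * X) := by
    field_simp; ring
  rw [e2]
  linarith

end RegularFamily

namespace ElasticFamily

variable {μ : ℝ} {Γ : ℝ × ℝ → Plane} (h : ElasticFamily μ Γ) {t : ℝ}
include h

lemma energy_antitone : AntitoneOn (J Γ (fun p => kap Γ 0 p ^ 2 + μ)) (Ioi 0) := by
  refine antitoneOn_of_hasDerivWithinAt_nonpos (convex_Ioi 0) (fun s hs =>
    (h.hasDerivAt_energy hs).continuousAt.continuousWithinAt) (fun s hs =>
    (h.hasDerivAt_energy (by simpa using hs)).hasDerivWithinAt) fun s _ => ?_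
  exact neg_nonpos.2 RegularFamily.J_sq_nonneg

lemma energy_eq (ht : 0 < t) : J Γ (fun p => kap Γ 0 p ^ 2 + μ) t =
    J Γ (fun p => kap Γ 0 p ^ 2) t + μ * J Γ (fun _ => 1) t := by
  have := (h.sm_kap 0).continuousOn
  rw [← RegularFamily.J_const_mul, ← h.J_add ht (by fun_prop) (by fun_prop)]
  simp

/-- The energy at time `1` dominates both terms of the energy at later times; dividing by `μ` gives
the length. -/
lemma exists_bounds : ∃ M > 0, ∀ t ≥ 1, J Γ (fun p => kap Γ 0 p ^ 2) t ≤ M ∧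
    J Γ (fun _ => 1) t ≤ M := by
  have h0 : (0 : ℝ) ≤ J Γ (fun p => kap Γ 0 p ^ 2 + μ) 1 :=
    RegularFamily.J_nonneg fun x _ => add_nonneg (sq_nonneg _) h.pos.le
  refine ⟨J Γ (fun p => kap Γ 0 p ^ 2 + μ) 1 + J Γ (fun p => kap Γ 0 p ^ 2 + μ) 1 / μ + 1,
    by have := h.pos; positivity, fun t ht => ?_⟩
  have ht0 : 0 < t := by linarith
  have h1 := h.energy_antitone (mem_Ioi.2 one_pos) (mem_Ioi.2 ht0) ht
  rw [h.energy_eq ht0] at h1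
  have h2 : 0 ≤ J Γ (fun p => kap Γ 0 p ^ 2) t := RegularFamily.J_sq_nonneg
  have h3 := h.length_pos ht0
  have h4 := h.pos
  have h5 : J Γ (fun _ => 1) t ≤ J Γ (fun p => kap Γ 0 p ^ 2 + μ) 1 / μ := by
    rw [le_div_iff₀ h4]; linarith
  have h6 : 0 ≤ J Γ (fun p => kap Γ 0 p ^ 2 + μ) 1 / μ := by positivity
  have h7 : 0 < μ * J Γ (fun _ => 1) t := by positivity
  constructor <;> linarith

/-- The length of the curves is bounded below. -/
lemma exists_inv_length_le : ∃ C > 0, ∀ t ≥ 1, (J Γ (fun _ => 1) t)⁻¹ ≤ C := by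
  obtain ⟨M, hM, hMb⟩ := h.exists_bounds
  obtain ⟨P, hP⟩ := h.fixed 0 zero_mem_ends
  obtain ⟨Q, hQ⟩ := h.fixed 1 one_mem_ends
  -- If the end points coincide, the integral of `⟨τ, v⟩` with `v = τ(0)` is zero, while `⟨τ, v⟩ ≥ 1
  -- - K` for `K = ∫ |k| ds`. Hence `K ≥ 1`, and Cauchy-Schwarz gives `1 ≤ K² ≤ M L`. Otherwise the
  -- length is at least the distance of the end points.
  by_cases hPQ : P = Q
  · refine ⟨M, hM, fun t ht => ?_⟩
    have ht0 : 0 < t := by linarith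
    have hL := h.length_pos ht0
    set v := tau Γ (t, 0)
    have hv : ‖v‖ = 1 := h.norm_tau (p := (t, 0)) ⟨ht0, left_mem_Icc.2 zero_le_one⟩
    have hsm : Sm (fun q => inner ℝ (Γ q) v : ℝ × ℝ → ℝ) := h.smooth.inner ℝ contDiffOn_const
    have h1 := h.J_Ds hsm ht0
    simp only [hP t ht0, hQ t ht0, hPQ, sub_self] at h1
    set K := J Γ (fun p => ‖kap Γ 0 p‖) t with hK
    have hτ : ∀ x ∈ I, ‖tau Γ (t, x) - v‖ ≤ K := fun x hx => by
      refine (h.norm_sub_le_J h.sm_tau ht0 hx (left_mem_Icc.2 zero_le_one)).trans (le_of_eq ?_)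
      refine RegularFamily.J_congr ht0 fun p hp => ?_
      rw [h.Ds_tau hp, norm_smul, h.norm_nu hp, mul_one]
    have h2 : (1 - K) * J Γ (fun _ => 1) t ≤ 0 := by
      rw [← h1, ← RegularFamily.J_const_mul]
      refine h.J_mono ht0 continuousOn_const (h.sm_Ds hsm).continuousOn fun x hx => ?_
      have hp : (t, x) ∈ U := ⟨ht0, hx⟩
      have e1 : Ds Γ (fun q => inner ℝ (Γ q) v : ℝ × ℝ → ℝ) (t, x) = inner ℝ (tau Γ (t, x)) v := by
        rw [Ds, der_inner h.smooth contDiffOn_const hp, der_const, inner_zero_right, zero_add]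
        rfl
      have e2 : (inner ℝ (tau Γ (t, x)) v : ℝ) = 1 + inner ℝ (tau Γ (t, x) - v) v := by
        rw [inner_sub_left, real_inner_self_eq_norm_sq, hv]; ring
      have e3 := (abs_le.1 (abs_real_inner_le_norm (tau Γ (t, x) - v) v)).1
      rw [hv, mul_one] at e3
      rw [e1, e2, mul_one]
      linarith [hτ x hx]
    have hK1 : 1 ≤ K := by
      by_contra hlt
      push Not at hlt
      nlinarith
    have ck := (h.sm_kap 0).continuousOn
    have h3 := h.J_mul_sq_le ht0 (f := fun p => ‖kap Γ 0 p‖) (g := fun _ => (1 : ℝ))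
      ck.norm continuousOn_const
    simp only [mul_one, one_pow, Real.norm_eq_abs, sq_abs] at h3
    rw [inv_le_comm₀ hL hM]
    rw [inv_le_iff_one_le_mul₀' hM]
    have h4 : 1 ≤ K ^ 2 := one_le_pow₀ hK1
    calc (1 : ℝ) ≤ K ^ 2 := h4
      _ ≤ _ := h3
      _ ≤ _ := by gcongr; exact (hMb t ht).1
  · refine ⟨‖P - Q‖⁻¹, inv_pos.2 (norm_pos_iff.2 (sub_ne_zero.2 hPQ)), fun t ht => ?_⟩
    have ht0 : 0 < t := by linarith
    have h1 := h.norm_sub_le_J h.smooth ht0 (left_mem_Icc.2 zero_le_one) (right_mem_Icc.2 zero_le_one)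
    have e1 : J Γ (fun p => ‖Ds Γ Γ p‖) t = J Γ (fun _ => 1) t :=
      RegularFamily.J_congr ht0 fun p hp => h.norm_tau hp
    rw [hP t ht0, hQ t ht0, e1] at h1
    exact inv_anti₀ (norm_pos_iff.2 (sub_ne_zero.2 hPQ)) h1

lemma exists_sq_le : ∃ C > 0, ∀ f, Sm f → ∀ t ≥ 1, ∀ x ∈ I,
    f (t, x) ^ 2 ≤ C * (J Γ (fun p => f p ^ 2) t + J Γ (fun p => Ds Γ f p ^ 2) t) := by
  obtain ⟨C, hC, hCb⟩ := h.exists_inv_length_le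
  refine ⟨C + 1, by linarith, fun f hf t ht x hx => ?_⟩
  have ht0 : 0 < t := by linarith
  have h1 := h.sq_le_J hf ht0 one_pos hx
  have h2 : 0 ≤ J Γ (fun p => f p ^ 2) t := RegularFamily.J_sq_nonneg
  have h3 : 0 ≤ J Γ (fun p => Ds Γ f p ^ 2) t := RegularFamily.J_sq_nonneg
  have h4 := mul_le_mul_of_nonneg_right (hCb t ht) h2
  rw [inv_one, one_mul] at h1
  nlinarith

lemma exists_Ds_le {ε : ℝ} (hε : 0 < ε) : ∃ C > 0, ∀ f, Sm f → ∀ t ≥ 1,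
    J Γ (fun p => Ds Γ f p ^ 2) t ≤
      ε * J Γ (fun p => Ds Γ (Ds Γ f) p ^ 2) t + C * J Γ (fun p => f p ^ 2) t := by
  obtain ⟨C, hC, hCb⟩ := h.exists_inv_length_le
  -- With this `η` and the weight `a = 2 / η`, the coefficient of the first derivative on the right
  -- of `J_Ds_sq_le` is at most `1/4 + 1/4`. Absorbing it doubles the other coefficients, hence the
  -- `6` in `ε / 6`.
  set η := min (1 / (8 * (C + 1))) (ε / 6) with hη
  have hη0 : 0 < η := by rw [hη]; positivity
  have hη1 : 2 * η * (C + 1) ≤ 1 / 4 := by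
    have : η ≤ 1 / (8 * (C + 1)) := min_le_left _ _
    rw [le_div_iff₀ (by positivity)] at this
    linarith
  have hη2 : 6 * η ≤ ε := by
    have : η ≤ ε / 6 := min_le_right _ _
    linarith
  refine ⟨2 * ((C + 2 / η) / (2 * η) + 1 / (4 * η)), by positivity, fun f hf t ht => ?_⟩
  have h1 := h.J_Ds_sq_le hf (by linarith) hη0 (a := 2 / η) (by positivity) (hCb t ht)
  have e1 : 1 / (2 * η * (2 / η)) = 1 / 4 := by field_simp; norm_num
  rw [e1] at h1
  have h2 : 0 ≤ J Γ (fun p => Ds Γ (Ds Γ f) p ^ 2) t := RegularFamily.J_sq_nonneg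
  have h3 : 0 ≤ J Γ (fun p => Ds Γ f p ^ 2) t := RegularFamily.J_sq_nonneg
  nlinarith [mul_le_mul_of_nonneg_right hη1 h3, mul_le_mul_of_nonneg_right hη2 h2]

/-- Interpolation for the derivatives of the curvature. -/
lemma exists_kap_le (m : ℕ) : ∀ i < m, ∀ ε > 0, ∃ C > 0, ∀ t ≥ 1,
    J Γ (fun p => kap Γ i p ^ 2) t ≤ ε * J Γ (fun p => kap Γ m p ^ 2) t + C := by
  obtain ⟨M, hM, hMb⟩ := h.exists_bounds
  induction m with
  | zero => intro i hi; omega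
  | succ m ih =>
    have top : ∀ ε > 0, ∃ C > 0, ∀ t ≥ 1,
        J Γ (fun p => kap Γ m p ^ 2) t ≤ ε * J Γ (fun p => kap Γ (m + 1) p ^ 2) t + C := by
      intro ε hε
      -- At the lowest order the energy bound on `∫ k² ds` suffices. Above it, `exists_Ds_le`
      -- produces a term of order `m`, which the induction hypothesis bounds by half of the
      -- left-hand side.
      rcases m with _ | m
      · refine ⟨M, hM, fun t ht => (hMb t ht).1.trans ?_⟩
        have : 0 ≤ J Γ (fun p => kap Γ (0 + 1) p ^ 2) t := RegularFamily.J_sq_nonneg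
        nlinarith
      · obtain ⟨C, hC, hCb⟩ := h.exists_Ds_le (half_pos hε)
        obtain ⟨D, hD, hDb⟩ := ih m (by omega) (1 / (2 * C)) (by positivity)
        refine ⟨2 * C * D, by positivity, fun t ht => ?_⟩
        have h1 := hCb (kap Γ m) (h.sm_kap m) t ht
        have h2 := mul_le_mul_of_nonneg_left (hDb t ht) hC.le
        have e1 : C * (1 / (2 * C) * J Γ (fun p => kap Γ (m + 1) p ^ 2) t + D) =
          J Γ (fun p => kap Γ (m + 1) p ^ 2) t / 2 + C * D := by field_simp
        rw [e1] at h2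
        change J Γ (fun p => kap Γ (m + 1) p ^ 2) t ≤
          ε / 2 * J Γ (fun p => kap Γ (m + 1 + 1) p ^ 2) t + _ at h1
        linarith
    intro i hi ε hε
    rcases Nat.lt_succ_iff_lt_or_eq.1 hi with hi | rfl
    · obtain ⟨C, hC, hCb⟩ := ih i hi 1 one_pos
      obtain ⟨D, hD, hDb⟩ := top ε hε
      refine ⟨D + C, by positivity, fun t ht => ?_⟩
      linarith [hCb t ht, hDb t ht]
    · exact top ε hε

end ElasticFamily

/-! ### A uniform Gronwall lemma -/

/-- The quadratic inequality for `u = 1 + y` is read as the linear inequality `u' ≤ (C u) u`, whose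
coefficient has bounded integral over unit intervals. So `u (t + 1)` is at most a constant times `u
s` for every `s` in `[t, t + 1]`; averaging over `s` bounds it. Integrating the inequality once more
bounds the integral of `z`. -/
lemma uniform_gronwall {y y' z : ℝ → ℝ} {B C : ℝ} (hy0 : ∀ t, 0 ≤ y t) (hz0 : ∀ t, 0 ≤ z t)
    (hzc : ContinuousOn z (Ioi 0)) (hy : ∀ t > 0, HasDerivAt y (y' t) t)
    (hle : ∀ᶠ t in atTop, y' t ≤ -z t + C * (1 + y t) ^ 2)
    (hB : ∀ᶠ t in atTop, ∫ s in t..t + 1, y s ≤ B) :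
    ∃ D, (∀ᶠ t in atTop, y t ≤ D) ∧ ∀ᶠ t in atTop, ∫ s in t..t + 1, z s ≤ D := by
  have hyc : ContinuousOn y (Ioi 0) := fun t ht => (hy t ht).continuousAt.continuousWithinAt
  obtain ⟨T, hT⟩ := eventually_atTop.1 (hle.and hB)
  wlog hC : 0 < C generalizing C
  · exact this (C := 1) (hle.mono fun t h1 => h1.trans (by nlinarith [sq_nonneg (1 + y t)]))
      (fun t ht => ⟨(hT t ht).1.trans (by nlinarith [sq_nonneg (1 + y t)]), (hT t ht).2⟩) one_pos
  set T' := max T 1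
  have hT1 : 1 ≤ T' := le_max_right _ _
  have hT2 : T ≤ T' := le_max_left _ _
  have hint : ∀ {w : ℝ → ℝ}, ContinuousOn w (Ioi 0) → ∀ {a b : ℝ}, 0 < a → a ≤ b →
      IntervalIntegrable w MeasureTheory.volume a b := fun hw a b ha hab =>
    (hw.mono fun s hs => by
      rw [uIcc_of_le hab] at hs; exact ha.trans_le hs.1).intervalIntegrable
  have hder : ∀ {w : ℝ → ℝ}, ContinuousOn w (Ioi 0) → ∀ {a s : ℝ}, 0 < a → a ≤ s →
      HasDerivAt (fun r => ∫ q in a..r, w q) (w s) s := fun hw a s ha has =>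
    intervalIntegral.integral_hasDerivAt_right (hint hw ha has)
      (hw.stronglyMeasurableAtFilter isOpen_Ioi s (ha.trans_le has))
      (hw.continuousAt (Ioi_mem_nhds (ha.trans_le has)))
  set u := fun t => 1 + y t with hu
  have huc : ContinuousOn u (Ioi 0) := continuousOn_const.add hyc
  set D := (1 + B) * Real.exp (C * (1 + B)) with hD
  have hbound : ∀ t ≥ T', u (t + 1) ≤ D := by
    intro t ht
    have ht0 : 0 < t := by linarith
    have hIu : ∫ s in t..t + 1, u s ≤ 1 + B := by
      rw [intervalIntegral.integral_add intervalIntegrable_const (hint hyc ht0 (by linarith))]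
      have := (hT t (hT2.trans ht)).2
      simpa using this
    have hI0 : ∀ s ∈ Icc t (t + 1), ∫ q in t..s, u q ≤ ∫ q in t..t + 1, u q := fun s hs =>
      intervalIntegral.integral_mono_interval le_rfl hs.1 hs.2
        (Eventually.of_forall fun q => by simp only [hu, Pi.zero_apply]; linarith [hy0 q])
        (hint huc ht0 (by linarith))
    -- The integrating factor for the linear inequality with coefficient `C u`.
    have hanti : AntitoneOn (fun s => u s * Real.exp (-C * ∫ q in t..s, u q)) (Icc t (t + 1)) := by
      have hd : ∀ s ∈ Icc t (t + 1), HasDerivAt (fun s => u s * Real.exp (-C * ∫ q in t..s, u q))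
          (y' s * Real.exp (-C * ∫ q in t..s, u q) +
            u s * (Real.exp (-C * ∫ q in t..s, u q) * (-C * u s))) s := fun s hs =>
        ((hy s (ht0.trans_le hs.1)).const_add 1).mul
          (((hder huc ht0 hs.1).const_mul (-C)).exp)
      refine antitoneOn_of_hasDerivWithinAt_nonpos (convex_Icc _ _)
        (fun s hs => (hd s hs).continuousAt.continuousWithinAt)
        (fun s hs => (hd s (interior_subset hs)).hasDerivWithinAt) fun s hs => ?_
      have hs' := interior_subset hs
      have h1 := (hT s (hT2.trans (ht.trans hs'.1))).1
      have h2 := hz0 s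
      have h3 : y' s ≤ C * u s ^ 2 := by linarith
      have h4 := Real.exp_pos (-C * ∫ q in t..s, u q)
      nlinarith
    have hlow : ∀ s ∈ Icc t (t + 1), u (t + 1) * Real.exp (-C * (1 + B)) ≤ u s := by
      intro s hs
      have h1 := hanti hs (right_mem_Icc.2 (by linarith)) hs.2
      have h2 : Real.exp (-C * ∫ q in t..s, u q) ≤ 1 := by
        rw [Real.exp_le_one_iff]
        have : 0 ≤ ∫ q in t..s, u q := intervalIntegral.integral_nonneg hs.1
          fun q _ => by simp only [hu]; linarith [hy0 q]
        nlinarith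
      have h3 : Real.exp (-C * (1 + B)) ≤ Real.exp (-C * ∫ q in t..t + 1, u q) := by
        apply Real.exp_le_exp.2; nlinarith
      have h4 : 0 ≤ u (t + 1) := by simp only [hu]; linarith [hy0 (t + 1)]
      have h5 : 0 ≤ u s := by simp only [hu]; linarith [hy0 s]
      calc _ ≤ u (t + 1) * Real.exp (-C * ∫ q in t..t + 1, u q) := by gcongr
        _ ≤ _ := h1
        _ ≤ u s * 1 := mul_le_mul_of_nonneg_left h2 h5
        _ = u s := mul_one _
    have h6 : u (t + 1) * Real.exp (-C * (1 + B)) ≤ ∫ s in t..t + 1, u s := by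
      have := intervalIntegral.integral_mono_on (a := t) (b := t + 1) (by linarith)
        intervalIntegrable_const (hint huc ht0 (by linarith)) hlow
      simpa using this
    have h7 : u (t + 1) * Real.exp (-C * (1 + B)) ≤ 1 + B := h6.trans hIu
    calc u (t + 1) = (u (t + 1) * Real.exp (-C * (1 + B))) * Real.exp (C * (1 + B)) := by
          rw [mul_assoc, ← Real.exp_add]; simp
      _ ≤ D := mul_le_mul_of_nonneg_right h7 (Real.exp_pos _).le
  have hyD : ∀ t ≥ T' + 1, u t ≤ D := fun t ht => by
    have := hbound (t - 1) (by linarith); simpa using this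
  refine ⟨max D (D + C * D ^ 2), ?_, ?_⟩
  · filter_upwards [eventually_ge_atTop (T' + 1)] with t ht
    have : 1 + y t ≤ D := hyD t ht
    exact (by linarith : y t ≤ D).trans (le_max_left _ _)
  · filter_upwards [eventually_ge_atTop (T' + 1)] with t ht
    have ht0 : 0 < t := by linarith
    refine le_trans ?_ (le_max_right _ _)
    have hanti : AntitoneOn (fun s => y s + (∫ q in t..s, z q) - C * D ^ 2 * s) (Icc t (t + 1)) := by
      have hd : ∀ s ∈ Icc t (t + 1), HasDerivAt (fun s => y s + (∫ q in t..s, z q) - C * D ^ 2 * s)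
          (y' s + z s - C * D ^ 2 * 1) s := fun s hs =>
        ((hy s (ht0.trans_le hs.1)).add (hder hzc ht0 hs.1)).sub
          ((hasDerivAt_id s).const_mul (C * D ^ 2))
      refine antitoneOn_of_hasDerivWithinAt_nonpos (convex_Icc _ _)
        (fun s hs => (hd s hs).continuousAt.continuousWithinAt)
        (fun s hs => (hd s (interior_subset hs)).hasDerivWithinAt) fun s hs => ?_
      have hs' := interior_subset hs
      have h1 := (hT s (by linarith [hs'.1])).1
      have h2 : 1 + y s ≤ D := hyD s (ht.trans hs'.1)
      have h3 : (1 + y s) ^ 2 ≤ D ^ 2 := pow_le_pow_left₀ (by linarith [hy0 s]) h2 2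
      nlinarith
    have h1 := hanti (left_mem_Icc.2 (by linarith)) (right_mem_Icc.2 (by linarith)) (by linarith)
    simp only [intervalIntegral.integral_same] at h1
    have h2 : 1 + y t ≤ D := hyD t ht
    linarith [hy0 (t + 1)]

end

section

/-! ### Polynomials in the derivatives of the curvature -/

/-- `W Γ w m f`: on the space-time domain, `f` is a polynomial in `k, ∂ₛ k, …, ∂ₛ^m k`, of weight at
most `w`, where `∂ₛ^i k` has weight `i + 1`. -/
inductive W (Γ : ℝ × ℝ → Plane) : ℕ → ℕ → (ℝ × ℝ → ℝ) → Prop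
  | const (w m : ℕ) (c : ℝ) : W Γ w m (fun _ => c)
  | var {w m i : ℕ} : i ≤ m → i + 1 ≤ w → W Γ w m (kap Γ i)
  | add {w m : ℕ} {f g : ℝ × ℝ → ℝ} : W Γ w m f → W Γ w m g → W Γ w m (fun p => f p + g p)
  | mul {w w₁ w₂ m : ℕ} {f g : ℝ × ℝ → ℝ} : W Γ w₁ m f → W Γ w₂ m g → w₁ + w₂ ≤ w →
      W Γ w m (fun p => f p * g p)
  | congr {w m : ℕ} {f g : ℝ × ℝ → ℝ} : W Γ w m f → EqOn f g U → W Γ w m g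

/-- `Top Γ m f`: up to a nonzero factor and to terms of lower order, `f` is `∂ₛ^(m+2) k`. -/
def Top (Γ : ℝ × ℝ → Plane) (m : ℕ) (f : ℝ × ℝ → ℝ) : Prop :=
  ∃ c : ℝ, c ≠ 0 ∧ ∃ R, W Γ (m + 3) m R ∧ ∀ p ∈ U, f p = c * kap Γ (m + 2) p + R p

variable {Γ : ℝ × ℝ → Plane} {f g : ℝ × ℝ → ℝ} {w m : ℕ}

lemma W.mono (hf : W Γ w m f) : ∀ {w' m' : ℕ}, w ≤ w' → m ≤ m' → W Γ w' m' f := by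
  induction hf with
  | const w m c => exact fun _ _ => .const _ _ c
  | var hi hw => exact fun h1 h2 => .var (hi.trans h2) (hw.trans h1)
  | add _ _ h1 h2 => exact fun hw hm => .add (h1 hw hm) (h2 hw hm)
  | mul _ _ hle h1 h2 => exact fun hw hm => .mul (h1 le_rfl hm) (h2 le_rfl hm) (hle.trans hw)
  | congr _ he h1 => exact fun hw hm => .congr (h1 hw hm) he

lemma W.const_mul (c : ℝ) (hf : W Γ w m f) : W Γ w m (fun p => c * f p) :=
  .mul (w₁ := 0) (.const 0 m c) hf (by omega)

lemma W.mul' {w₁ w₂ m₁ m₂ : ℕ} (hf : W Γ w₁ m₁ f) (hg : W Γ w₂ m₂ g) (hw : w₁ + w₂ ≤ w)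
    (h₁ : m₁ ≤ m) (h₂ : m₂ ≤ m) : W Γ w m (fun p => f p * g p) :=
  .mul (hf.mono le_rfl h₁) (hg.mono le_rfl h₂) hw

namespace RegularFamily

variable (h : RegularFamily Γ)
include h

lemma sm_W (hf : W Γ w m f) : Sm f := by
  induction hf with
  | const w m c => exact Sm.const c
  | var => exact h.sm_kap _
  | add _ _ h1 h2 => exact h1.add h2
  | mul _ _ _ h1 h2 => exact h1.mul h2
  | congr _ he h1 => exact h1.congr' he

lemma W_Ds (hf : W Γ w m f) : W Γ (w + 1) (m + 1) (Ds Γ f) := by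
  induction hf with
  | const w m c => exact .congr (.const _ _ 0) fun p _ => (Ds_const c).symm
  | @var w m i hi hw => exact .var (i := i + 1) (by omega) (by omega)
  | add hf hg h1 h2 =>
    exact .congr (.add h1 h2) fun p hp => (Ds_add (h.sm_W hf) (h.sm_W hg) hp).symm
  | mul hf hg hle h1 h2 =>
    refine .congr (.add (.mul' hf h2 (by omega) (by omega) le_rfl)
      (.mul' h1 hg (by omega) le_rfl (by omega))) fun p hp =>
      (Ds_mul (h.sm_W hf) (h.sm_W hg) hp).symm
  | congr _ he h1 => exact .congr h1 (Ds_congr he)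

lemma sm_Top (hf : Top Γ m f) : Sm f := by
  obtain ⟨c, _, R, hR, he⟩ := hf
  exact (((Sm.const c).mul (h.sm_kap (m + 2))).add (h.sm_W hR)).congr' fun p hp => (he p hp).symm

lemma Top_Ds (hf : Top Γ m f) : Top Γ (m + 1) (Ds Γ f) := by
  obtain ⟨c, hc, R, hR, he⟩ := hf
  refine ⟨c, hc, Ds Γ R, h.W_Ds hR, fun p hp => ?_⟩
  rw [Ds_congr he hp, Ds_add ((Sm.const c).mul (h.sm_kap (m + 2))) (h.sm_W hR) hp,
    Ds_const_mul c (h.sm_kap _) hp]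
  rfl

end RegularFamily

lemma Top.W (hf : Top Γ m f) : W Γ (m + 3) (m + 2) f := by
  obtain ⟨c, hc, R, hR, he⟩ := hf
  exact .congr (.add (.const_mul c (.var le_rfl le_rfl)) (hR.mono le_rfl (by omega)))
    fun p hp => (he p hp).symm

namespace ElasticFamily

variable {μ : ℝ} (h : ElasticFamily μ Γ)
include h

lemma nvel_eq : ∃ R, W Γ 3 0 R ∧ ∀ p ∈ U, nvel Γ p = -2 * kap Γ 2 p + R p := by
  refine ⟨fun p => (-1) * (kap Γ 0 p * (kap Γ 0 p * kap Γ 0 p)) + μ * kap Γ 0 p,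
    ?_, fun p hp => ?_⟩
  · have hk : W Γ 1 0 (kap Γ 0) := .var le_rfl le_rfl
    exact .add (.const_mul _ (.mul hk (.mul (w := 2) hk hk le_rfl) le_rfl))
      (.const_mul _ (hk.mono (by omega) le_rfl))
  · rw [h.law p hp]; ring

lemma Top_nvel : Top Γ 0 (nvel Γ) := ⟨-2, by norm_num, h.nvel_eq⟩

/-- In weight and order, `Dt` costs as much as four arclength derivatives. The remainder is two
orders below the leading term, which is what makes it absorbable in the energy estimates. -/
lemma Dt_kap (i : ℕ) : ∃ R, W Γ (i + 5) (i + 2) R ∧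
    ∀ p ∈ U, Dt Γ (kap Γ i) p = -2 * kap Γ (i + 4) p + R p := by
  have hk : ∀ j, W Γ (j + 1) j (kap Γ j) := fun j => .var le_rfl le_rfl
  have hV := h.Top_nvel.W
  induction i with
  | zero =>
    obtain ⟨R, hR, he⟩ := h.nvel_eq
    have hRs := h.sm_W hR
    refine ⟨fun p => Ds Γ (Ds Γ R) p + (kap Γ 0 p * kap Γ 0 p) * nvel Γ p,
      .add (h.W_Ds (h.W_Ds hR)) (.mul' (W.mul (w := 2) (hk 0) (hk 0) le_rfl) hV le_rfl
        (by omega) le_rfl), fun p hp => ?_⟩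
    have e1 : ∀ p ∈ U, Ds Γ (nvel Γ) p = -2 * kap Γ 3 p + Ds Γ R p := fun p hp => by
      rw [Ds_congr he hp, Ds_add ((Sm.const (-2)).mul (h.sm_kap 2)) hRs hp,
        Ds_const_mul _ (h.sm_kap _) hp]
      rfl
    rw [h.Dt_curv hp, Ds_congr e1 hp, Ds_add ((Sm.const (-2)).mul (h.sm_kap 3)) (h.sm_Ds hRs) hp,
      Ds_const_mul _ (h.sm_kap _) hp, sq, add_assoc]
    rfl
  | succ i ih =>
    obtain ⟨R, hR, he⟩ := ih
    refine ⟨fun p => Ds Γ R p + (kap Γ 0 p * nvel Γ p) * kap Γ (i + 1) p, .add (h.W_Ds hR) ?_,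
      fun p hp => ?_⟩
    · exact .mul' (W.mul' (w := 4) (m := 2) (hk 0) hV le_rfl (by omega) le_rfl) (hk (i + 1))
        (by omega) (by omega) (by omega)
    · change Dt Γ (Ds Γ (kap Γ i)) p = _
      rw [h.Dt_Ds (h.sm_kap i) hp, Ds_congr he hp,
        Ds_add ((Sm.const _).mul (h.sm_kap _)) (h.sm_W hR) hp, Ds_const_mul _ (h.sm_kap _) hp,
        smul_eq_mul, add_assoc]
      rfl

lemma W_Dt (hf : W Γ w m f) : W Γ (w + 4) (m + 4) (Dt Γ f) := by
  induction hf with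
  | const w m c => exact .congr (.const _ _ 0) fun p _ => (Dt_const c).symm
  | @var w m i hi hw =>
    obtain ⟨R, hR, he⟩ := h.Dt_kap i
    exact .congr (.add (.const_mul (-2) (.var (i := i + 4) (by omega) (by omega)))
      (hR.mono (by omega) (by omega))) fun p hp => (he p hp).symm
  | add hf hg h1 h2 =>
    exact .congr (.add h1 h2) fun p hp => (Dt_add (h.sm_W hf) (h.sm_W hg) hp).symm
  | mul hf hg hle h1 h2 =>
    refine .congr (.add (.mul' hf h2 (by omega) (by omega) le_rfl)
      (.mul' h1 hg (by omega) le_rfl (by omega))) fun p hp =>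
      (Dt_mul (h.sm_W hf) (h.sm_W hg) hp).symm
  | congr _ he h1 => exact .congr h1 (Dt_congr he)

lemma Dt_Top_aux (hf : Top Γ m f) : ∃ c : ℝ, c ≠ 0 ∧ (∃ R, W Γ (m + 3) m R ∧
    ∀ p ∈ U, f p = c * kap Γ (m + 2) p + R p) ∧ ∃ R, W Γ (m + 7) (m + 4) R ∧
    ∀ p ∈ U, Dt Γ f p = c * (-2) * kap Γ (m + 6) p + R p := by
  obtain ⟨c, hc, R, hR, he⟩ := hf
  obtain ⟨S, hS, hSe⟩ := h.Dt_kap (m + 2)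
  refine ⟨c, hc, ⟨R, hR, he⟩, fun p => c * S p + Dt Γ R p,
    .add (.const_mul c hS) (h.W_Dt hR), fun p hp => ?_⟩
  rw [Dt_congr he hp, Dt_add ((Sm.const c).mul (h.sm_kap (m + 2))) (h.sm_W hR) hp,
    Dt_const_mul c (h.sm_kap _) hp, hSe p hp]
  ring

lemma Top_Dt (hf : Top Γ m f) : Top Γ (m + 4) (Dt Γ f) := by
  obtain ⟨c, hc, _, R, hR, he⟩ := h.Dt_Top_aux hf
  exact ⟨c * (-2), by simpa using hc, R, hR, he⟩

/-- `Dt f` and `-2 ∂ₛ⁴ f` have the same leading term `-2 c ∂ₛ^(m+6) k`. Thus functions comparable to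
a derivative of the curvature solve a linear fourth order parabolic equation up to terms two orders
lower. -/
lemma Top_evolution (hf : Top Γ m f) : ∃ R, W Γ (m + 7) (m + 4) R ∧
    ∀ p ∈ U, Dt Γ f p = -2 * Ds Γ (Ds Γ (Ds Γ (Ds Γ f))) p + R p := by
  obtain ⟨c, hc, ⟨S, hS, hSe⟩, R, hR, he⟩ := h.Dt_Top_aux hf
  have key : ∀ {j : ℕ} {a b : ℝ × ℝ → ℝ}, Sm b → (∀ p ∈ U, a p = c * kap Γ j p + b p) →
      ∀ p ∈ U, Ds Γ a p = c * kap Γ (j + 1) p + Ds Γ b p := fun {j a b} hb hab p hp => by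
    rw [Ds_congr hab hp, Ds_add ((Sm.const c).mul (h.sm_kap j)) hb hp,
      Ds_const_mul c (h.sm_kap _) hp]
    rfl
  have s0 := h.sm_W hS
  have s1 := h.sm_Ds s0
  have s2 := h.sm_Ds s1
  have e4 := key (h.sm_Ds s2) (key s2 (key s1 (key s0 hSe)))
  refine ⟨fun p => R p + 2 * Ds Γ (Ds Γ (Ds Γ (Ds Γ S))) p,
    .add hR (.const_mul 2 (h.W_Ds (h.W_Ds (h.W_Ds (h.W_Ds hS))))), fun p hp => ?_⟩
  rw [he p hp, e4 p hp]
  ring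

end ElasticFamily

/-! ### Bounds for large times -/

/-- `f` is bounded for large times. -/
def EvBdd (f : ℝ × ℝ → ℝ) : Prop := ∃ C, ∀ᶠ t in atTop, ∀ x ∈ I, |f (t, x)| ≤ C

/-- Sum of the absolute values of the curvature derivatives of order in `[a, b)`. -/
def absSum (Γ : ℝ × ℝ → Plane) (a b : ℕ) (p : ℝ × ℝ) : ℝ := ∑ i ∈ Finset.Ico a b, |kap Γ i p|

lemma absSum_nonneg (a b : ℕ) (p : ℝ × ℝ) : 0 ≤ absSum Γ a b p :=
  Finset.sum_nonneg fun _ _ => abs_nonneg _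

lemma absSum_mono (a : ℕ) {b b' : ℕ} (hb : b ≤ b') (p : ℝ × ℝ) :
    absSum Γ a b p ≤ absSum Γ a b' p :=
  Finset.sum_le_sum_of_subset_of_nonneg (Finset.Ico_subset_Ico_right hb) fun _ _ _ => abs_nonneg _

lemma le_absSum {a b i : ℕ} (ha : a ≤ i) (hb : i < b) (p : ℝ × ℝ) :
    |kap Γ i p| ≤ absSum Γ a b p :=
  Finset.single_le_sum (f := fun i => |kap Γ i p|) (fun _ _ => abs_nonneg _)
    (Finset.mem_Ico.2 ⟨ha, hb⟩)

/-- If the derivatives of the curvature of order less than `q` are bounded, then a polynomial of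
weight at most `2 q + 1` is bounded by an affine function of the other derivatives. -/
lemma W.abs_le {q : ℕ} (hq : ∀ i < q, EvBdd (kap Γ i)) (hf : W Γ w m f) (hw : w ≤ 2 * q + 1) :
    ∃ C > 0, ∀ᶠ t in atTop, ∀ x ∈ I, |f (t, x)| ≤ C * (1 + absSum Γ q (min (m + 1) w) (t, x)) := by
  induction hf with
  | const w m c =>
    refine ⟨|c| + 1, by positivity, Eventually.of_forall fun t x _ => ?_⟩
    have := absSum_nonneg (Γ := Γ) q (min (m + 1) w) (t, x)
    nlinarith [abs_nonneg c]
  | @var w m i hi hiw =>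
    rcases lt_or_ge i q with hiq | hiq
    · obtain ⟨C, hC⟩ := hq i hiq
      refine ⟨|C| + 1, by positivity, hC.mono fun t ht x hx => ?_⟩
      have h1 := absSum_nonneg (Γ := Γ) q (min (m + 1) w) (t, x)
      nlinarith [ht x hx, le_abs_self C, abs_nonneg C]
    · refine ⟨1, one_pos, Eventually.of_forall fun t x _ => ?_⟩
      have := le_absSum (Γ := Γ) hiq (show i < min (m + 1) w by omega) (t, x)
      linarith
  | @add w m f g _ _ h1 h2 =>
    obtain ⟨C, hC, h1⟩ := h1 hw
    obtain ⟨D, hD, h2⟩ := h2 hw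
    refine ⟨C + D, by positivity, ?_⟩
    filter_upwards [h1, h2] with t h1 h2 x hx
    linarith [abs_add_le (f (t, x)) (g (t, x)), h1 x hx, h2 x hx]
  | @mul w w₁ w₂ m f g _ _ hle h1 h2 =>
    obtain ⟨C, hC, h1⟩ := h1 (by omega)
    obtain ⟨D, hD, h2⟩ := h2 (by omega)
    refine ⟨C * D, by positivity, ?_⟩
    filter_upwards [h1, h2] with t h1 h2 x hx
    have e1 := h1 x hx
    have e2 := h2 x hx
    have m1 := absSum_mono (Γ := Γ) q (show min (m + 1) w₁ ≤ min (m + 1) w by omega) (t, x)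
    have m2 := absSum_mono (Γ := Γ) q (show min (m + 1) w₂ ≤ min (m + 1) w by omega) (t, x)
    rw [abs_mul]
    -- Since `w₁ + w₂ ≤ 2 q + 1`, one of the two weights is at most `q`. That factor contains only
    -- derivatives of order less than `q` and is bounded.
    rcases le_or_gt w₁ q with hw1 | hw1
    · have z : absSum Γ q (min (m + 1) w₁) (t, x) = 0 := by
        rw [absSum, Finset.Ico_eq_empty (by omega), Finset.sum_empty]
      rw [z, add_zero, mul_one] at e1
      calc _ ≤ C * (D * (1 + absSum Γ q (min (m + 1) w₂) (t, x))) := by gcongr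
        _ ≤ C * (D * (1 + absSum Γ q (min (m + 1) w) (t, x))) := by gcongr
        _ = _ := by ring
    · have z : absSum Γ q (min (m + 1) w₂) (t, x) = 0 := by
        rw [absSum, Finset.Ico_eq_empty (by omega), Finset.sum_empty]
      rw [z, add_zero, mul_one] at e2
      calc _ ≤ (C * (1 + absSum Γ q (min (m + 1) w₁) (t, x))) * D := by
            gcongr; have := absSum_nonneg (Γ := Γ) q (min (m + 1) w₁) (t, x); positivity
        _ ≤ (C * (1 + absSum Γ q (min (m + 1) w) (t, x))) * D := by gcongr
        _ = _ := by ring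
  | congr _ he h1 =>
    obtain ⟨C, hC, h1⟩ := h1 hw
    refine ⟨C, hC, ?_⟩
    filter_upwards [h1, eventually_gt_atTop 0] with t h1 ht x hx
    rw [← he (show (t, x) ∈ U from ⟨ht, hx⟩)]
    exact h1 x hx

/-- If the derivatives of the curvature of order less than `q` are bounded, then in a polynomial of
weight at most `q + 7` the other derivatives occur at most in products of two factors, one of which
has order `q`. -/
lemma W.abs_le_mul {q : ℕ} (hq4 : 4 ≤ q) (hq : ∀ i < q, EvBdd (kap Γ i)) (hf : W Γ w m f)
    (hw : w ≤ q + 7) : ∃ C > 0, ∀ᶠ t in atTop, ∀ x ∈ I,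
      |f (t, x)| ≤ C * ((1 + |kap Γ q (t, x)|) * (1 + absSum Γ q (m + 1) (t, x))) := by
  have base : ∀ {w m : ℕ} {f : ℝ × ℝ → ℝ}, W Γ w m f → w ≤ 2 * q + 1 →
      ∃ C > 0, ∀ᶠ t in atTop, ∀ x ∈ I,
      |f (t, x)| ≤ C * ((1 + |kap Γ q (t, x)|) * (1 + absSum Γ q (m + 1) (t, x))) := by
    intro w m f hf hw
    obtain ⟨C, hC, h1⟩ := hf.abs_le hq hw
    refine ⟨C, hC, h1.mono fun t h1 x hx => (h1 x hx).trans ?_⟩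
    have m1 := absSum_mono (Γ := Γ) q (show min (m + 1) w ≤ m + 1 by omega) (t, x)
    have m2 := absSum_nonneg (Γ := Γ) q (m + 1) (t, x)
    have : 0 ≤ |kap Γ q (t, x)| * (1 + absSum Γ q (m + 1) (t, x)) := by positivity
    gcongr
    linarith
  induction hf with
  | const w m c => exact base (w := 0) (.const 0 m c) (by omega)
  | @var w m i hi hiw =>
    rcases lt_or_ge i q with hiq | hiq
    · exact base (w := i + 1) (.var hi le_rfl) (by omega)
    · refine ⟨1, one_pos, Eventually.of_forall fun t x _ => ?_⟩
      have h1 := le_absSum (Γ := Γ) hiq (show i < m + 1 by omega) (t, x)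
      have h2 := abs_nonneg (kap Γ q (t, x))
      have h3 := absSum_nonneg (Γ := Γ) q (m + 1) (t, x)
      nlinarith
  | @add w m f g _ _ h1 h2 =>
    obtain ⟨C, hC, h1⟩ := h1 hw
    obtain ⟨D, hD, h2⟩ := h2 hw
    refine ⟨C + D, by positivity, ?_⟩
    filter_upwards [h1, h2] with t h1 h2 x hx
    linarith [abs_add_le (f (t, x)) (g (t, x)), h1 x hx, h2 x hx]
  | @mul w w₁ w₂ m f g hf hg hle h1 h2 =>
    have key : ∀ {w₁ w₂ : ℕ} {f g : ℝ × ℝ → ℝ}, W Γ w₁ m f → W Γ w₂ m g → w₁ + w₂ ≤ q + 7 →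
        w₁ ≤ w₂ → (∃ C > 0, ∀ᶠ t in atTop, ∀ x ∈ I,
          |g (t, x)| ≤ C * ((1 + |kap Γ q (t, x)|) * (1 + absSum Γ q (m + 1) (t, x)))) →
        ∃ C > 0, ∀ᶠ t in atTop, ∀ x ∈ I,
          |f (t, x) * g (t, x)| ≤
            C * ((1 + |kap Γ q (t, x)|) * (1 + absSum Γ q (m + 1) (t, x))) := by
      -- The lighter factor satisfies `2 w₁ ≤ q + 7`, so `w₁ ≤ q + 1` because `q ≥ 4`: the only
      -- unbounded derivative it can contain is `∂ₛ^q k`. If it does contain it, then `w₂ ≤ 6`, and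
      -- the other factor is affine in the unbounded derivatives by `W.abs_le`.
      intro w₁ w₂ f g hf hg hle hww h2
      obtain ⟨C, hC, h1⟩ := hf.abs_le hq (by omega)
      rcases le_or_gt w₁ q with hw1 | hw1
      · obtain ⟨D, hD, h2⟩ := h2
        refine ⟨C * D, by positivity, ?_⟩
        filter_upwards [h1, h2] with t h1 h2 x hx
        have e1 := h1 x hx
        have z : absSum Γ q (min (m + 1) w₁) (t, x) = 0 := by
          rw [absSum, Finset.Ico_eq_empty (by omega), Finset.sum_empty]
        rw [z, add_zero, mul_one] at e1
        rw [abs_mul, mul_assoc]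
        exact mul_le_mul e1 (h2 x hx) (abs_nonneg _) hC.le
      · obtain ⟨D, hD, h2⟩ := hg.abs_le hq (by omega)
        refine ⟨C * D, by positivity, ?_⟩
        filter_upwards [h1, h2] with t h1 h2 x hx
        have e1 := h1 x hx
        have e2 := h2 x hx
        have m1 := absSum_mono (Γ := Γ) q (show min (m + 1) w₁ ≤ q + 1 by omega) (t, x)
        have m2 := absSum_mono (Γ := Γ) q (show min (m + 1) w₂ ≤ m + 1 by omega) (t, x)
        have z : absSum Γ q (q + 1) (t, x) = |kap Γ q (t, x)| := by simp [absSum]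
        rw [z] at m1
        rw [abs_mul]
        calc _ ≤ (C * (1 + absSum Γ q (min (m + 1) w₁) (t, x))) *
              (D * (1 + absSum Γ q (min (m + 1) w₂) (t, x))) := by
              gcongr; have := absSum_nonneg (Γ := Γ) q (min (m + 1) w₁) (t, x); positivity
          _ ≤ (C * (1 + |kap Γ q (t, x)|)) * (D * (1 + absSum Γ q (m + 1) (t, x))) := by
              gcongr
              have := absSum_nonneg (Γ := Γ) q (min (m + 1) w₂) (t, x); positivity
          _ = _ := by ring
    rcases le_total w₁ w₂ with hww | hww
    · exact key hf hg (by omega) hww (h2 (by omega))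
    · obtain ⟨C, hC, h3⟩ := key hg hf (by omega) hww (h1 (by omega))
      exact ⟨C, hC, h3.mono fun t h3 x hx => by simpa only [mul_comm (f (t, x))] using h3 x hx⟩
  | congr _ he h1 =>
    obtain ⟨C, hC, h1⟩ := h1 hw
    refine ⟨C, hC, ?_⟩
    filter_upwards [h1, eventually_gt_atTop 0] with t h1 ht x hx
    rw [← he (show (t, x) ∈ U from ⟨ht, hx⟩)]
    exact h1 x hx

end

section

/-! ### Decay of the velocity -/

/-- At most exponential growth gives `y (t + 1) ≤ e^C y s` for `s` in `[t, t + 1]`; averaging over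
`s` bounds `y (t + 1)` by a multiple of the integral. -/
lemma tendsto_zero_of_integral {y y' : ℝ → ℝ} {C : ℝ} (hy0 : ∀ t, 0 ≤ y t)
    (hy : ∀ t > 0, HasDerivAt y (y' t) t) (hle : ∀ᶠ t in atTop, y' t ≤ C * y t)
    (hI : Tendsto (fun t => ∫ s in t..t + 1, y s) atTop (nhds 0)) : Tendsto y atTop (nhds 0) := by
  wlog hC : 0 < C generalizing C
  · exact this (C := 1) (hle.mono fun t h1 => h1.trans (by nlinarith [hy0 t])) one_pos
  have hyc : ContinuousOn y (Ioi 0) := fun t ht => (hy t ht).continuousAt.continuousWithinAt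
  obtain ⟨T, hT⟩ := eventually_atTop.1 hle
  have hbound : ∀ t ≥ max T 1, y (t + 1) ≤ Real.exp C * ∫ s in t..t + 1, y s := by
    intro t ht
    have ht1 : 0 < t := one_pos.trans_le ((le_max_right T 1).trans ht)
    have hanti : AntitoneOn (fun s => y s * Real.exp (-C * s)) (Icc t (t + 1)) := by
      have hd : ∀ s ∈ Icc t (t + 1), HasDerivAt (fun s => y s * Real.exp (-C * s))
          (y' s * Real.exp (-C * s) + y s * (Real.exp (-C * s) * (-C * 1))) s := fun s hs =>
        (hy s (ht1.trans_le hs.1)).mul (((hasDerivAt_id s).const_mul (-C)).exp)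
      refine antitoneOn_of_hasDerivWithinAt_nonpos (convex_Icc _ _)
        (fun s hs => (hd s hs).continuousAt.continuousWithinAt)
        (fun s hs => (hd s (interior_subset hs)).hasDerivWithinAt) fun s hs => ?_
      have hs' := interior_subset hs
      have h1 := hT s (((le_max_left T 1).trans ht).trans hs'.1)
      have h4 := Real.exp_pos (-C * s)
      nlinarith
    have hlow : ∀ s ∈ Icc t (t + 1), y (t + 1) ≤ Real.exp C * y s := by
      intro s hs
      have h1 : y (t + 1) * Real.exp (-C * (t + 1)) ≤ y s * Real.exp (-C * s) :=
        hanti hs (right_mem_Icc.2 (by linarith)) hs.2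
      have h2 := mul_le_mul_of_nonneg_right h1 (Real.exp_pos (C * (t + 1))).le
      rw [mul_assoc, mul_assoc, ← Real.exp_add, ← Real.exp_add] at h2
      have e1 : -C * (t + 1) + C * (t + 1) = 0 := by ring
      have e2 : Real.exp (-C * s + C * (t + 1)) ≤ Real.exp C :=
        Real.exp_le_exp.2 (by nlinarith [hs.1])
      rw [e1, Real.exp_zero, mul_one] at h2
      nlinarith [hy0 s]
    have hyint : IntervalIntegrable y MeasureTheory.volume t (t + 1) :=
      (hyc.mono fun s hs => by
        rw [uIcc_of_le (by linarith)] at hs; exact ht1.trans_le hs.1).intervalIntegrable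
    have := intervalIntegral.integral_mono_on (a := t) (b := t + 1) (by linarith)
      intervalIntegrable_const (hyint.const_mul (Real.exp C)) hlow
    simpa using this
  have h1 : Tendsto (fun t => y (t + 1)) atTop (nhds 0) := by
    refine squeeze_zero' (Eventually.of_forall fun t => hy0 _)
      ((eventually_ge_atTop _).mono hbound) ?_
    simpa using hI.const_mul (Real.exp C)
  have h2 := h1.comp (tendsto_atTop_add_const_right atTop (-1 : ℝ) tendsto_id)
  simpa [Function.comp_def] using h2

namespace ElasticFamily

variable {μ : ℝ} {Γ : ℝ × ℝ → Plane} (h : ElasticFamily μ Γ) {t : ℝ}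
include h

lemma exists_curv_le : ∃ C > 0, ∀ t ≥ 1, ∀ x ∈ I,
    kap Γ 0 (t, x) ^ 4 ≤ C * (1 + J Γ (fun p => kap Γ 1 p ^ 2) t) := by
  obtain ⟨M, hM, hMb⟩ := h.exists_bounds
  obtain ⟨C, hC, hCb⟩ := h.exists_inv_length_le
  refine ⟨(C * M + M + 1) ^ 2, by positivity, fun t ht x hx => ?_⟩
  have hY : 0 ≤ J Γ (fun p => kap Γ 1 p ^ 2) t := RegularFamily.J_sq_nonneg
  set Y := J Γ (fun p => kap Γ 1 p ^ 2) t
  -- This weight balances the two terms `a ∫ k²` and `a⁻¹ Y` of the Sobolev inequality, so that `k²`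
  -- grows only like `√(1 + Y)`.
  set a := Real.sqrt (1 + Y)
  have ha2 : a ^ 2 = 1 + Y := Real.sq_sqrt (by linarith)
  have ha1 : 1 ≤ a := Real.one_le_sqrt.2 (by linarith)
  have ha : 0 < a := by linarith
  have h1 : kap Γ 0 (t, x) ^ 2 ≤ (C + a) * M + a⁻¹ * Y :=
    (h.sq_le_J (h.sm_kap 0) (by linarith) ha hx).trans (by
      gcongr
      · exact RegularFamily.J_sq_nonneg
      · exact hCb t ht
      · exact (hMb t ht).1
      · exact le_rfl)
  have h2 : a⁻¹ * Y ≤ a := by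
    rw [inv_mul_le_iff₀ ha]; nlinarith
  have h3 : kap Γ 0 (t, x) ^ 2 ≤ (C * M + M + 1) * a := by
    nlinarith [mul_pos hC hM]
  calc kap Γ 0 (t, x) ^ 4 = (kap Γ 0 (t, x) ^ 2) ^ 2 := by ring
    _ ≤ ((C * M + M + 1) * a) ^ 2 := by gcongr
    _ = _ := by rw [mul_pow, ha2]

/-- The flow law expresses `∂ₛ² k` through `V`, `k³` and `k`. Here `∫ k⁶ ≤ sup k⁴ · ∫ k²` is
controlled by `∫ (∂ₛ k)²`, and interpolation with a small factor absorbs this into the left-hand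
side. -/
lemma exists_J_kap_two_le : ∃ C > 0, ∀ t ≥ 1,
    J Γ (fun p => kap Γ 2 p ^ 2) t ≤ C * (1 + J Γ (fun p => nvel Γ p ^ 2) t) := by
  obtain ⟨M, hM, hMb⟩ := h.exists_bounds
  obtain ⟨C, hC, hCb⟩ := h.exists_curv_le
  obtain ⟨D, hD, hDb⟩ := h.exists_kap_le 2 1 (by norm_num) (1 / (2 * C * M)) (by positivity)
  refine ⟨2 + 2 * (C * M * (1 + D) + μ ^ 2 * M), by positivity, fun t ht => ?_⟩
  have ht0 : 0 < t := by linarith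
  have hY : 0 ≤ J Γ (fun p => kap Γ 1 p ^ 2) t := RegularFamily.J_sq_nonneg
  have hZ : 0 ≤ J Γ (fun p => kap Γ 2 p ^ 2) t := RegularFamily.J_sq_nonneg
  have hy : 0 ≤ J Γ (fun p => nvel Γ p ^ 2) t := RegularFamily.J_sq_nonneg
  have h2 := hDb t ht
  have hk := (hMb t ht).1
  have hk0 : 0 ≤ J Γ (fun p => kap Γ 0 p ^ 2) t := RegularFamily.J_sq_nonneg
  have c0 := (h.sm_kap 0).continuousOn
  have c2 := (h.sm_kap 2).continuousOn
  have cV := h.sm_nvel.continuousOn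
  have hpt := hCb t ht
  set Y := J Γ (fun p => kap Γ 1 p ^ 2) t
  have h1 : J Γ (fun p => kap Γ 2 p ^ 2) t ≤ 3 / 4 * J Γ (fun p => nvel Γ p ^ 2) t
      + (3 / 4 * (C * (1 + Y)) + 3 / 4 * μ ^ 2) * J Γ (fun p => kap Γ 0 p ^ 2) t := by
    refine h.J_le₂ ht0 (by fun_prop) (by fun_prop) (by fun_prop) fun x hx => ?_
    have e1 := h.law (t, x) ⟨ht0, hx⟩
    have e2 := mul_le_mul_of_nonneg_right (hpt x hx) (sq_nonneg (kap Γ 0 (t, x)))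
    have e3 : kap Γ 2 (t, x) = -(nvel Γ (t, x) + kap Γ 0 (t, x) ^ 3 - μ * kap Γ 0 (t, x)) / 2 := by
      linarith
    rw [e3]
    nlinarith [sq_nonneg (nvel Γ (t, x) - kap Γ 0 (t, x) ^ 3),
      sq_nonneg (nvel Γ (t, x) + μ * kap Γ 0 (t, x)),
      sq_nonneg (kap Γ 0 (t, x) ^ 3 + μ * kap Γ 0 (t, x))]
  have h3 : (3 / 4 * (C * (1 + Y)) + 3 / 4 * μ ^ 2) * J Γ (fun p => kap Γ 0 p ^ 2) t
      ≤ (3 / 4 * (C * (1 + Y)) + 3 / 4 * μ ^ 2) * M := by gcongr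
  have h4 : C * M * Y ≤ J Γ (fun p => kap Γ 2 p ^ 2) t / 2 + C * M * D := by
    have := mul_le_mul_of_nonneg_left h2 (by positivity : 0 ≤ C * M)
    have e : C * M * (1 / (2 * C * M) * J Γ (fun p => kap Γ 2 p ^ 2) t + D)
      = J Γ (fun p => kap Γ 2 p ^ 2) t / 2 + C * M * D := by field_simp
    linarith
  have h5 : 0 ≤ (2 * (C * M * (1 + D) + μ ^ 2 * M)) * J Γ (fun p => nvel Γ p ^ 2) t := by positivity
  have h6 : 0 < C * M := by positivity
  have h7 : 0 < C * M * D := by positivity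
  have h8 : 0 ≤ μ ^ 2 * M := by positivity
  nlinarith

lemma exists_curv_le_nvel : ∃ C > 0, ∀ t ≥ 1, ∀ x ∈ I,
    kap Γ 0 (t, x) ^ 4 ≤ C * (1 + J Γ (fun p => nvel Γ p ^ 2) t) := by
  obtain ⟨C, hC, hCb⟩ := h.exists_curv_le
  obtain ⟨D, hD, hDb⟩ := h.exists_kap_le 2 1 (by norm_num) 1 one_pos
  obtain ⟨E, hE, hEb⟩ := h.exists_J_kap_two_le
  refine ⟨C * (1 + E + D), by positivity, fun t ht x hx => ?_⟩
  have hy : 0 ≤ J Γ (fun p => nvel Γ p ^ 2) t := RegularFamily.J_sq_nonneg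
  have h1 := hDb t ht
  have h2 := hEb t ht
  have h3 : 1 + J Γ (fun p => kap Γ 1 p ^ 2) t ≤
      (1 + E + D) * (1 + J Γ (fun p => nvel Γ p ^ 2) t) := by nlinarith
  calc _ ≤ _ := hCb t ht x hx
    _ ≤ C * ((1 + E + D) * (1 + J Γ (fun p => nvel Γ p ^ 2) t)) := by gcongr
    _ = _ := by ring

/-- Evolution of the normal velocity. -/
lemma Dt_nvel {p : ℝ × ℝ} (hp : p ∈ U) : Dt Γ (nvel Γ) p =
    -2 * Ds Γ (Ds Γ (Ds Γ (Ds Γ (nvel Γ)))) p + (μ - 5 * kap Γ 0 p ^ 2) * Ds Γ (Ds Γ (nvel Γ)) p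
      - 10 * kap Γ 0 p * kap Γ 1 p * Ds Γ (nvel Γ) p
      + (-6 * kap Γ 1 p ^ 2 - 8 * kap Γ 0 p * kap Γ 2 p - 3 * kap Γ 0 p ^ 4
        + μ * kap Γ 0 p ^ 2) * nvel Γ p := by
  have hk := h.sm_kap 0
  have hk1 := h.sm_kap 1
  have hV := h.sm_nvel
  have hV1 := h.sm_Ds hV
  have hV2 := h.sm_Ds hV1
  have hV3 := h.sm_Ds hV2
  have e1 : Dt Γ (nvel Γ) p =
      Dt Γ (fun q => (-2) * kap Γ 2 q + ((-1) * kap Γ 0 q ^ 3 + μ * kap Γ 0 q)) p :=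
    Dt_congr (fun q hq => by rw [h.law q hq]; ring) hp
  have e2 : ∀ q ∈ U, Ds Γ (Dt Γ (kap Γ 0)) q = Ds Γ (Ds Γ (Ds Γ (nvel Γ))) q +
      (kap Γ 0 q ^ 2 * Ds Γ (nvel Γ) q + 2 * (kap Γ 0 q * kap Γ 1 q * nvel Γ q)) := fun q hq => by
    rw [Ds_congr (fun r hr => h.Dt_curv hr) hq, Ds_add hV2 ((hk.pow 2).mul hV) hq,
      Ds_mul (hk.pow 2) hV hq, Ds_pow hk 2 hq]
    change _ + (_ + _ * kap Γ 1 q * _) = _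
    norm_num; ring
  have e3 : Ds Γ (Ds Γ (Dt Γ (kap Γ 0))) p = Ds Γ (Ds Γ (Ds Γ (Ds Γ (nvel Γ)))) p +
      (kap Γ 0 p ^ 2 * Ds Γ (Ds Γ (nvel Γ)) p + 4 * (kap Γ 0 p * kap Γ 1 p * Ds Γ (nvel Γ) p)
        + 2 * ((kap Γ 0 p * kap Γ 2 p + kap Γ 1 p ^ 2) * nvel Γ p)) := by
    rw [Ds_congr e2 hp, Ds_add hV3 (((hk.pow 2).mul hV1).add
      ((Sm.const 2).mul ((hk.mul hk1).mul hV))) hp,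
      Ds_add ((hk.pow 2).mul hV1) ((Sm.const 2).mul ((hk.mul hk1).mul hV)) hp,
      Ds_mul (hk.pow 2) hV1 hp, Ds_pow hk 2 hp, Ds_const_mul 2 ((hk.mul hk1).mul hV) hp,
      Ds_mul (hk.mul hk1) hV hp, Ds_mul hk hk1 hp]
    change _ + (_ + _ * kap Γ 1 p * _ + 2 * (_ + (_ * kap Γ 2 p + kap Γ 1 p * _) * _)) = _
    norm_num; ring
  have e4 := h.Dt_Ds_Ds hk hp
  change Dt Γ (kap Γ 2) p = _ + (2 * (_ * kap Γ 2 p) + _ * kap Γ 1 p) at e4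
  rw [e1, Dt_add ((Sm.const (-2)).mul (h.sm_kap 2)) (((Sm.const (-1)).mul (hk.pow 3)).add
    ((Sm.const μ).mul hk)) hp, Dt_add ((Sm.const (-1)).mul (hk.pow 3)) ((Sm.const μ).mul hk) hp,
    Dt_const_mul _ (h.sm_kap 2) hp, Dt_const_mul _ (hk.pow 3) hp, Dt_const_mul _ hk hp,
    Dt_pow hk 3 hp, e4, e3, h.Dt_curv hp]
  norm_num; ring

/-- Integration by parts has no boundary terms because `V` vanishes at the ends; the rest is
Cauchy-Schwarz. -/
lemma J_Ds_nvel_sq (ht : 0 < t) : J Γ (fun p => Ds Γ (nvel Γ) p ^ 2) t ^ 2 ≤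
    J Γ (fun p => nvel Γ p ^ 2) t * J Γ (fun p => Ds Γ (Ds Γ (nvel Γ)) p ^ 2) t := by
  have hV := h.sm_nvel
  have h1 := h.J_parts (h.sm_Ds hV) hV ht
  rw [h.nvel_end zero_mem_ends ht, h.nvel_end one_mem_ends ht] at h1
  have e1 : J Γ (fun p => Ds Γ (nvel Γ) p * Ds Γ (nvel Γ) p) t =
      J Γ (fun p => Ds Γ (nvel Γ) p ^ 2) t :=
    congrArg (fun F => J Γ F t) (funext fun p => (sq _).symm)
  rw [← e1, h1, mul_zero, mul_zero, sub_zero, zero_sub, neg_sq, mul_comm (J Γ _ t)]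
  exact h.J_mul_sq_le ht (h.sm_Ds (h.sm_Ds hV)).continuousOn hV.continuousOn

lemma nvel_sq_le (ht : 0 < t) {x : ℝ} (hx : x ∈ I) :
    nvel Γ (t, x) ^ 2 ≤ J Γ (fun _ => 1) t * J Γ (fun p => Ds Γ (nvel Γ) p ^ 2) t := by
  have hV := h.sm_nvel
  have h1 := h.norm_sub_le_J hV ht hx (left_mem_Icc.2 zero_le_one)
  rw [h.nvel_end zero_mem_ends ht, sub_zero] at h1
  have c1 := (h.sm_Ds hV).continuousOn
  have h2 := h.J_mul_sq_le ht (f := fun _ => (1 : ℝ)) (g := fun p => ‖Ds Γ (nvel Γ) p‖)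
    continuousOn_const c1.norm
  simp only [one_mul, one_pow, Real.norm_eq_abs, sq_abs] at h2 h1
  calc _ = |nvel Γ (t, x)| ^ 2 := (sq_abs _).symm
    _ ≤ _ := by gcongr
    _ ≤ _ := h2

/-- The exact derivatives of `k ∂ₛk V²` and `k² V ∂ₛV` integrate to zero, since `V` vanishes at the
ends. Subtracting suitable multiples removes `∂ₛ k`, and the flow law removes the remaining `∂ₛ² k`.
The error then involves only `k`, `V`, `∂ₛ V` and `∂ₛ² V`, so a pointwise bound for `k` suffices to
estimate it. -/
lemma J_nvel_evolution (ht : 0 < t) :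
    J Γ (fun p => Dt Γ (fun q => nvel Γ q ^ 2) p - kap Γ 0 p * nvel Γ p * nvel Γ p ^ 2) t =
      -4 * J Γ (fun p => Ds Γ (Ds Γ (nvel Γ)) p ^ 2) t
      + J Γ (fun p => 2 * (μ - 6 * kap Γ 0 p ^ 2) * nvel Γ p * Ds Γ (Ds Γ (nvel Γ)) p
        - 2 * kap Γ 0 p ^ 2 * Ds Γ (nvel Γ) p ^ 2 + kap Γ 0 p * nvel Γ p ^ 3
        - 4 * kap Γ 0 p ^ 4 * nvel Γ p ^ 2) t := by
  have hk := h.sm_kap 0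
  have hk1 := h.sm_kap 1
  have hV := h.sm_nvel
  have hV1 := h.sm_Ds hV
  have hV2 := h.sm_Ds hV1
  have hV4 := h.sm_Ds (h.sm_Ds hV2)
  have s1 := (hk.mul hk1).mul (hV.pow 2)
  have s2 := (hk.pow 2).mul (hV.mul hV1)
  have z1 := h.J_Ds s1 ht
  have z2 := h.J_Ds s2 ht
  simp only [h.nvel_end zero_mem_ends ht, h.nvel_end one_mem_ends ht] at z1 z2
  have p4 := h.J_parts_four hV hV h.bd_nvel h.bd_nvel ht
  have e1 : J Γ (fun p => Ds Γ (Ds Γ (nvel Γ)) p * Ds Γ (Ds Γ (nvel Γ)) p) t =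
      J Γ (fun p => Ds Γ (Ds Γ (nvel Γ)) p ^ 2) t :=
    congrArg (fun F => J Γ F t) (funext fun p => (sq _).symm)
  rw [e1] at p4
  have c0 := hk.continuousOn
  have cV := hV.continuousOn
  have cV1 := hV1.continuousOn
  have cV2 := hV2.continuousOn
  have cV4 := hV4.continuousOn
  have d1 := (h.sm_Ds s1).continuousOn
  have d2 := (h.sm_Ds s2).continuousOn
  rw [← p4, ← RegularFamily.J_const_mul]
  have key : J Γ (fun p => Dt Γ (fun q => nvel Γ q ^ 2) p - kap Γ 0 p * nvel Γ p * nvel Γ p ^ 2) t =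
      J Γ (fun p => (-4) * (nvel Γ p * Ds Γ (Ds Γ (Ds Γ (Ds Γ (nvel Γ)))) p) +
        ((2 * (μ - 6 * kap Γ 0 p ^ 2) * nvel Γ p * Ds Γ (Ds Γ (nvel Γ)) p
        - 2 * kap Γ 0 p ^ 2 * Ds Γ (nvel Γ) p ^ 2 + kap Γ 0 p * nvel Γ p ^ 3
        - 4 * kap Γ 0 p ^ 4 * nvel Γ p ^ 2) +
        ((-12) * Ds Γ (fun q => kap Γ 0 q * kap Γ 1 q * nvel Γ q ^ 2) p +
          2 * Ds Γ (fun q => kap Γ 0 q ^ 2 * (nvel Γ q * Ds Γ (nvel Γ) q)) p))) t := by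
    refine RegularFamily.J_congr ht fun p hp => ?_
    have e1 : nvel Γ p ^ 3 = -(2 * kap Γ 2 p + kap Γ 0 p ^ 3 - μ * kap Γ 0 p) * nvel Γ p ^ 2 := by
      rw [← h.law p hp]; ring
    rw [Dt_pow hV 2 hp, h.Dt_nvel hp, Ds_mul (hk.mul hk1) (hV.pow 2) hp, Ds_mul hk hk1 hp,
      Ds_pow hV 2 hp, Ds_mul (hk.pow 2) (hV.mul hV1) hp, Ds_mul hV hV1 hp, Ds_pow hk 2 hp]
    change _ = _ + (_ + ((-12) * (_ + (_ * kap Γ 2 p + kap Γ 1 p * _) * _) +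
      2 * (_ + _ * kap Γ 1 p * _)))
    norm_num
    linear_combination (-2 * kap Γ 0 p) * e1
  rw [key, h.J_add ht (by fun_prop) (by fun_prop), h.J_add ht (by fun_prop) (by fun_prop),
    h.J_add ht (by fun_prop) (by fun_prop), RegularFamily.J_const_mul (-12),
    RegularFamily.J_const_mul 2, z1, z2]
  ring

/-- The error keeps a factor `∫ V² ds`. It is therefore at most quadratic, as the uniform Gronwall
lemma requires, and it becomes linear once `∫ V² ds` is bounded, which then gives decay. -/
lemma exists_nvel_evolution_le : ∃ C > 0, ∀ t ≥ 1,
    J Γ (fun p => Dt Γ (fun q => nvel Γ q ^ 2) p - kap Γ 0 p * nvel Γ p * nvel Γ p ^ 2) t ≤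
      -J Γ (fun p => Ds Γ (Ds Γ (nvel Γ)) p ^ 2) t
      + C * ((1 + J Γ (fun p => nvel Γ p ^ 2) t) * J Γ (fun p => nvel Γ p ^ 2) t) := by
  obtain ⟨M, hM, hMb⟩ := h.exists_bounds
  obtain ⟨C, hC, hCb⟩ := h.exists_curv_le_nvel
  refine ⟨μ ^ 2 + 32 * C + ((1 + M) * M) ^ 2, by positivity, fun t ht => ?_⟩
  have ht0 : 0 < t := by linarith
  rw [h.J_nvel_evolution ht0]
  have hk := (hMb t ht).1
  have hL := (hMb t ht).2
  have hV := h.sm_nvel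
  have c0 := (h.sm_kap 0).continuousOn
  have cV := hV.continuousOn
  have cV1 := (h.sm_Ds hV).continuousOn
  have cV2 := (h.sm_Ds (h.sm_Ds hV)).continuousOn
  have hpt := hCb t ht
  have hV1 := h.J_Ds_nvel_sq ht0
  have hsup := fun x hx => h.nvel_sq_le ht0 (x := x) hx
  have hz : 0 ≤ J Γ (fun p => Ds Γ (Ds Γ (nvel Γ)) p ^ 2) t := RegularFamily.J_sq_nonneg
  have hy : 0 ≤ J Γ (fun p => nvel Γ p ^ 2) t := RegularFamily.J_sq_nonneg
  have hu : 0 ≤ J Γ (fun p => Ds Γ (nvel Γ) p ^ 2) t := RegularFamily.J_sq_nonneg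
  set y := J Γ (fun p => nvel Γ p ^ 2) t
  set z := J Γ (fun p => Ds Γ (Ds Γ (nvel Γ)) p ^ 2) t
  set u := J Γ (fun p => Ds Γ (nvel Γ) p ^ 2) t
  -- The weight for the cubic term: `k V³ ≤ S (a⁻¹ V² + a k²)` with `V² ≤ S`. Since `a⁻¹ y ≤ a` and
  -- `∫ k²` is bounded, both parts integrate to a multiple of `S a`.
  set a := Real.sqrt (1 + y)
  have ha2 : a ^ 2 = 1 + y := Real.sq_sqrt (by linarith)
  have ha1 : 1 ≤ a := Real.one_le_sqrt.2 (by linarith)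
  have ha : 0 < a := by linarith
  set S := M * u
  have hS : 0 ≤ S := by positivity
  have hB : J Γ (fun p => 2 * (μ - 6 * kap Γ 0 p ^ 2) * nvel Γ p * Ds Γ (Ds Γ (nvel Γ)) p
        - 2 * kap Γ 0 p ^ 2 * Ds Γ (nvel Γ) p ^ 2 + kap Γ 0 p * nvel Γ p ^ 3
        - 4 * kap Γ 0 p ^ 4 * nvel Γ p ^ 2) t ≤
      2 * z + (μ ^ 2 + 32 * (C * (1 + y)) + S * a⁻¹) * y
        + (S * a) * J Γ (fun p => kap Γ 0 p ^ 2) t := by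
    refine h.J_le₃ ht0 (by fun_prop) (by fun_prop) (by fun_prop) (by fun_prop) fun x hx => ?_
    have b1 := mul_le_mul_of_nonneg_right (hpt x hx) (sq_nonneg (nvel Γ (t, x)))
    have b2 : nvel Γ (t, x) ^ 2 ≤ S := (hsup x hx).trans (mul_le_mul_of_nonneg_right hL hu)
    generalize kap Γ 0 (t, x) = k at *
    generalize nvel Γ (t, x) = V at *
    generalize Ds Γ (nvel Γ) (t, x) = V1 at *
    generalize Ds Γ (Ds Γ (nvel Γ)) (t, x) = V2 at *
    have b3 : k * V ≤ a⁻¹ * V ^ 2 + a * k ^ 2 := by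
      have e1 : 0 ≤ a⁻¹ * (V - a * k / 2) ^ 2 := by positivity
      have e2 : a⁻¹ * (V - a * k / 2) ^ 2 = a⁻¹ * V ^ 2 + a * k ^ 2 / 4 - k * V := by
        field_simp; ring
      nlinarith [mul_nonneg ha.le (sq_nonneg k)]
    have b4 : 0 ≤ a⁻¹ * V ^ 2 + a * k ^ 2 := by positivity
    have b5 : k * V ^ 3 ≤ S * (a⁻¹ * V ^ 2 + a * k ^ 2) :=
      calc k * V ^ 3 = V ^ 2 * (k * V) := by ring
        _ ≤ V ^ 2 * (a⁻¹ * V ^ 2 + a * k ^ 2) := by gcongr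
        _ ≤ _ := by gcongr
    nlinarith [sq_nonneg (V2 - μ * V), sq_nonneg (V2 + 6 * k ^ 2 * V), sq_nonneg (k * V1)]
  have h1 : (S * a) * J Γ (fun p => kap Γ 0 p ^ 2) t ≤ (S * a) * M := by gcongr
  have h2 : S * a⁻¹ * y ≤ S * a := by
    have : a⁻¹ * y ≤ a := by rw [inv_mul_le_iff₀ ha]; nlinarith
    calc S * a⁻¹ * y = S * (a⁻¹ * y) := by ring
      _ ≤ _ := by gcongr
  -- `S = M u` and `u² ≤ y z`, so the square of the left side is a product of `z` and the last term.
  have h3 : (1 + M) * (S * a) ≤ z + ((1 + M) * M) ^ 2 * ((1 + y) * y) := by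
    set q := ((1 + M) * M) ^ 2 * ((1 + y) * y)
    have hq : 0 ≤ q := by positivity
    refine abs_le_of_sq_le_sq' ?_ (by positivity) |>.2
    calc ((1 + M) * (S * a)) ^ 2 = ((1 + M) * M) ^ 2 * a ^ 2 * u ^ 2 := by ring
      _ ≤ ((1 + M) * M) ^ 2 * a ^ 2 * (y * z) := by gcongr
      _ = q * z := by rw [ha2]; ring
      _ ≤ (z + q) ^ 2 := by nlinarith [mul_nonneg hq hz]
  nlinarith [mul_nonneg (sq_nonneg μ) (mul_nonneg hy hy)]

lemma tendsto_integral_nvel :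
    Tendsto (fun t => ∫ s in t..t + 1, J Γ (fun p => nvel Γ p ^ 2) s) atTop (nhds 0) := by
  set E := J Γ (fun p => kap Γ 0 p ^ 2 + μ)
  -- The energy is monotone only for positive times; freezing it before time `1` gives a monotone
  -- function on the line. It is bounded below, hence converges, and its increments over unit
  -- intervals tend to zero.
  have hanti : Antitone (fun t => E (max t 1)) := fun s t hst =>
    h.energy_antitone (mem_Ioi.2 (one_pos.trans_le (le_max_right _ _)))
      (mem_Ioi.2 (one_pos.trans_le (le_max_right _ _))) (max_le_max_right 1 hst)
  have hbdd : BddBelow (range fun t => E (max t 1)) := ⟨0, by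
    rintro _ ⟨t, rfl⟩
    exact RegularFamily.J_nonneg fun x _ => add_nonneg (sq_nonneg _) h.pos.le⟩
  have hlim := tendsto_atTop_ciInf hanti hbdd
  have hlim1 := hlim.comp (tendsto_atTop_add_const_right atTop (1 : ℝ) tendsto_id)
  have h1 := hlim.sub hlim1
  rw [sub_self] at h1
  refine h1.congr' ?_
  filter_upwards [eventually_ge_atTop 1] with t ht
  have ht0 : 0 < t := by linarith
  have hc : ContinuousOn (fun s => -J Γ (fun p => nvel Γ p ^ 2) s) (uIcc t (t + 1)) := by
    rw [uIcc_of_le (by linarith)]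
    exact fun s hs => (h.hasDerivAt_J' (h.sm_nvel.pow 2)
      (ht0.trans_le hs.1)).continuousAt.continuousWithinAt.neg
  have h2 := intervalIntegral.integral_eq_sub_of_hasDerivAt (a := t) (b := t + 1) (fun s hs => by
    rw [uIcc_of_le (by linarith)] at hs
    exact h.hasDerivAt_energy (ht0.trans_le hs.1)) hc.intervalIntegrable
  rw [intervalIntegral.integral_neg] at h2
  simp only [Function.comp_apply, id]
  rw [max_eq_left ht, max_eq_left (by linarith)]
  linarith

/-- Bounds for the normal velocity, which tends to zero. -/
lemma nvel_bounds :
    (∃ D, (∀ᶠ t in atTop, J Γ (fun p => nvel Γ p ^ 2) t ≤ D) ∧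
      ∀ᶠ t in atTop, ∫ s in t..t + 1, J Γ (fun p => Ds Γ (Ds Γ (nvel Γ)) p ^ 2) s ≤ D) ∧
    Tendsto (J Γ (fun p => nvel Γ p ^ 2)) atTop (nhds 0) := by
  obtain ⟨C, hC, hCb⟩ := h.exists_nvel_evolution_le
  have hV2 := h.sm_Ds (h.sm_Ds h.sm_nvel)
  have hbd := uniform_gronwall (B := 1) (C := C)
    (fun t => RegularFamily.J_sq_nonneg (Γ := Γ) (f := nvel Γ) (t := t))
    (fun t => RegularFamily.J_sq_nonneg (Γ := Γ) (f := Ds Γ (Ds Γ (nvel Γ))) (t := t))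
    (fun t ht => (h.hasDerivAt_J' (hV2.pow 2) ht).continuousAt.continuousWithinAt)
    (fun t ht => h.hasDerivAt_J' (h.sm_nvel.pow 2) ht)
    (by
      filter_upwards [eventually_ge_atTop 1] with t ht
      refine (hCb t ht).trans ?_
      have : 0 ≤ J Γ (fun p => nvel Γ p ^ 2) t := RegularFamily.J_sq_nonneg
      gcongr
      nlinarith)
    (h.tendsto_integral_nvel.eventually (eventually_le_nhds one_pos))
  refine ⟨hbd, ?_⟩
  obtain ⟨D, hD, _⟩ := hbd
  refine tendsto_zero_of_integral (C := C * (1 + D))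
    (fun t => RegularFamily.J_sq_nonneg) (fun t ht => h.hasDerivAt_J' (h.sm_nvel.pow 2) ht) ?_
    h.tendsto_integral_nvel
  filter_upwards [eventually_ge_atTop 1, hD] with t ht hDt
  refine (hCb t ht).trans ?_
  have h1 : 0 ≤ J Γ (fun p => nvel Γ p ^ 2) t := RegularFamily.J_sq_nonneg
  have h2 : 0 ≤ J Γ (fun p => Ds Γ (Ds Γ (nvel Γ)) p ^ 2) t := RegularFamily.J_sq_nonneg
  have h3 : C * ((1 + J Γ (fun p => nvel Γ p ^ 2) t) * J Γ (fun p => nvel Γ p ^ 2) t) ≤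
      C * ((1 + D) * J Γ (fun p => nvel Γ p ^ 2) t) := by gcongr
  linarith

end ElasticFamily

end

/-! ### Estimates for the second derivative of the velocity -/

section

/-- Sum of the squares of the curvature derivatives of order less than `n`. -/
def sqSum (Γ : ℝ × ℝ → Plane) (n : ℕ) (p : ℝ × ℝ) : ℝ := ∑ i ∈ Finset.range n, kap Γ i p ^ 2

lemma one_add_absSum_sq_le (Γ : ℝ × ℝ → Plane) (q n : ℕ) (p : ℝ × ℝ) :
    (1 + absSum Γ q n p) ^ 2 ≤ (n + 1) * (1 + sqSum Γ n p) := by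
  have h1 := sq_sum_le_card_mul_sum_sq (s := Finset.range (n + 1))
    (f := fun i => if i = 0 then (1 : ℝ) else |kap Γ (i - 1) p|)
  rw [Finset.sum_range_succ', Finset.sum_range_succ'] at h1
  simp only [Finset.card_range, if_true, Nat.succ_ne_zero, if_false, Nat.add_sub_cancel, sq_abs,
    one_pow] at h1
  push_cast at h1
  have h2 : absSum Γ q n p ≤ ∑ i ∈ Finset.range n, |kap Γ i p| :=
    Finset.sum_le_sum_of_subset_of_nonneg (fun i hi =>
      Finset.mem_range.2 (Finset.mem_Ico.1 hi).2) fun _ _ _ => abs_nonneg _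
  have h3 := absSum_nonneg (Γ := Γ) q n p
  have h4 : (1 + absSum Γ q n p) ^ 2 ≤ (∑ i ∈ Finset.range n, |kap Γ i p| + 1) ^ 2 := by
    exact pow_le_pow_left₀ (by linarith) (by linarith) 2
  rw [sqSum, add_comm (1 : ℝ) (∑ _ ∈ _, _)]
  exact h4.trans h1

lemma RegularFamily.continuousOn_sqSum {Γ : ℝ × ℝ → Plane} (h : RegularFamily Γ) (n : ℕ) :
    ContinuousOn (sqSum Γ n) U :=
  continuousOn_finsetSum _ fun i _ => (h.sm_kap i).continuousOn.pow 2

/-- Elementary estimate for the lower order terms in the evolution of the normal velocity. -/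
lemma error_sq_le {k k1 V V1 V2 μ N S : ℝ} (hμ : 0 < μ) (hN : 0 < N) (hk : |k| ≤ N)
    (hk1 : |k1| ≤ N) (hV : V ^ 2 ≤ S) :
    ((μ - 5 * k ^ 2) * V2 + (-10 * (k * k1)) * V1 + (-6 * k1 ^ 2 + k ^ 4 - 3 * μ * k ^ 2) * V
      + (4 * k) * V ^ 2) ^ 2 ≤ 4 * ((μ + 5 * N ^ 2) + 10 * N ^ 2
        + (6 * N ^ 2 + N ^ 4 + 3 * μ * N ^ 2) + 4 * N) ^ 2 * (V2 ^ 2 + V1 ^ 2 + (1 + S) * V ^ 2) := by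
  set n := (μ + 5 * N ^ 2) + 10 * N ^ 2 + (6 * N ^ 2 + N ^ 4 + 3 * μ * N ^ 2) + 4 * N with hn
  have bk : k ^ 2 ≤ N ^ 2 := sq_le_sq' (abs_le.1 hk).1 (abs_le.1 hk).2
  have bk1 : k1 ^ 2 ≤ N ^ 2 := sq_le_sq' (abs_le.1 hk1).1 (abs_le.1 hk1).2
  have bkk : |k * k1| ≤ N ^ 2 := by
    rw [abs_mul, sq]; exact mul_le_mul hk hk1 (abs_nonneg _) hN.le
  have bk4 : k ^ 4 ≤ N ^ 4 := by
    calc k ^ 4 = (k ^ 2) ^ 2 := by ring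
      _ ≤ (N ^ 2) ^ 2 := by gcongr
      _ = N ^ 4 := by ring
  have q0 : 0 ≤ k ^ 2 := sq_nonneg _
  have q0' : 0 ≤ k1 ^ 2 := sq_nonneg _
  have q1 : 0 ≤ N ^ 2 := by positivity
  have q2 : 0 ≤ N ^ 4 := by positivity
  have q3 : 0 ≤ μ * N ^ 2 := by positivity
  have q4 : μ * k ^ 2 ≤ μ * N ^ 2 := by gcongr
  have q5 : 0 ≤ μ * k ^ 2 := by positivity
  have q6 : 0 ≤ k ^ 4 := by positivity
  have a1 := abs_le.1 bkk
  have a2 := abs_le.1 hk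
  have r2 : (μ - 5 * k ^ 2) ^ 2 ≤ n ^ 2 := sq_le_sq' (by linarith) (by linarith)
  have r1 : (-10 * (k * k1)) ^ 2 ≤ n ^ 2 := sq_le_sq' (by linarith) (by linarith)
  have r0 : (-6 * k1 ^ 2 + k ^ 4 - 3 * μ * k ^ 2) ^ 2 ≤ n ^ 2 :=
    sq_le_sq' (by linarith) (by linarith)
  have r3 : (4 * k) ^ 2 ≤ n ^ 2 := sq_le_sq' (by linarith) (by linarith)
  have four : ∀ a b c d : ℝ, (a + b + c + d) ^ 2 ≤ 4 * (a ^ 2 + b ^ 2 + c ^ 2 + d ^ 2) := by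
    intro a b c d
    nlinarith [sq_nonneg (a - b), sq_nonneg (a - c), sq_nonneg (a - d), sq_nonneg (b - c),
      sq_nonneg (b - d), sq_nonneg (c - d)]
  refine (four _ _ _ _).trans ?_
  have w2 := mul_le_mul_of_nonneg_right r2 (sq_nonneg V2)
  have w1 := mul_le_mul_of_nonneg_right r1 (sq_nonneg V1)
  have w0 := mul_le_mul_of_nonneg_right r0 (sq_nonneg V)
  have w3 := mul_le_mul_of_nonneg_right r3 (sq_nonneg (V ^ 2))
  have w4 : n ^ 2 * (V ^ 2) ^ 2 ≤ n ^ 2 * (S * V ^ 2) := by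
    rw [sq (V ^ 2)]; gcongr
  rw [mul_pow, mul_pow, mul_pow (-6 * k1 ^ 2 + k ^ 4 - 3 * μ * k ^ 2), mul_pow (4 * k)]
  linarith

/-- Here `u0`, `u1`, `y` stand for the squared L² norms of `V`, `∂ₛ V`, `∂ₛ² V`, and `Q (1 + y)` for
a pointwise bound of `V²`. As `u0` is bounded and `u1` is interpolated, the total error is quadratic
in `1 + y`, the form needed for `uniform_gronwall`. -/
lemma quadratic_error_le {a N Q D E y u0 u1 : ℝ} (ha : 0 ≤ a) (hN : 0 ≤ N) (hQ : 0 ≤ Q)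
    (hD : 0 ≤ D) (hE : 0 ≤ E) (hy : 0 ≤ y) (hu1 : 0 ≤ u1) (h0 : u0 ≤ D) (h1 : u1 ≤ y + E * D) :
    a * (y + u1 + (1 + Q * (1 + y)) * u0)
      + ((5 * (N * (1 + 2 * (Q * (1 + y))))) * y + (2 * (N * (1 + 2 * (Q * (1 + y))))) * u1) ≤
    (a * (2 + E * D + D + Q * D) + N * (1 + 2 * Q) * (7 + 2 * (E * D))) * (1 + y) ^ 2 := by
  have hED : 0 ≤ E * D := by positivity
  have k1 : y + u1 + (1 + Q * (1 + y)) * u0 ≤ (2 + E * D + D + Q * D) * (1 + y) ^ 2 := by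
    have e0 : (1 + Q * (1 + y)) * u0 ≤ (1 + Q * (1 + y)) * D := by gcongr
    have e1 : (2 + E * D + D + Q * D) * (1 + y) = 2 + E * D + D + Q * D * (1 + y)
      + 2 * y + E * D * y + D * y := by ring
    have e2 : 0 ≤ E * D * y := by positivity
    have e3 : 0 ≤ D * y := by positivity
    have e4 : (2 + E * D + D + Q * D) * (1 + y) ≤ (2 + E * D + D + Q * D) * (1 + y) ^ 2 := by
      gcongr; nlinarith
    linarith
  have k2 : (1 + 2 * (Q * (1 + y))) * (5 * y + 2 * u1) ≤
      ((1 + 2 * Q) * (1 + y)) * ((7 + 2 * (E * D)) * (1 + y)) := by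
    have e1 : 1 + 2 * (Q * (1 + y)) ≤ (1 + 2 * Q) * (1 + y) := by linarith
    have e2 : 5 * y + 2 * u1 ≤ (7 + 2 * (E * D)) * (1 + y) := by
      linarith [mul_nonneg hED hy]
    gcongr
  have m1 := mul_le_mul_of_nonneg_left k1 ha
  have m2 := mul_le_mul_of_nonneg_left k2 hN
  linarith

/-- The left side collects what the commutator of `Dt` with `∂ₛ²` and the change of the length
element contribute to the evolution of `∫ (∂ₛ² V)²`. -/
lemma cubic_error_le {k k1 V V1 V2 N S : ℝ} (hN : 0 < N) (hk : |k| ≤ N) (hk1 : |k1| ≤ N)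
    (hV : V ^ 2 ≤ S) (hV1 : V1 ^ 2 ≤ 2 * S) :
    3 * k * V * V2 ^ 2 + 2 * (k * V1 + k1 * V) * V1 * V2 ≤
      (5 * (N * (1 + 2 * S))) * V2 ^ 2 + (2 * (N * (1 + 2 * S))) * V1 ^ 2 := by
  have c0 : |V| ≤ 1 + 2 * S := by
    rw [abs_le]; constructor <;> nlinarith [sq_nonneg (V - 1), sq_nonneg (V + 1)]
  have c1 : |V1| ≤ 1 + 2 * S := by
    rw [abs_le]; constructor <;> nlinarith [sq_nonneg (V1 - 1), sq_nonneg (V1 + 1)]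
  have d0 : |k * V| ≤ N * (1 + 2 * S) := by
    rw [abs_mul]; exact mul_le_mul hk c0 (abs_nonneg _) hN.le
  have d1 : |k * V1| ≤ N * (1 + 2 * S) := by
    rw [abs_mul]; exact mul_le_mul hk c1 (abs_nonneg _) hN.le
  have d2 : |k1 * V| ≤ N * (1 + 2 * S) := by
    rw [abs_mul]; exact mul_le_mul hk1 c0 (abs_nonneg _) hN.le
  set T := N * (1 + 2 * S)
  have d3 : |k * V1 + k1 * V| ≤ 2 * T := (abs_add_le _ _).trans (by linarith)
  have f1 : k * V * V2 ^ 2 ≤ T * V2 ^ 2 :=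
    mul_le_mul_of_nonneg_right (abs_le.1 d0).2 (sq_nonneg _)
  have f2 : (k * V1 + k1 * V) * (2 * (V1 * V2)) ≤ 2 * T * (V1 ^ 2 + V2 ^ 2) := by
    have e1 : |2 * (V1 * V2)| ≤ V1 ^ 2 + V2 ^ 2 := by
      rw [abs_le]; constructor <;> nlinarith [sq_nonneg (V1 - V2), sq_nonneg (V1 + V2)]
    calc _ ≤ |(k * V1 + k1 * V) * (2 * (V1 * V2))| := le_abs_self _
      _ = |k * V1 + k1 * V| * |2 * (V1 * V2)| := abs_mul _ _
      _ ≤ _ := mul_le_mul d3 e1 (abs_nonneg _) ((abs_nonneg _).trans d3)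
  linarith

namespace ElasticFamily

variable {μ : ℝ} {Γ : ℝ × ℝ → Plane} (h : ElasticFamily μ Γ)
include h

lemma exists_J_sqSum_le {n m : ℕ} (hn : n ≤ m) : ∀ ε > 0, ∃ D > 0, ∀ t ≥ 1,
    J Γ (sqSum Γ n) t ≤ ε * J Γ (fun p => kap Γ m p ^ 2) t + D := by
  induction n with
  | zero =>
    intro ε hε
    refine ⟨1, one_pos, fun t _ => ?_⟩
    have h1 : 0 ≤ J Γ (fun p => kap Γ m p ^ 2) t := RegularFamily.J_sq_nonneg
    have e : J Γ (sqSum Γ 0) t = 0 := by simp [J, sqSum]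
    rw [e]; positivity
  | succ n ih =>
    intro ε hε
    obtain ⟨D, hD, hDb⟩ := ih (by omega) (ε / 2) (half_pos hε)
    obtain ⟨E, hE, hEb⟩ := h.exists_kap_le m n (by omega) (ε / 2) (half_pos hε)
    refine ⟨D + E, by positivity, fun t ht => ?_⟩
    have e : sqSum Γ (n + 1) = fun p => sqSum Γ n p + kap Γ n p ^ 2 :=
      funext fun p => Finset.sum_range_succ _ _
    have c1 := h.continuousOn_sqSum n
    have c2 := (h.sm_kap n).continuousOn
    rw [e, h.J_add (by linarith) (by fun_prop) (by fun_prop)]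
    linarith [hEb t ht, hDb t ht]

/-- Interpolation gives L² bounds for all orders up to `m`, and the passage to pointwise bounds
costs one derivative. -/
lemma evBdd_of_J {m : ℕ} {D : ℝ} (hD : ∀ᶠ t in atTop, J Γ (fun p => kap Γ m p ^ 2) t ≤ D) :
    ∀ i < m, EvBdd (kap Γ i) := by
  have key : ∀ i ≤ m, ∃ D, ∀ᶠ t in atTop, J Γ (fun p => kap Γ i p ^ 2) t ≤ D := fun i hi => by
    rcases hi.lt_or_eq with hi | rfl
    · obtain ⟨C, hC, hCb⟩ := h.exists_kap_le m i hi 1 one_pos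
      refine ⟨D + C, ?_⟩
      filter_upwards [hD, eventually_ge_atTop 1] with t h1 h2
      linarith [hCb t h2]
    · exact ⟨D, hD⟩
  intro i hi
  obtain ⟨C, hC, hCb⟩ := h.exists_sq_le
  obtain ⟨D₁, h1⟩ := key i hi.le
  obtain ⟨D₂, h2⟩ := key (i + 1) hi
  refine ⟨Real.sqrt (C * (D₁ + D₂)), ?_⟩
  filter_upwards [h1, h2, eventually_ge_atTop 1] with t h1 h2 h3 x hx
  apply Real.abs_le_sqrt
  refine (hCb (kap Γ i) (h.sm_kap i) t h3 x hx).trans ?_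
  change C * (_ + J Γ (fun p => kap Γ (i + 1) p ^ 2) t) ≤ _
  gcongr

/-- Integrals of a function with bounded coefficients that is comparable to `∂ₛ^(m+2) k`. -/
lemma J_kap_le_of_Top {m q : ℕ} {G : ℝ × ℝ → ℝ} (hG : Top Γ m G) (hqm : m + 3 ≤ 2 * q + 1)
    (hq : ∀ i < q, EvBdd (kap Γ i)) : ∃ C > 0, ∀ᶠ t in atTop,
      J Γ (fun p => kap Γ (m + 2) p ^ 2) t ≤ C * (1 + J Γ (fun p => G p ^ 2) t) ∧
      J Γ (fun p => G p ^ 2) t ≤ C * (1 + J Γ (fun p => kap Γ (m + 2) p ^ 2) t) := by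
  have sG := (h.sm_Top hG).continuousOn
  obtain ⟨c, hc, R, hR, he⟩ := hG
  obtain ⟨M, hM, hMb⟩ := h.exists_bounds
  obtain ⟨C, hC, hCb⟩ := hR.abs_le hq hqm
  have ck := fun i => (h.sm_kap i).continuousOn
  have sR := (h.sm_W hR).continuousOn
  have cs := h.continuousOn_sqSum (m + 1)
  have hJR : ∀ ε > 0, ∃ D > 0, ∀ᶠ t in atTop,
      J Γ (fun p => R p ^ 2) t ≤ ε * J Γ (fun p => kap Γ (m + 2) p ^ 2) t + D := by
    intro ε hε
    obtain ⟨D, hD, hDb⟩ := h.exists_J_sqSum_le (n := m + 1) (m := m + 2) (by omega)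
      (ε / (C ^ 2 * (m + 2))) (by positivity)
    refine ⟨C ^ 2 * (m + 2) * (M + D), by positivity, ?_⟩
    filter_upwards [hCb, eventually_ge_atTop 1] with t h1 h3
    have h2 := hDb t h3
    have ht0 : 0 < t := by linarith
    have e1 : J Γ (fun p => R p ^ 2) t ≤ (C ^ 2 * (m + 2)) * J Γ (fun _ => 1) t
        + (C ^ 2 * (m + 2)) * J Γ (sqSum Γ (m + 1)) t := by
      refine h.J_le₂ ht0 (by fun_prop) continuousOn_const cs fun x hx => ?_
      have b1 : |R (t, x)| ≤ C * (1 + absSum Γ q (m + 1) (t, x)) := by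
        refine (h1 x hx).trans ?_
        have := absSum_mono (Γ := Γ) q (show min (m + 1) (m + 3) ≤ m + 1 by omega) (t, x)
        gcongr
      have b2 := one_add_absSum_sq_le Γ q (m + 1) (t, x)
      push_cast at b2
      calc R (t, x) ^ 2 = |R (t, x)| ^ 2 := (sq_abs _).symm
        _ ≤ (C * (1 + absSum Γ q (m + 1) (t, x))) ^ 2 := by gcongr
        _ = C ^ 2 * (1 + absSum Γ q (m + 1) (t, x)) ^ 2 := by ring
        _ ≤ C ^ 2 * ((m + 1 + 1) * (1 + sqSum Γ (m + 1) (t, x))) := by gcongr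
        _ = _ := by ring
    have e2 := mul_le_mul_of_nonneg_left h2 (by positivity : (0 : ℝ) ≤ C ^ 2 * (m + 2))
    have e3 : C ^ 2 * (m + 2) * (ε / (C ^ 2 * (m + 2)) * J Γ (fun p => kap Γ (m + 2) p ^ 2) t + D)
      = ε * J Γ (fun p => kap Γ (m + 2) p ^ 2) t + C ^ 2 * (m + 2) * D := by field_simp
    have e4 : (C ^ 2 * (m + 2)) * J Γ (fun _ => 1) t ≤ (C ^ 2 * (m + 2)) * M := by
      gcongr; exact (hMb t h3).2
    linarith
  have hc2 : 0 < c ^ 2 := by positivity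
  obtain ⟨D, hD, hDb⟩ := hJR (c ^ 2 / 4) (by positivity)
  refine ⟨2 * c ^ 2 + c ^ 2 / 2 + 2 * D + (4 / c ^ 2) * (1 + D), by positivity, ?_⟩
  filter_upwards [hDb, eventually_ge_atTop 1] with t h1 h2
  have ht0 : 0 < t := by linarith
  have hK : 0 ≤ J Γ (fun p => kap Γ (m + 2) p ^ 2) t := RegularFamily.J_sq_nonneg
  have hGn : 0 ≤ J Γ (fun p => G p ^ 2) t := RegularFamily.J_sq_nonneg
  have cm := ck (m + 2)
  have a1 : J Γ (fun p => kap Γ (m + 2) p ^ 2) t ≤ 2 / c ^ 2 * J Γ (fun p => G p ^ 2) t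
      + 2 / c ^ 2 * J Γ (fun p => R p ^ 2) t := by
    refine h.J_le₂ ht0 (by fun_prop) (by fun_prop) (by fun_prop) fun x hx => ?_
    have e := he (t, x) ⟨ht0, hx⟩
    have e1 : kap Γ (m + 2) (t, x) ^ 2 = (G (t, x) - R (t, x)) ^ 2 / c ^ 2 := by
      rw [e]; field_simp; ring
    rw [e1, ← mul_add, div_mul_eq_mul_div]
    gcongr
    nlinarith [sq_nonneg (G (t, x) + R (t, x))]
  have a2 : J Γ (fun p => G p ^ 2) t ≤ (2 * c ^ 2) * J Γ (fun p => kap Γ (m + 2) p ^ 2) t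
      + 2 * J Γ (fun p => R p ^ 2) t := by
    refine h.J_le₂ ht0 (by fun_prop) (by fun_prop) (by fun_prop) fun x hx => ?_
    rw [he (t, x) ⟨ht0, hx⟩]
    nlinarith [sq_nonneg (c * kap Γ (m + 2) (t, x) - R (t, x))]
  set K := J Γ (fun p => kap Γ (m + 2) p ^ 2) t
  set Y := J Γ (fun p => G p ^ 2) t
  have hq0 : 0 < 4 / c ^ 2 := by positivity
  constructor
  · have a3 : 2 / c ^ 2 * J Γ (fun p => R p ^ 2) t ≤ 2 / c ^ 2 * (c ^ 2 / 4 * K + D) := by gcongr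
    have a4 : 2 / c ^ 2 * (c ^ 2 / 4 * K + D) = K / 2 + 2 / c ^ 2 * D := by field_simp; ring
    have a5 : K ≤ 4 / c ^ 2 * (Y + D) := by
      have : 4 / c ^ 2 * (Y + D) = 2 * (2 / c ^ 2 * Y + 2 / c ^ 2 * D) := by ring
      linarith
    have a6 : 4 / c ^ 2 * (Y + D) ≤ (4 / c ^ 2) * ((1 + D) * (1 + Y)) := by
      gcongr; nlinarith
    have a7 : 0 ≤ (2 * c ^ 2 + c ^ 2 / 2 + 2 * D) * (1 + Y) := by positivity
    linarith
  · have a3 : 0 ≤ (4 / c ^ 2) * (1 + D) * (1 + K) := by positivity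
    have a4 : 0 ≤ D * K := by positivity
    have a5 : 0 ≤ c ^ 2 * (1 + K) := by positivity
    nlinarith

/-- `L²` bounds in space and time pass between `∂ₛ^(m+2) k` and functions comparable to it. -/
lemma integral_le_of_le {f g : ℝ × ℝ → ℝ} (hf : Sm f) (hg : Sm g) {C D : ℝ} (hC : 0 < C)
    (hle : ∀ᶠ t in atTop, J Γ (fun p => f p ^ 2) t ≤ C * (1 + J Γ (fun p => g p ^ 2) t))
    (hD : ∀ᶠ t in atTop, ∫ s in t..t + 1, J Γ (fun p => g p ^ 2) s ≤ D) :
    ∀ᶠ t in atTop, ∫ s in t..t + 1, J Γ (fun p => f p ^ 2) s ≤ C * (1 + D) := by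
  have hint : ∀ {f : ℝ × ℝ → ℝ}, Sm f → ∀ t > 0,
      IntervalIntegrable (J Γ (fun p => f p ^ 2)) MeasureTheory.volume t (t + 1) := fun hf t ht => by
    apply ContinuousOn.intervalIntegrable
    rw [uIcc_of_le (by linarith)]
    exact fun s hs =>
      (h.hasDerivAt_J' (hf.pow 2) (ht.trans_le hs.1)).continuousAt.continuousWithinAt
  obtain ⟨T, hT⟩ := eventually_atTop.1 hle
  filter_upwards [hD, eventually_ge_atTop T, eventually_gt_atTop 0] with t h1 h2 h3
  have i1 := hint hf t h3
  have i2 := hint hg t h3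
  calc _ ≤ ∫ s in t..t + 1, C * (1 + J Γ (fun p => g p ^ 2) s) :=
        intervalIntegral.integral_mono_on (by linarith) i1
          ((intervalIntegrable_const.add i2).const_mul C) fun s hs => hT s (h2.trans hs.1)
    _ = C * (1 + ∫ s in t..t + 1, J Γ (fun p => g p ^ 2) s) := by
        rw [intervalIntegral.integral_const_mul,
          intervalIntegral.integral_add intervalIntegrable_const i2]
        simp
    _ ≤ _ := by gcongr

/-- The bound for `∫ V² ds` passes to `∂ₛ² k` through the flow law, which starts the bootstrap. -/
lemma evBdd_kap_zero_one : ∀ i < 2, EvBdd (kap Γ i) := by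
  obtain ⟨⟨D, hD, _⟩, _⟩ := h.nvel_bounds
  obtain ⟨C, hC, hCb⟩ := h.exists_J_kap_two_le
  refine h.evBdd_of_J (D := C * (1 + D)) ?_
  filter_upwards [hD, eventually_ge_atTop 1] with t h1 h2
  exact (hCb t h2).trans (by gcongr)

set_option maxHeartbeats 800000 in
/-- Bounds for the second derivative of the normal velocity. -/
lemma Ds_Ds_nvel_bounds : ∃ D,
    (∀ᶠ t in atTop, J Γ (fun p => Ds Γ (Ds Γ (nvel Γ)) p ^ 2) t ≤ D) ∧
    ∀ᶠ t in atTop,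
      ∫ s in t..t + 1, J Γ (fun p => Ds Γ (Ds Γ (Ds Γ (Ds Γ (nvel Γ)))) p ^ 2) s ≤ D := by
  obtain ⟨⟨D, hD, hDI⟩, _⟩ := h.nvel_bounds
  have hD0 : 0 ≤ D := by
    obtain ⟨t, ht⟩ := hD.exists
    exact RegularFamily.J_sq_nonneg.trans ht
  obtain ⟨A, hA⟩ := h.evBdd_kap_zero_one 0 (by norm_num)
  obtain ⟨B, hB⟩ := h.evBdd_kap_zero_one 1 (by norm_num)
  obtain ⟨C, hC, hCb⟩ := h.exists_sq_le
  obtain ⟨E, hE, hEb⟩ := h.exists_Ds_le one_pos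
  have hk := h.sm_kap 0
  have hk1 := h.sm_kap 1
  have hV := h.sm_nvel
  have hV1 := h.sm_Ds hV
  have hV2 := h.sm_Ds hV1
  have hV4 := h.sm_Ds (h.sm_Ds hV2)
  have c0 := hk.continuousOn
  have c1 := hk1.continuousOn
  have cV := hV.continuousOn
  have cV1 := hV1.continuousOn
  have cV2 := hV2.continuousOn
  have cV4 := hV4.continuousOn
  have ck2 := (h.sm_kap 2).continuousOn
  have cDt := (h.sm_Dt hV).continuousOn
  set N := max (max |A| |B|) 1
  have hN : 0 < N := one_pos.trans_le (le_max_right _ _)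
  have hAN : A ≤ N := (le_abs_self A).trans ((le_max_left _ _).trans (le_max_left _ _))
  have hBN : B ≤ N := (le_abs_self B).trans ((le_max_right _ _).trans (le_max_left _ _))
  have hμ := h.pos
  set n₀ := (μ + 5 * N ^ 2) + 10 * N ^ 2 + (6 * N ^ 2 + N ^ 4 + 3 * μ * N ^ 2) + 4 * N with hn₀
  have hn₀0 : 0 < n₀ := by positivity
  set a := 4 * n₀ ^ 2
  have ha0 : 0 < a := by positivity
  set Q := C * (1 + E) * (1 + D) + 1 with hQ
  have hQ0 : 0 < Q := by positivity
  have key : ∀ᶠ t in atTop,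
      J Γ (fun p => Dt Γ (fun q => Ds Γ (Ds Γ (nvel Γ)) q ^ 2) p
        - kap Γ 0 p * nvel Γ p * Ds Γ (Ds Γ (nvel Γ)) p ^ 2) t ≤
      -J Γ (fun p => Ds Γ (Ds Γ (Ds Γ (Ds Γ (nvel Γ)))) p ^ 2) t
      + (a * (2 + E * D + D + Q * D) + N * (1 + 2 * Q) * (7 + 2 * (E * D))) *
        (1 + J Γ (fun p => Ds Γ (Ds Γ (nvel Γ)) p ^ 2) t) ^ 2 := by
    filter_upwards [hD, hA, hB, eventually_ge_atTop 1] with t hDt hAt hBt ht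
    have ht0 : 0 < t := by linarith
    have hy : 0 ≤ J Γ (fun p => Ds Γ (Ds Γ (nvel Γ)) p ^ 2) t := RegularFamily.J_sq_nonneg
    have hz : 0 ≤ J Γ (fun p => Ds Γ (Ds Γ (Ds Γ (Ds Γ (nvel Γ)))) p ^ 2) t :=
      RegularFamily.J_sq_nonneg
    set z := J Γ (fun p => Ds Γ (Ds Γ (Ds Γ (Ds Γ (nvel Γ)))) p ^ 2) t
    have hu0 : 0 ≤ J Γ (fun p => nvel Γ p ^ 2) t := RegularFamily.J_sq_nonneg
    have hu1 := hEb (nvel Γ) hV t ht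
    -- `∂ₛ² V` need not satisfy the homogeneous boundary conditions, but `V` and `Dt V` do. So the
    -- pairing of `∂ₛ² Dt V` with `∂ₛ² V` becomes that of `Dt V` with `∂ₛ⁴ V`, without boundary
    -- terms.
    have p4 := h.J_parts_four (h.sm_Dt hV) hV (h.bd_Dt hV h.bd_nvel) h.bd_nvel ht0
    have s0 := fun x hx => hCb (nvel Γ) hV t ht x hx
    have s1 := fun x hx => hCb _ hV1 t ht x hx
    set y := J Γ (fun p => Ds Γ (Ds Γ (nvel Γ)) p ^ 2) t
    set u0 := J Γ (fun p => nvel Γ p ^ 2) t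
    set u1 := J Γ (fun p => Ds Γ (nvel Γ) p ^ 2) t
    have hu1n : 0 ≤ u1 := RegularFamily.J_sq_nonneg
    have hu1' : u1 ≤ y + E * D := by nlinarith
    have hED : 0 ≤ E * D := by positivity
    have hS0 : ∀ x ∈ I, nvel Γ (t, x) ^ 2 ≤ Q * (1 + y) := fun x hx =>
      (s0 x hx).trans (by
        have : u0 + u1 ≤ (1 + E) * (1 + D) * (1 + y) := by
          nlinarith [mul_nonneg hD0 hy, mul_nonneg hE.le hy, mul_nonneg hED hy]
        calc C * (u0 + u1) ≤ C * ((1 + E) * (1 + D) * (1 + y)) := by gcongr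
          _ ≤ Q * (1 + y) := by rw [hQ]; nlinarith)
    have hS1 : ∀ x ∈ I, Ds Γ (nvel Γ) (t, x) ^ 2 ≤ 2 * (Q * (1 + y)) := fun x hx =>
      (s1 x hx).trans (by
        have : u1 + y ≤ 2 * ((1 + E) * (1 + D) * (1 + y)) := by
          nlinarith [mul_nonneg hD0 hy, mul_nonneg hE.le hy, mul_nonneg hED hy]
        calc C * (u1 + y) ≤ C * (2 * ((1 + E) * (1 + D) * (1 + y))) := by gcongr
          _ ≤ 2 * (Q * (1 + y)) := by rw [hQ]; nlinarith)
    set S := Q * (1 + y)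
    have hS : 0 ≤ S := by positivity
    have g1 : J Γ (fun p => 2 * (Dt Γ (nvel Γ) p * Ds Γ (Ds Γ (Ds Γ (Ds Γ (nvel Γ)))) p)) t ≤
        -3 * z + a * (y + u1 + (1 + S) * u0) := by
      have : J Γ (fun p => 2 * (Dt Γ (nvel Γ) p * Ds Γ (Ds Γ (Ds Γ (Ds Γ (nvel Γ)))) p)) t ≤
          -3 * z + a * J Γ (fun p => Ds Γ (Ds Γ (nvel Γ)) p ^ 2 + Ds Γ (nvel Γ) p ^ 2
            + (1 + S) * nvel Γ p ^ 2) t := by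
        refine h.J_le₂ ht0 (by fun_prop) (by fun_prop) (by fun_prop) fun x hx => ?_
        have b0 := (hAt x hx).trans hAN
        have b1 := (hBt x hx).trans hBN
        have b2 := hS0 x hx
        have law := h.law (t, x) ⟨ht0, hx⟩
        rw [h.Dt_nvel (p := (t, x)) ⟨ht0, hx⟩]
        generalize kap Γ 0 (t, x) = k at *
        generalize kap Γ 1 (t, x) = k1 at *
        generalize kap Γ 2 (t, x) = k2 at *
        generalize Ds Γ (Ds Γ (Ds Γ (Ds Γ (nvel Γ)))) (t, x) = V4 at *
        generalize Ds Γ (Ds Γ (nvel Γ)) (t, x) = V2 at *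
        generalize Ds Γ (nvel Γ) (t, x) = V1 at *
        generalize nvel Γ (t, x) = V at *
        have hR2 := error_sq_le (V1 := V1) (V2 := V2) hμ hN b0 b1 b2
        set R := (μ - 5 * k ^ 2) * V2 + (-10 * (k * k1)) * V1
          + (-6 * k1 ^ 2 + k ^ 4 - 3 * μ * k ^ 2) * V + (4 * k) * V ^ 2 with hR
        -- The flow law eliminates `∂ₛ² k`, for which no pointwise bound is available yet; only `k`
        -- and `∂ₛ k` remain in the coefficients.
        have e2 : -2 * V4 + (μ - 5 * k ^ 2) * V2 - 10 * k * k1 * V1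
            + (-6 * k1 ^ 2 - 8 * k * k2 - 3 * k ^ 4 + μ * k ^ 2) * V = -2 * V4 + R := by
          rw [hR]
          have : k2 = -(V + k ^ 3 - μ * k) / 2 := by linarith
          rw [this]; ring
        rw [e2]
        have e3 : 2 * ((-2 * V4 + R) * V4) = -3 * V4 ^ 2 + R ^ 2 - (V4 - R) ^ 2 := by ring
        rw [e3]
        linarith [sq_nonneg (V4 - R)]
      refine this.trans (le_of_eq ?_)
      rw [h.J_add ht0 (by fun_prop) (by fun_prop), h.J_add ht0 (by fun_prop) (by fun_prop),
        RegularFamily.J_const_mul]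
    have g2 : J Γ (fun p => 3 * kap Γ 0 p * nvel Γ p * Ds Γ (Ds Γ (nvel Γ)) p ^ 2
        + 2 * (kap Γ 0 p * Ds Γ (nvel Γ) p + kap Γ 1 p * nvel Γ p) * Ds Γ (nvel Γ) p
          * Ds Γ (Ds Γ (nvel Γ)) p) t ≤
        (5 * (N * (1 + 2 * S))) * y + (2 * (N * (1 + 2 * S))) * u1 := by
      refine h.J_le₂ ht0 (by fun_prop) (by fun_prop) (by fun_prop) fun x hx => ?_
      exact cubic_error_le hN ((hAt x hx).trans hAN) ((hBt x hx).trans hBN) (hS0 x hx) (hS1 x hx)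
    have g0 : J Γ (fun p => Dt Γ (fun q => Ds Γ (Ds Γ (nvel Γ)) q ^ 2) p
        - kap Γ 0 p * nvel Γ p * Ds Γ (Ds Γ (nvel Γ)) p ^ 2) t =
        J Γ (fun p => 2 * (Dt Γ (nvel Γ) p * Ds Γ (Ds Γ (Ds Γ (Ds Γ (nvel Γ)))) p)) t +
        J Γ (fun p => 3 * kap Γ 0 p * nvel Γ p * Ds Γ (Ds Γ (nvel Γ)) p ^ 2
        + 2 * (kap Γ 0 p * Ds Γ (nvel Γ) p + kap Γ 1 p * nvel Γ p) * Ds Γ (nvel Γ) p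
          * Ds Γ (Ds Γ (nvel Γ)) p) t := by
      have cD := (h.sm_Ds (h.sm_Ds (h.sm_Dt hV))).continuousOn
      rw [RegularFamily.J_const_mul, p4, ← RegularFamily.J_const_mul,
        ← h.J_add ht0 (by fun_prop) (by fun_prop)]
      refine RegularFamily.J_congr ht0 fun p hp => ?_
      rw [Dt_pow hV2 2 hp, h.Dt_Ds_Ds hV hp]
      norm_num; ring
    rw [g0]
    have k1 := quadratic_error_le ha0.le hN.le hQ0.le hD0 hE.le hy hu1n hDt hu1'
    linarith
  obtain ⟨D', h1, h2⟩ := uniform_gronwall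
    (fun t => RegularFamily.J_sq_nonneg (Γ := Γ) (f := Ds Γ (Ds Γ (nvel Γ))) (t := t))
    (fun t => RegularFamily.J_sq_nonneg (Γ := Γ) (f := Ds Γ (Ds Γ (Ds Γ (Ds Γ (nvel Γ)))))
      (t := t))
    (fun t ht => (h.hasDerivAt_J' (hV4.pow 2) ht).continuousAt.continuousWithinAt)
    (fun t ht => h.hasDerivAt_J' (hV2.pow 2) ht) key hDI
  exact ⟨D', h1, h2⟩

end ElasticFamily

end

section

/-! ### Bounds for all derivatives of the curvature -/

lemma W.sq_le {Γ : ℝ × ℝ → Plane} {f : ℝ × ℝ → ℝ} {w m q : ℕ} (hq4 : 4 ≤ q)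
    (hq : ∀ i < q, EvBdd (kap Γ i)) (hf : W Γ w m f) (hw : w ≤ q + 7) :
    ∃ B > 0, ∀ᶠ t in atTop, ∀ x ∈ I,
      f (t, x) ^ 2 ≤ B * ((1 + kap Γ q (t, x) ^ 2) * (1 + sqSum Γ (m + 1) (t, x))) := by
  obtain ⟨C, hC, hCb⟩ := hf.abs_le_mul hq4 hq hw
  refine ⟨C ^ 2 * (2 * (m + 2)), by positivity, hCb.mono fun t ht x hx => ?_⟩
  have h1 := one_add_absSum_sq_le Γ q (m + 1) (t, x)
  push_cast at h1
  have h2 : (1 + |kap Γ q (t, x)|) ^ 2 ≤ 2 * (1 + kap Γ q (t, x) ^ 2) := by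
    nlinarith [sq_nonneg (1 - |kap Γ q (t, x)|), sq_abs (kap Γ q (t, x))]
  calc f (t, x) ^ 2 = |f (t, x)| ^ 2 := (sq_abs _).symm
    _ ≤ (C * ((1 + |kap Γ q (t, x)|) * (1 + absSum Γ q (m + 1) (t, x)))) ^ 2 :=
        pow_le_pow_left₀ (abs_nonneg _) (ht x hx) 2
    _ = C ^ 2 * ((1 + |kap Γ q (t, x)|) ^ 2 * (1 + absSum Γ q (m + 1) (t, x)) ^ 2) := by ring
    _ ≤ C ^ 2 * ((2 * (1 + kap Γ q (t, x) ^ 2)) *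
          ((m + 1 + 1) * (1 + sqSum Γ (m + 1) (t, x)))) := by gcongr
    _ = _ := by ring

/-- The bookkeeping of `smoothing`, with `y` and `z` for the squared L² norms of `G` and `∂ₛ² G`. Of
the good term `-4 z`, one half of `z` pays for the top order part of `G P` and one `z` for the
product with `R`. -/
lemma absorb_aux {l b a M C₁ C₂ D₀ D₁ y z L S₅ S₃ u v : ℝ} (hl : 0 ≤ l) (hb : 0 ≤ b) (ha : 0 ≤ a)
    (hM : 0 ≤ M) (hC₂ : 0 ≤ C₂) (hD₀ : 0 ≤ D₀) (hD₁ : 0 ≤ D₁)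
    (hbC : b * (2 * C₂) = 1 / 2) (hy : 0 ≤ y) (hL : L ≤ M)
    (hu : u ≤ (l * (1 + y)) * y + b * L + b * S₅)
    (hv : v ≤ 1 * z + (a * (1 + y)) * L + (a * (1 + y)) * S₃)
    (h₅ : S₅ ≤ 2 * C₂ * (1 + z) + D₁) (h₃ : S₃ ≤ 2 * C₁ * (1 + y) + D₀) (hz : 0 ≤ z) :
    -4 * z + u + v ≤ -z + (l + b * (M + 2 * C₂ + D₁) + a * (M + 2 * C₁ + D₀)) * (1 + y) ^ 2 := by
  have hay : 0 ≤ a * (1 + y) := by positivity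
  have f1 := mul_le_mul_of_nonneg_left hL hb
  have f2 := mul_le_mul_of_nonneg_left h₅ hb
  have e : b * (2 * C₂ * (1 + z) + D₁) = b * (2 * C₂) * z + b * (2 * C₂ + D₁) := by ring
  rw [e, hbC] at f2
  have f3 := mul_le_mul_of_nonneg_left hL hay
  have f4 := mul_le_mul_of_nonneg_left h₃ hay
  have g1 : (1 : ℝ) ≤ (1 + y) ^ 2 := one_le_pow₀ (by linarith)
  have k1 : 0 ≤ l * (1 + y) := by positivity
  have k2 := mul_le_mul_of_nonneg_left g1 (by positivity : 0 ≤ b * (M + 2 * C₂ + D₁))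
  have k3 : 0 ≤ a * (1 + y) * y * (M + D₀) := by positivity
  linarith

/-- `f` is bounded in `L²` in space and time, on time intervals of unit length. -/
def IntBdd (Γ : ℝ × ℝ → Plane) (f : ℝ × ℝ → ℝ) : Prop :=
  ∃ D, ∀ᶠ t in atTop, ∫ s in t..t + 1, J Γ (fun p => f p ^ 2) s ≤ D

/-- The normal velocity and its normal time derivatives. -/
def vel (Γ : ℝ × ℝ → Plane) : ℕ → ℝ × ℝ → ℝ
  | 0 => nvel Γ
  | j + 1 => Dt Γ (vel Γ j)

namespace ElasticFamily

variable {μ : ℝ} {Γ : ℝ × ℝ → Plane} (h : ElasticFamily μ Γ)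
include h

/-- The parabolic smoothing step. -/
lemma smoothing {q : ℕ} (hq4 : 4 ≤ q) (hq : ∀ i < q, EvBdd (kap Γ i))
    (hI : IntBdd Γ (kap Γ (q + 2))) {G P R : ℝ × ℝ → ℝ} (hG : Top Γ q G)
    (hP : W Γ (q + 7) (q + 4) P) (hR : W Γ (q + 5) (q + 2) R)
    (hev : ∀ t > 0, J Γ (fun p => Dt Γ (fun r => G r ^ 2) p - kap Γ 0 p * nvel Γ p * G p ^ 2) t =
      -4 * J Γ (fun p => Ds Γ (Ds Γ G) p ^ 2) t + J Γ (fun p => G p * P p) t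
        + J Γ (fun p => Ds Γ (Ds Γ G) p * R p) t) :
    (∀ i < q + 2, EvBdd (kap Γ i)) ∧ IntBdd Γ (kap Γ (q + 4)) := by
  have sG := h.sm_Top hG
  have sGss := h.sm_Ds (h.sm_Ds sG)
  have cG := sG.continuousOn
  have cGss := sGss.continuousOn
  have cP := (h.sm_W hP).continuousOn
  have cR := (h.sm_W hR).continuousOn
  have hGss : Top Γ (q + 2) (Ds Γ (Ds Γ G)) := h.Top_Ds (h.Top_Ds hG)
  obtain ⟨M, hM, hMb⟩ := h.exists_bounds
  obtain ⟨C₁, hC₁, hGb⟩ := h.J_kap_le_of_Top hG (q := q) (by omega) hq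
  obtain ⟨C₂, hC₂, hGssb⟩ := h.J_kap_le_of_Top hGss (q := q) (by omega) hq
  obtain ⟨B₁, hB₁, hPb⟩ := hP.sq_le hq4 hq le_rfl
  obtain ⟨B₂, hB₂, hRb⟩ := hR.sq_le hq4 hq (by omega)
  obtain ⟨C₃, hC₃, hsq⟩ := h.exists_sq_le
  obtain ⟨D₀, hD₀, hD₀b⟩ := h.exists_J_sqSum_le (n := q + 2) (m := q + 2) le_rfl 1 one_pos
  obtain ⟨D₁, hD₁, hD₁b⟩ := h.exists_J_sqSum_le (n := q + 4) (m := q + 4) le_rfl 1 one_pos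
  have ssucc : ∀ n, ∀ t > 0, J Γ (sqSum Γ (n + 1)) t
      = J Γ (sqSum Γ n) t + J Γ (fun p => kap Γ n p ^ 2) t := fun n t ht => by
    have e : sqSum Γ (n + 1) = fun p => sqSum Γ n p + kap Γ n p ^ 2 :=
      funext fun p => Finset.sum_range_succ _ _
    have c1 := h.continuousOn_sqSum n
    have c2 := (h.sm_kap n).continuousOn
    rw [e, h.J_add ht (by fun_prop) (by fun_prop)]
  -- a bound for the derivative of order `q`
  set A := 1 + C₃ * (C₁ + D₀) with hA
  have hA0 : 0 < A := by positivity
  have hkq : ∀ᶠ t in atTop, ∀ x ∈ I,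
      1 + kap Γ q (t, x) ^ 2 ≤ A * (1 + J Γ (fun p => G p ^ 2) t) := by
    filter_upwards [hGb, eventually_ge_atTop 1] with t h1 ht x hx
    have ht0 : 0 < t := by linarith
    have hy : 0 ≤ J Γ (fun p => G p ^ 2) t := RegularFamily.J_sq_nonneg
    have h2 := hD₀b t ht
    rw [ssucc (q + 1) t ht0, ssucc q t ht0] at h2
    have h3 : 0 ≤ J Γ (sqSum Γ q) t :=
      RegularFamily.J_nonneg fun x _ => Finset.sum_nonneg fun _ _ => sq_nonneg _
    have h4 : kap Γ q (t, x) ^ 2 ≤ C₃ * (J Γ (fun p => kap Γ q p ^ 2) t +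
      J Γ (fun p => kap Γ (q + 1) p ^ 2) t) := hsq _ (h.sm_kap q) t ht x hx
    have h5 : J Γ (fun p => kap Γ q p ^ 2) t + J Γ (fun p => kap Γ (q + 1) p ^ 2) t ≤
        (C₁ + D₀) * (1 + J Γ (fun p => G p ^ 2) t) := by
      have := mul_nonneg hD₀.le hy
      linarith [h1.1]
    have h6 := mul_le_mul_of_nonneg_left h5 hC₃.le
    rw [hA]
    linarith
  -- `G P` is split as `l (1 + y) G²` plus `b` times derivatives of order up to `q + 4`. The top one
  -- is controlled by `2 C₂ (1 + z)`, and this `l` makes `b (2 C₂) = 1 / 2`, so it can be absorbed.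
  set l := C₂ * (B₁ * A) with hl
  have hl0 : 0 < l := by positivity
  set b := B₁ * A / (4 * l) with hb
  have hb0 : 0 < b := by positivity
  have hbC : b * (2 * C₂) = 1 / 2 := by
    rw [hb, hl]; field_simp; norm_num
  set K := l + b * (M + 2 * C₂ + D₁) + B₂ * A / 4 * (M + 2 * C₁ + D₀) with hK
  have hK0 : 0 < K := by positivity
  have key : ∀ᶠ t in atTop,
      J Γ (fun p => Dt Γ (fun r => G r ^ 2) p - kap Γ 0 p * nvel Γ p * G p ^ 2) t ≤
      -J Γ (fun p => Ds Γ (Ds Γ G) p ^ 2) t + K * (1 + J Γ (fun p => G p ^ 2) t) ^ 2 := by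
    filter_upwards [hGb, hGssb, hPb, hRb, hkq, eventually_ge_atTop 1] with t h1 h2 h3 h4 h5 ht
    have ht0 : 0 < t := by linarith
    have hy : 0 ≤ J Γ (fun p => G p ^ 2) t := RegularFamily.J_sq_nonneg
    have hz : 0 ≤ J Γ (fun p => Ds Γ (Ds Γ G) p ^ 2) t := RegularFamily.J_sq_nonneg
    have hL := (hMb t ht).2
    rw [hev t ht0]
    set y := J Γ (fun p => G p ^ 2) t
    set z := J Γ (fun p => Ds Γ (Ds Γ G) p ^ 2) t
    have cs3 := h.continuousOn_sqSum (q + 3)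
    have cs5 := h.continuousOn_sqSum (q + 5)
    have e1 : J Γ (fun p => G p * P p) t ≤ (l * (1 + y)) * y + b * J Γ (fun _ => 1) t
        + b * J Γ (sqSum Γ (q + 5)) t := by
      refine h.J_le₃ ht0 (by fun_prop) (by fun_prop) continuousOn_const cs5 fun x hx => ?_
      have hs : 0 ≤ sqSum Γ (q + 5) (t, x) := Finset.sum_nonneg fun _ _ => sq_nonneg _
      have b1 : P (t, x) ^ 2 ≤ (1 + y) * (B₁ * A * (1 + sqSum Γ (q + 5) (t, x))) :=
        (h3 x hx).trans (by
          calc _ ≤ B₁ * ((A * (1 + y)) * (1 + sqSum Γ (q + 5) (t, x))) := by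
                gcongr; exact h5 x hx
            _ = _ := by ring)
      have b2 : 0 ≤ (2 * (l * (1 + y)) * G (t, x) - P (t, x)) ^ 2 := sq_nonneg _
      have b3 : 4 * (l * (1 + y)) * (G (t, x) * P (t, x)) ≤
          4 * (l * (1 + y)) * ((l * (1 + y)) * G (t, x) ^ 2 + b * (1 + sqSum Γ (q + 5) (t, x))) := by
        have : 4 * (l * (1 + y)) * (b * (1 + sqSum Γ (q + 5) (t, x))) =
            (1 + y) * (B₁ * A * (1 + sqSum Γ (q + 5) (t, x))) := by
          rw [hb]; field_simp
        rw [mul_add (4 * (l * (1 + y))), this]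
        linarith
      have := le_of_mul_le_mul_left b3 (by positivity)
      linarith
    have e2 : J Γ (fun p => Ds Γ (Ds Γ G) p * R p) t ≤ 1 * z
        + (B₂ * A / 4 * (1 + y)) * J Γ (fun _ => 1) t
        + (B₂ * A / 4 * (1 + y)) * J Γ (sqSum Γ (q + 3)) t := by
      refine h.J_le₃ ht0 (by fun_prop) (by fun_prop) continuousOn_const cs3 fun x hx => ?_
      have hs : 0 ≤ sqSum Γ (q + 3) (t, x) := Finset.sum_nonneg fun _ _ => sq_nonneg _
      have b1 : R (t, x) ^ 2 ≤ (1 + y) * (B₂ * A * (1 + sqSum Γ (q + 3) (t, x))) :=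
        (h4 x hx).trans (by
          calc _ ≤ B₂ * ((A * (1 + y)) * (1 + sqSum Γ (q + 3) (t, x))) := by
                gcongr; exact h5 x hx
            _ = _ := by ring)
      have b2 : 0 ≤ (2 * Ds Γ (Ds Γ G) (t, x) - R (t, x)) ^ 2 := sq_nonneg _
      linarith
    have e3 := hD₁b t ht
    have e4 := hD₀b t ht
    have e5 : J Γ (sqSum Γ (q + 5)) t ≤ 2 * C₂ * (1 + z) + D₁ := by
      rw [ssucc (q + 4) t ht0]
      linarith [h2.1]
    have e6 : J Γ (sqSum Γ (q + 3)) t ≤ 2 * C₁ * (1 + y) + D₀ := by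
      rw [ssucc (q + 2) t ht0]
      linarith [h1.1]
    rw [hK]
    exact absorb_aux hl0.le hb0.le (by positivity) hM.le hC₂.le hD₀.le hD₁.le hbC hy hL e1 e2
      e5 e6 hz
  obtain ⟨D, hD⟩ := hI
  obtain ⟨D', h1, h2⟩ := uniform_gronwall
    (fun t => RegularFamily.J_sq_nonneg (Γ := Γ) (f := G) (t := t))
    (fun t => RegularFamily.J_sq_nonneg (Γ := Γ) (f := Ds Γ (Ds Γ G)) (t := t))
    (fun t ht => (h.hasDerivAt_J' (sGss.pow 2) ht).continuousAt.continuousWithinAt)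
    (fun t ht => h.hasDerivAt_J' (sG.pow 2) ht) key
    (h.integral_le_of_le sG (h.sm_kap (q + 2)) hC₁ (hGb.mono fun t ht => ht.2) hD)
  refine ⟨h.evBdd_of_J (D := C₁ * (1 + D')) ?_, ⟨_, h.integral_le_of_le (h.sm_kap (q + 4)) sGss hC₂
    (hGssb.mono fun t ht => ht.1) h2⟩⟩
  filter_upwards [hGb, h1] with t h3 h4
  exact h3.1.trans (by gcongr)

lemma Top_vel (j : ℕ) : Top Γ (4 * j) (vel Γ j) := by
  induction j with
  | zero => exact h.Top_nvel
  | succ j ih => exact h.Top_Dt ih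

lemma sm_vel (j : ℕ) : Sm (vel Γ j) := h.sm_Top (h.Top_vel j)

lemma bd_vel (j : ℕ) : Bd Γ (vel Γ j) := by
  induction j with
  | zero => exact h.bd_nvel
  | succ j ih => exact h.bd_Dt (h.sm_vel j) ih

lemma W_curv_nvel : W Γ 4 2 (fun p => kap Γ 0 p * nvel Γ p) :=
  .mul' (.var le_rfl le_rfl) h.Top_nvel.W le_rfl (by omega) le_rfl

/-- `vel Γ j` is comparable to the derivative of `k` of order `4 j + 2` and satisfies the
homogeneous boundary conditions, so testing its parabolic equation with itself leaves no boundary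
terms. -/
lemma smoothing_vel {j : ℕ} (hj : 1 ≤ j) (hq : ∀ i < 4 * j, EvBdd (kap Γ i))
    (hI : IntBdd Γ (kap Γ (4 * j + 2))) :
    (∀ i < 4 * j + 2, EvBdd (kap Γ i)) ∧ IntBdd Γ (kap Γ (4 * j + 4)) := by
  have hG := h.Top_vel j
  obtain ⟨R, hR, hRe⟩ := h.Top_evolution hG
  have hkG : W Γ (4 * j + 7) (4 * j + 4) (fun p => (kap Γ 0 p * nvel Γ p) * vel Γ j p) :=
    .mul' h.W_curv_nvel hG.W (by omega) (by omega) (by omega)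
  refine h.smoothing (G := vel Γ j) (P := fun p => 2 * R p + (-1) * ((kap Γ 0 p * nvel Γ p)
    * vel Γ j p)) (R := fun _ => 0) (by omega) hq hI hG (.add (.const_mul 2 hR)
    (.const_mul (-1) hkG)) (.const _ _ 0) fun t ht => ?_
  have sG := h.sm_vel j
  have cG := sG.continuousOn
  have cR := (h.sm_W hR).continuousOn
  have ck := (h.sm_kap 0).continuousOn
  have cV := h.sm_nvel.continuousOn
  have c2 := (h.sm_Ds (h.sm_Ds sG)).continuousOn
  have c4 := (h.sm_Ds (h.sm_Ds (h.sm_Ds (h.sm_Ds sG)))).continuousOn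
  have p4 := h.J_parts_four sG sG (h.bd_vel j) (h.bd_vel j) ht
  have e1 : J Γ (fun p => Ds Γ (Ds Γ (vel Γ j)) p * Ds Γ (Ds Γ (vel Γ j)) p) t =
      J Γ (fun p => Ds Γ (Ds Γ (vel Γ j)) p ^ 2) t :=
    congrArg (fun F => J Γ F t) (funext fun p => (sq _).symm)
  have e2 : J Γ (fun p => Ds Γ (Ds Γ (vel Γ j)) p * 0) t = 0 := by simp [J]
  rw [e2, ← e1, ← p4, add_zero, ← RegularFamily.J_const_mul, ← h.J_add ht (by fun_prop)
    (by fun_prop)]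
  refine RegularFamily.J_congr ht fun p hp => ?_
  rw [Dt_pow sG 2 hp, hRe p hp]
  norm_num; ring

/-- This supplies the level between `vel Γ j` and `vel Γ (j + 1)`. The second derivative need not
satisfy the boundary conditions, but `vel Γ j` and `vel Γ (j + 1)` both do, so the integration by
parts is applied to this pair. -/
lemma smoothing_Ds_Ds_vel {j : ℕ} (hj : 1 ≤ j) (hq : ∀ i < 4 * j + 2, EvBdd (kap Γ i))
    (hI : IntBdd Γ (kap Γ (4 * j + 4))) :
    (∀ i < 4 * j + 4, EvBdd (kap Γ i)) ∧ IntBdd Γ (kap Γ (4 * j + 6)) := by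
  have hF := h.Top_vel j
  obtain ⟨R, hR, hRe⟩ := h.Top_evolution hF
  have hF1 := h.Top_Ds hF
  have hG := h.Top_Ds hF1
  have hkV := h.W_curv_nvel
  have hk0 : W Γ 1 0 (kap Γ 0) := .var le_rfl le_rfl
  have hk1 : W Γ 2 1 (kap Γ 1) := .var le_rfl le_rfl
  have hV := h.Top_nvel.W
  have hV1 := (h.Top_Ds h.Top_nvel).W
  have hkG : W Γ (4 * j + 9) (4 * j + 6)
      (fun p => (kap Γ 0 p * nvel Γ p) * Ds Γ (Ds Γ (vel Γ j)) p) :=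
    .mul' hkV hG.W (by omega) (by omega) (by omega)
  have hc : W Γ 5 3 (fun p => kap Γ 0 p * Ds Γ (nvel Γ) p + kap Γ 1 p * nvel Γ p) :=
    .add (.mul' hk0 hV1 (by omega) (by omega) (by omega))
      (.mul' hk1 hV (by omega) (by omega) (by omega))
  have hcF : W Γ (4 * j + 9) (4 * j + 6)
      (fun p => (kap Γ 0 p * Ds Γ (nvel Γ) p + kap Γ 1 p * nvel Γ p) * Ds Γ (vel Γ j) p) :=
    .mul' hc hF1.W (by omega) (by omega) (by omega)
  refine h.smoothing (q := 4 * j + 2) (G := Ds Γ (Ds Γ (vel Γ j)))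
    (P := fun p => 3 * ((kap Γ 0 p * nvel Γ p) * Ds Γ (Ds Γ (vel Γ j)) p)
      + 2 * ((kap Γ 0 p * Ds Γ (nvel Γ) p + kap Γ 1 p * nvel Γ p) * Ds Γ (vel Γ j) p))
    (R := fun p => 2 * R p) (by omega) hq hI hG (.add (.const_mul 3 hkG) (.const_mul 2 hcF))
    (.const_mul 2 hR) fun t ht => ?_
  have sF := h.sm_vel j
  have sF1 := h.sm_Ds sF
  have sG := h.sm_Ds sF1
  have sG2 := h.sm_Ds (h.sm_Ds sG)
  have sD := h.sm_vel (j + 1)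
  have cF1 := sF1.continuousOn
  have cG := sG.continuousOn
  have cG2 := sG2.continuousOn
  have cD := sD.continuousOn
  have cD2 := (h.sm_Ds (h.sm_Ds sD)).continuousOn
  have cR := (h.sm_W hR).continuousOn
  have ck := (h.sm_kap 0).continuousOn
  have ck1 := (h.sm_kap 1).continuousOn
  have cV := h.sm_nvel.continuousOn
  have cV1 := (h.sm_Ds h.sm_nvel).continuousOn
  have p4 := h.J_parts_four sD sF (h.bd_vel (j + 1)) (h.bd_vel j) ht
  have e1 : J Γ (fun p => vel Γ (j + 1) p * Ds Γ (Ds Γ (Ds Γ (Ds Γ (vel Γ j)))) p) t =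
      J Γ (fun p => (-2) * Ds Γ (Ds Γ (Ds Γ (Ds Γ (vel Γ j)))) p ^ 2
        + Ds Γ (Ds Γ (Ds Γ (Ds Γ (vel Γ j)))) p * R p) t :=
    RegularFamily.J_congr ht fun p hp => by
      change Dt Γ (vel Γ j) p * _ = _
      rw [hRe p hp]; ring
  rw [h.J_add ht (by fun_prop) (by fun_prop), RegularFamily.J_const_mul, p4] at e1
  have e2 : J Γ (fun p => Ds Γ (Ds Γ (Ds Γ (Ds Γ (vel Γ j)))) p * (2 * R p)) t =
      2 * J Γ (fun p => Ds Γ (Ds Γ (Ds Γ (Ds Γ (vel Γ j)))) p * R p) t := by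
    rw [← RegularFamily.J_const_mul]
    exact congrArg (fun F => J Γ F t) (funext fun p => by ring)
  have e3 : J Γ (fun p => Dt Γ (fun r => Ds Γ (Ds Γ (vel Γ j)) r ^ 2) p
      - kap Γ 0 p * nvel Γ p * Ds Γ (Ds Γ (vel Γ j)) p ^ 2) t =
      J Γ (fun p => 2 * (Ds Γ (Ds Γ (vel Γ (j + 1))) p * Ds Γ (Ds Γ (vel Γ j)) p) +
        Ds Γ (Ds Γ (vel Γ j)) p * (3 * ((kap Γ 0 p * nvel Γ p) * Ds Γ (Ds Γ (vel Γ j)) p)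
      + 2 * ((kap Γ 0 p * Ds Γ (nvel Γ) p + kap Γ 1 p * nvel Γ p) * Ds Γ (vel Γ j) p))) t := by
    refine RegularFamily.J_congr ht fun p hp => ?_
    change _ = 2 * (Ds Γ (Ds Γ (Dt Γ (vel Γ j))) p * _) + _
    rw [Dt_pow sG 2 hp, h.Dt_Ds_Ds sF hp]
    norm_num; ring
  rw [e3, h.J_add ht (by fun_prop) (by fun_prop), RegularFamily.J_const_mul, e1, e2]
  ring

/-- All arclength derivatives of the curvature are bounded for large times. -/
theorem evBdd_kap (i : ℕ) : EvBdd (kap Γ i) := by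
  obtain ⟨D, hD, hDI⟩ := h.Ds_Ds_nvel_bounds
  have hT2 : Top Γ 2 (Ds Γ (Ds Γ (nvel Γ))) := h.Top_Ds (h.Top_Ds h.Top_nvel)
  have hT4 : Top Γ 4 (Ds Γ (Ds Γ (Ds Γ (Ds Γ (nvel Γ))))) := h.Top_Ds (h.Top_Ds hT2)
  obtain ⟨C, hC, hCb⟩ := h.J_kap_le_of_Top hT2 (q := 2) (by norm_num) h.evBdd_kap_zero_one
  have h4 : ∀ i < 4, EvBdd (kap Γ i) := by
    refine h.evBdd_of_J (D := C * (1 + D)) ?_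
    filter_upwards [hD, hCb] with t h1 h2
    exact h2.1.trans (by gcongr)
  obtain ⟨E, hE, hEb⟩ := h.J_kap_le_of_Top hT4 (q := 4) (by norm_num) h4
  have h6 : IntBdd Γ (kap Γ 6) :=
    ⟨_, h.integral_le_of_le (h.sm_kap 6) (h.sm_Top hT4) hE (hEb.mono fun t ht => ht.1) hDI⟩
  -- The weight count in `smoothing` needs `q ≥ 4`, so the induction starts at `j = 1`, where the
  -- estimate for `∂ₛ² V` provides both parts.
  have key : ∀ j ≥ 1, (∀ i < 4 * j, EvBdd (kap Γ i)) ∧ IntBdd Γ (kap Γ (4 * j + 2)) := by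
    intro j hj
    induction j, hj using Nat.le_induction with
    | base => exact ⟨h4, h6⟩
    | succ j hj ih =>
      have h1 := h.smoothing_vel hj ih.1 ih.2
      exact h.smoothing_Ds_Ds_vel hj h1.1 h1.2
  exact (key (i + 1) (by omega)).1 i (by omega)

/-- All arclength derivatives of the curvature are bounded away from the initial time. -/
theorem exists_kap_bound (i : ℕ) : ∃ C, ∀ t ≥ 1, ∀ x ∈ I, |kap Γ i (t, x)| ≤ C := by
  obtain ⟨C, hC⟩ := h.evBdd_kap i
  obtain ⟨T, hT⟩ := eventually_atTop.1 hC
  obtain ⟨D, hD⟩ := (isCompact_Icc.prod isCompact_Icc).exists_bound_of_continuousOn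
    (s := Icc 1 (max T 1) ×ˢ I) (f := kap Γ i)
    ((h.sm_kap i).continuousOn.mono (prod_mono (fun s hs => one_pos.trans_le hs.1) le_rfl))
  refine ⟨max C D, fun t ht x hx => ?_⟩
  rcases le_total T t with h1 | h1
  · exact (hT t h1 x hx).trans (le_max_left _ _)
  · exact (hD (t, x) ⟨⟨ht, h1.trans (le_max_left _ _)⟩, hx⟩).trans (le_max_right _ _)

/-- The normal velocity tends to zero uniformly. -/
theorem nvel_tendsto_zero : ∀ ε > 0, ∀ᶠ t in atTop, ∀ x ∈ I, |nvel Γ (t, x)| ≤ ε := by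
  intro ε hε
  obtain ⟨_, hlim⟩ := h.nvel_bounds
  obtain ⟨D, hD, _⟩ := h.Ds_Ds_nvel_bounds
  obtain ⟨M, hM, hMb⟩ := h.exists_bounds
  have hD0 : 0 ≤ D := by
    obtain ⟨t, ht⟩ := hD.exists
    exact RegularFamily.J_sq_nonneg.trans ht
  -- The threshold comes from `V⁴ ≤ M² ∫ V² ∫ (∂ₛ² V)²`, where the last factor is bounded by `D`.
  have hsm : ∀ᶠ t in atTop, J Γ (fun p => nvel Γ p ^ 2) t ≤ ε ^ 4 / (M ^ 2 * (D + 1)) :=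
    hlim.eventually (eventually_le_nhds (by positivity))
  filter_upwards [hD, hsm, eventually_ge_atTop 1] with t h1 h2 ht x hx
  have ht0 : 0 < t := by linarith
  have a1 := h.nvel_sq_le ht0 hx
  have a2 := h.J_Ds_nvel_sq ht0
  have hy : 0 ≤ J Γ (fun p => nvel Γ p ^ 2) t := RegularFamily.J_sq_nonneg
  have hz : 0 ≤ J Γ (fun p => Ds Γ (Ds Γ (nvel Γ)) p ^ 2) t := RegularFamily.J_sq_nonneg
  have hu : 0 ≤ J Γ (fun p => Ds Γ (nvel Γ) p ^ 2) t := RegularFamily.J_sq_nonneg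
  have a3 : nvel Γ (t, x) ^ 2 ≤ M * J Γ (fun p => Ds Γ (nvel Γ) p ^ 2) t :=
    a1.trans (mul_le_mul_of_nonneg_right (hMb t ht).2 hu)
  have a4 : |nvel Γ (t, x)| ^ 4 ≤ ε ^ 4 := by
    calc |nvel Γ (t, x)| ^ 4 = (nvel Γ (t, x) ^ 2) ^ 2 := by
          rw [show (4 : ℕ) = 2 * 2 from rfl, pow_mul, sq_abs]
      _ ≤ (M * J Γ (fun p => Ds Γ (nvel Γ) p ^ 2) t) ^ 2 := by gcongr
      _ = M ^ 2 * J Γ (fun p => Ds Γ (nvel Γ) p ^ 2) t ^ 2 := by ring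
      _ ≤ M ^ 2 * (J Γ (fun p => nvel Γ p ^ 2) t
            * J Γ (fun p => Ds Γ (Ds Γ (nvel Γ)) p ^ 2) t) := by gcongr
      _ ≤ M ^ 2 * (ε ^ 4 / (M ^ 2 * (D + 1)) * (D + 1)) := by
          gcongr; linarith
      _ = ε ^ 4 := by field_simp
  exact le_of_pow_le_pow_left₀ (by norm_num) hε.le a4

end ElasticFamily

end

section

/-! ### Global elastic flows as smooth families of curves -/

section link

variable {μ : ℝ} {b : BoundaryCondition} {γ : ℝ → ℝ → Plane} {t x : ℝ}

lemma arcDeriv_slice {F : Type*} [NormedAddCommGroup F] [NormedSpace ℝ F]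
    (hγ : Sm (Function.uncurry γ)) {f : ℝ → F} {g : ℝ × ℝ → F} (hg : Sm g)
    (hf : ∀ y ∈ I, f y = g (t, y)) (ht : 0 < t) (hx : x ∈ I) :
    arcDeriv (γ t) f x = Ds (Function.uncurry γ) g (t, x) := by
  rw [arcDeriv, Ds_eq, speed, ← derivWithin_eq_dX hγ ht hx, ← derivWithin_eq_dX hg ht hx,
    derivWithin_congr hf (hf x hx)]
  rfl

namespace IsGlobalElasticFlow

variable (h : IsGlobalElasticFlow μ b γ)
include h

lemma regularFamily : RegularFamily (Function.uncurry γ) where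
  smooth := h.smooth
  regular := by
    rintro ⟨t, x⟩ ⟨ht, hx⟩
    rw [← derivWithin_eq_dX (f := Function.uncurry γ) h.smooth ht hx]
    exact h.regular t (le_of_lt ht) x hx

lemma tangent_eq (ht : 0 < t) (hx : x ∈ I) : tangent (γ t) x = tau (Function.uncurry γ) (t, x) :=
  arcDeriv_slice h.smooth h.smooth (fun _ _ => rfl) ht hx

lemma normal_eq (ht : 0 < t) (hx : x ∈ I) : normal (γ t) x = nu (Function.uncurry γ) (t, x) := by
  rw [normal, h.tangent_eq ht hx, nu]

lemma curvatureVector_eq (ht : 0 < t) (hx : x ∈ I) :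
    curvatureVector (γ t) x = Ds (Function.uncurry γ) (tau (Function.uncurry γ)) (t, x) :=
  arcDeriv_slice h.smooth h.regularFamily.sm_tau (fun _ hy => h.tangent_eq ht hy) ht hx

lemma curvature_eq (ht : 0 < t) (hx : x ∈ I) :
    curvature (γ t) x = kap (Function.uncurry γ) 0 (t, x) := by
  rw [curvature, h.curvatureVector_eq ht hx, h.normal_eq ht hx, kap]

lemma elasticGradient_eq (ht : 0 < t) (hx : x ∈ I) :
    elasticGradient μ (γ t) x = 2 * kap (Function.uncurry γ) 2 (t, x)
      + kap (Function.uncurry γ) 0 (t, x) ^ 3 - μ * kap (Function.uncurry γ) 0 (t, x) := by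
  have h1 : ∀ y ∈ I, arcDeriv (γ t) (curvature (γ t)) y = kap (Function.uncurry γ) 1 (t, y) :=
    fun y hy => arcDeriv_slice h.smooth (h.regularFamily.sm_kap 0)
      (fun _ hz => h.curvature_eq ht hz) ht hy
  rw [elasticGradient, h.curvature_eq ht hx, arcDeriv_slice h.smooth (h.regularFamily.sm_kap 1)
    h1 ht hx]
  rfl

lemma timeDeriv_eq (ht : 0 < t) (hx : x ∈ I) :
    timeDeriv γ t x = dT (Function.uncurry γ) (t, x) :=
  (hasDerivAt_dT h.smooth ht hx).hasDerivWithinAt.derivWithin (uniqueDiffOn_Ici 0 t ht.le)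

/-- Navier conditions make the family hinged, so a family that is not hinged has clamped conditions
and its end tangents are constant. -/
lemma elasticFamily (hμ : 0 < μ) : ElasticFamily μ (Function.uncurry γ) where
  toRegularFamily := h.regularFamily
  pos := hμ
  law := by
    rintro ⟨t, x⟩ ⟨ht, hx⟩
    have h1 := h.evolution t (le_of_lt ht) x hx
    rw [h.timeDeriv_eq ht hx, h.elasticGradient_eq ht hx, h.tangent_eq ht hx,
      h.normal_eq ht hx] at h1
    have h2 := congrArg (fun v => (inner ℝ v (nu (Function.uncurry γ) (t, x)) : ℝ)) h1
    simp only [inner_sub_left, real_inner_smul_left] at h2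
    rwa [RegularFamily.inner_tau_nu, h.regularFamily.inner_nu_nu (p := (t, x)) ⟨ht, hx⟩, mul_zero,
      sub_zero, mul_one] at h2
  fixed := by
    intro e he
    cases b with
    | navier P Q =>
      rcases he with rfl | rfl
      · exact ⟨P, fun t ht => (h.boundary t (le_of_lt ht)).1⟩
      · exact ⟨Q, fun t ht => (h.boundary t (le_of_lt ht)).2.1⟩
    | clamped P Q τ₀ τ₁ =>
      rcases he with rfl | rfl
      · exact ⟨P, fun t ht => (h.boundary t (le_of_lt ht)).1⟩
      · exact ⟨Q, fun t ht => (h.boundary t (le_of_lt ht)).2.1⟩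
  clamped := by
    intro hn e he
    cases b with
    | navier P Q =>
      refine absurd (fun e he t ht => ?_) hn
      change (inner ℝ (Ds (Function.uncurry γ) (tau (Function.uncurry γ)) (t, e))
        (nu (Function.uncurry γ) (t, e)) : ℝ) = 0
      rw [← h.curvatureVector_eq ht (ends_subset he)]
      have := (h.boundary t (le_of_lt ht)).2.2
      rcases he with rfl | rfl
      · rw [this.1, inner_zero_left]
      · rw [this.2, inner_zero_left]
    | clamped P Q τ₀ τ₁ =>
      rcases he with rfl | rfl
      · refine ⟨τ₀, fun t ht => ?_⟩
        rw [← h.tangent_eq ht (ends_subset zero_mem_ends)]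
        exact (h.boundary t (le_of_lt ht)).2.2.1
      · refine ⟨τ₁, fun t ht => ?_⟩
        rw [← h.tangent_eq ht (ends_subset one_mem_ends)]
        exact (h.boundary t (le_of_lt ht)).2.2.2

end IsGlobalElasticFlow

end link

/-! ### Bounds for the arclength derivatives of the curve -/

/-- The arclength derivatives of the curves of a family. -/
def sder (Γ : ℝ × ℝ → Plane) : ℕ → ℝ × ℝ → Plane
  | 0 => Γ
  | m + 1 => Ds Γ (sder Γ m)

lemma RegularFamily.sm_sder {Γ : ℝ × ℝ → Plane} (h : RegularFamily Γ) : ∀ m, Sm (sder Γ m)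
  | 0 => h.smooth
  | m + 1 => h.sm_Ds (sm_sder h m)

/-- By the Frenet formulas `∂ₛ` preserves this form. Hence bounds for the derivatives of the
curvature bound all arclength derivatives of the curve of positive order. -/
lemma RegularFamily.sder_succ_eq {Γ : ℝ × ℝ → Plane} (h : RegularFamily Γ) (m : ℕ) :
    ∃ w n f g, W Γ w n f ∧ W Γ w n g ∧
      ∀ p ∈ U, sder Γ (m + 1) p = f p • tau Γ p + g p • nu Γ p := by
  induction m with
  | zero =>
    exact ⟨0, 0, fun _ => 1, fun _ => 0, .const _ _ 1, .const _ _ 0, fun p _ => by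
      simp only [one_smul, zero_smul, add_zero]; rfl⟩
  | succ m ih =>
    obtain ⟨w, n, f, g, hf, hg, e⟩ := ih
    have k0 : W Γ (w + 1) (n + 1) (kap Γ 0) := .var (by omega) (by omega)
    have sf := h.sm_W hf
    have sg := h.sm_W hg
    refine ⟨_, n + 1, fun p => Ds Γ f p + (-1) * (kap Γ 0 p * g p),
      fun p => Ds Γ g p + kap Γ 0 p * f p,
      .add (.mono (h.W_Ds hf) (w' := w + 1 + w) (by omega) le_rfl) (.const_mul (-1) (.mul' k0 hg le_rfl le_rfl (by omega))),
      .add (.mono (h.W_Ds hg) (by omega) le_rfl) (.mul' k0 hf le_rfl le_rfl (by omega)),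
      fun p hp => ?_⟩
    change Ds Γ (sder Γ (m + 1)) p = _
    rw [Ds_congr e hp, Ds_add (sf.smul h.sm_tau) (sg.smul h.sm_nu) hp, Ds_smul sf h.sm_tau hp,
      Ds_smul sg h.sm_nu hp, h.Ds_tau hp, h.Ds_nu hp]
    module

namespace ElasticFamily

variable {μ : ℝ} {Γ : ℝ × ℝ → Plane} (h : ElasticFamily μ Γ)
include h

lemma exists_W_bound {w n : ℕ} {f : ℝ × ℝ → ℝ} (hf : W Γ w n f) :
    ∃ C, ∀ t ≥ 1, ∀ x ∈ I, |f (t, x)| ≤ C := by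
  induction hf with
  | const w m c => exact ⟨|c|, fun _ _ _ _ => le_rfl⟩
  | var => exact h.exists_kap_bound _
  | add _ _ ihf ihg =>
    obtain ⟨A, hA⟩ := ihf
    obtain ⟨B, hB⟩ := ihg
    exact ⟨A + B, fun t ht x hx => (abs_add_le _ _).trans (add_le_add (hA t ht x hx) (hB t ht x hx))⟩
  | mul _ _ _ ihf ihg =>
    obtain ⟨A, hA⟩ := ihf
    obtain ⟨B, hB⟩ := ihg
    refine ⟨A * B, fun t ht x hx => ?_⟩
    rw [abs_mul]
    exact mul_le_mul (hA t ht x hx) (hB t ht x hx) (abs_nonneg _)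
      ((abs_nonneg _).trans (hA t ht x hx))
  | congr _ e ihf =>
    obtain ⟨A, hA⟩ := ihf
    refine ⟨A, fun t ht x hx => ?_⟩
    rw [← e (x := (t, x)) ⟨one_pos.trans_le ht, hx⟩]
    exact hA t ht x hx

theorem exists_sder_bound (m : ℕ) : ∃ C, ∀ t ≥ 1, ∀ x ∈ I, ‖sder Γ m (t, x)‖ ≤ C := by
  cases m with
  | zero =>
    obtain ⟨P, hP⟩ := h.fixed 0 zero_mem_ends
    obtain ⟨M, hM, hMb⟩ := h.exists_bounds
    refine ⟨M + ‖P‖, fun t ht x hx => ?_⟩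
    have ht0 : 0 < t := by linarith
    have h1 := h.norm_sub_le_J h.smooth ht0 hx (ends_subset zero_mem_ends)
    have e1 : J Γ (fun p => ‖Ds Γ Γ p‖) t = J Γ (fun _ => 1) t :=
      RegularFamily.J_congr ht0 fun p hp => h.norm_tau hp
    rw [hP t ht0, e1] at h1
    have h2 := norm_le_norm_sub_add (Γ (t, x)) P
    have h3 := (hMb t ht).2
    change ‖Γ (t, x)‖ ≤ _
    linarith
  | succ m =>
    obtain ⟨w, n, f, g, hf, hg, e⟩ := h.sder_succ_eq m
    obtain ⟨A, hA⟩ := h.exists_W_bound hf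
    obtain ⟨B, hB⟩ := h.exists_W_bound hg
    refine ⟨A + B, fun t ht x hx => ?_⟩
    have hp : (t, x) ∈ U := ⟨by simp only [mem_Ioi]; linarith, hx⟩
    rw [e _ hp]
    refine (norm_add_le _ _).trans ?_
    rw [norm_smul, norm_smul, h.norm_tau hp, h.norm_nu hp, mul_one, mul_one]
    exact add_le_add (hA t ht x hx) (hB t ht x hx)

/-- The elastic flow equation in terms of the arclength derivatives of the curve. -/
lemma law_sder {p : ℝ × ℝ} (hp : p ∈ U) :
    2 * ((inner ℝ (sder Γ 4 p) (rot (sder Γ 1 p)) : ℝ) + inner ℝ (sder Γ 3 p) (rot (sder Γ 2 p)))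
      + inner ℝ (sder Γ 2 p) (rot (sder Γ 1 p)) ^ 3
      - μ * inner ℝ (sder Γ 2 p) (rot (sder Γ 1 p)) = -nvel Γ p := by
  have s1 := h.sm_sder 1
  have s2 := h.sm_sder 2
  have s3 := h.sm_sder 3
  have r1 : Sm (fun p => rot (sder Γ 1 p)) := rotL.contDiff.comp_contDiffOn s1
  have r2 : Sm (fun p => rot (sder Γ 2 p)) := rotL.contDiff.comp_contDiffOn s2
  have d1 : ∀ q ∈ U, Ds Γ (fun p => rot (sder Γ 1 p)) q = rot (sder Γ 2 q) := fun q hq =>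
    der_clm rotL s1 hq
  have k1 : ∀ q ∈ U, kap Γ 1 q = inner ℝ (sder Γ 3 q) (rot (sder Γ 1 q)) := by
    intro q hq
    have e : kap Γ 1 = Ds Γ (fun p => (inner ℝ (sder Γ 2 p) (rot (sder Γ 1 p)) : ℝ)) := rfl
    rw [e, Ds, der_inner s2 r1 hq]
    change (inner ℝ (sder Γ 2 q) (Ds Γ (fun p => rot (sder Γ 1 p)) q) : ℝ) +
      inner ℝ (sder Γ 3 q) _ = _
    rw [d1 q hq, inner_rot_self, zero_add]
  have k2 : kap Γ 2 p = inner ℝ (sder Γ 3 p) (rot (sder Γ 2 p))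
      + inner ℝ (sder Γ 4 p) (rot (sder Γ 1 p)) := by
    change Ds Γ (kap Γ 1) p = _
    rw [Ds_congr k1 hp, Ds, der_inner s3 r1 hp]
    change (inner ℝ (sder Γ 3 p) (Ds Γ (fun p => rot (sder Γ 1 p)) p) : ℝ) +
      inner ℝ (sder Γ 4 p) _ = _
    rw [d1 p hp]
  rw [h.law p hp, k2]
  change _ = - -(_ + (inner ℝ (sder Γ 2 p) (rot (sder Γ 1 p)) : ℝ) ^ 3
    - μ * inner ℝ (sder Γ 2 p) (rot (sder Γ 1 p)))
  ring

end ElasticFamily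

end

section

/-! ### Reparametrization by a multiple of the arclength -/

/-- A smooth positive density on `[0,1]` is pulled back to a constant one by a smooth
diffeomorphism. -/
lemma exists_isReparametrization {g : ℝ → ℝ} (hg : ContDiffOn ℝ ∞ g I) (hpos : ∀ x ∈ I, 0 < g x) :
    ∃ φ : ℝ → ℝ, IsReparametrization φ ∧ MapsTo φ I I ∧
      ∀ x ∈ I, HasDerivWithinAt φ ((∫ y in (0 : ℝ)..1, g y) / g (φ x)) I x := by
  -- Extending the density by constants makes the normalized arclength `S` a differentiable
  -- bijection of the whole line; the diffeomorphism is its inverse.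
  set G : ℝ → ℝ := IccExtend zero_le_one (I.domRestrict g) with hG
  have hGI : ∀ x ∈ I, G x = g x := fun x hx => IccExtend_of_mem _ _ hx
  have hGc : Continuous G := (continuousOn_iff_continuous_domRestrict.1 hg.continuousOn).Icc_extend'
  obtain ⟨z, hz, hzm⟩ := isCompact_Icc.exists_isMinOn (nonempty_Icc.2 zero_le_one) hg.continuousOn
  have hm : 0 < g z := hpos z hz
  have hGm : ∀ x, g z ≤ G x := fun x => hzm (projIcc 0 1 zero_le_one x).2
  have hGpos : ∀ x, 0 < G x := fun x => hm.trans_le (hGm x)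
  set ℓ := ∫ y in (0 : ℝ)..1, g y with hℓ
  have hℓG : ∫ y in (0 : ℝ)..1, G y = ℓ := by
    refine intervalIntegral.integral_congr fun x hx => ?_
    rw [uIcc_of_le zero_le_one] at hx
    exact hGI x hx
  have hℓ0 : 0 < ℓ := by
    rw [← hℓG]
    exact intervalIntegral.intervalIntegral_pos_of_pos_on (hGc.intervalIntegrable _ _)
      (fun x _ => hGpos x) zero_lt_one
  set S : ℝ → ℝ := fun x => ℓ⁻¹ * ∫ y in (0 : ℝ)..x, G y with hS
  have hS' : ∀ x, HasDerivAt S (ℓ⁻¹ * G x) x := fun x =>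
    (intervalIntegral.integral_hasDerivAt_right (hGc.intervalIntegrable _ _)
      (hGc.stronglyMeasurableAtFilter _ _) hGc.continuousAt).const_mul _
  have hSc : Continuous S := continuous_iff_continuousAt.2 fun x => (hS' x).continuousAt
  have hSm : StrictMono S := strictMono_of_hasDerivAt_pos hS' fun x => by
    have := hGpos x
    positivity
  have hS0 : S 0 = 0 := by simp [hS]
  have hS1 : S 1 = 1 := by
    simp only [hS, hℓG]; exact inv_mul_cancel₀ hℓ0.ne'
  set c := ℓ⁻¹ * g z with hc
  have hc0 : 0 < c := by positivity
  -- The slope of `S` is at least `c > 0`, so `S` tends to infinity in both directions and is onto.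
  have hT : Monotone fun x => S x - c * x := by
    refine monotone_of_hasDerivAt_nonneg (f' := fun x => ℓ⁻¹ * G x - c * 1)
      (fun x => (hS' x).sub ((hasDerivAt_id x).const_mul c)) fun x => ?_
    have := mul_le_mul_of_nonneg_left (hGm x) (inv_nonneg.2 hℓ0.le)
    simp only [Pi.zero_apply]
    linarith
  have hsurj : Function.Surjective S := by
    refine hSc.surjective ?_ ?_
    · refine tendsto_atTop_mono' _ ?_ (tendsto_id.const_mul_atTop hc0)
      filter_upwards [eventually_ge_atTop 0] with x hx
      have := hT hx
      simp only [hS0] at this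
      simp only [id]
      linarith
    · refine tendsto_atBot_mono' _ ?_ (tendsto_id.const_mul_atBot hc0)
      filter_upwards [eventually_le_atBot 0] with x hx
      have := hT hx
      simp only [hS0] at this
      simp only [id]
      linarith
  set e := hSm.orderIsoOfSurjective S hsurj with he
  have heS : ∀ x, e x = S x := fun _ => rfl
  have hSe : ∀ x, S (e.symm x) = x := fun x => e.apply_symm_apply x
  have h0 : e.symm 0 = 0 := e.symm_apply_eq.2 (by rw [heS, hS0])
  have h1 : e.symm 1 = 1 := e.symm_apply_eq.2 (by rw [heS, hS1])
  have hmaps : MapsTo e.symm I I := fun x hx =>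
    ⟨h0 ▸ e.symm.monotone hx.1, h1 ▸ e.symm.monotone hx.2⟩
  have hder : ∀ x ∈ I, HasDerivWithinAt e.symm (ℓ / g (e.symm x)) I x := fun x hx => by
    have h2 := HasDerivAt.of_local_left_inverse e.symm.continuous.continuousAt (hS' (e.symm x))
      (by have := hGpos (e.symm x); positivity) (Eventually.of_forall hSe)
    rw [hGI _ (hmaps hx), mul_inv, inv_inv] at h2
    exact h2.hasDerivWithinAt
  have hderiv : ∀ x ∈ I, derivWithin e.symm I x = ℓ / g (e.symm x) := fun x hx =>
    (hder x hx).derivWithin (uniqueDiffOn_I x hx)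
  refine ⟨e.symm, ⟨contDiffOn_infty.2 fun n => ?_, h0, h1, fun x hx => ?_⟩, hmaps, hder⟩
  -- Bootstrap: the derivative `ℓ / g ∘ φ` is as smooth as `φ`, so `φ` gains one order at a time.
  · induction n with
    | zero => exact contDiffOn_zero.2 e.symm.continuous.continuousOn
    | succ n ih =>
      push_cast
      refine (contDiffOn_succ_iff_derivWithin uniqueDiffOn_I).2
        ⟨fun x hx => (hder x hx).differentiableWithinAt, fun hn => absurd hn (by simp), ?_⟩
      refine ContDiffOn.congr ?_ hderiv
      refine contDiffOn_const.div ((hg.of_le (by exact_mod_cast le_top)).comp ih hmaps) fun x hx => ?_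
      exact (hpos _ (hmaps hx)).ne'
  · rw [hderiv x hx]
    exact div_pos hℓ0 (hpos _ (hmaps hx))

/-! ### Compactness -/

lemma iteratedDerivWithin_of_hasDerivWithinAt {E : Type*} [NormedAddCommGroup E] [NormedSpace ℝ E]
    {f : ℕ → ℝ → E} (hf : ∀ m, ∀ x ∈ I, HasDerivWithinAt (f m) (f (m + 1) x) I x) (m : ℕ) :
    EqOn (iteratedDerivWithin m (f 0) I) (f m) I := by
  induction m with
  | zero => intro x _; rw [iteratedDerivWithin_zero]
  | succ m ih =>
    intro x hx
    rw [iteratedDerivWithin_succ, derivWithin_congr ih (ih hx)]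
    exact (hf m x hx).derivWithin (uniqueDiffOn_I x hx)

lemma contDiffOn_of_hasDerivWithinAt {E : Type*} [NormedAddCommGroup E] [NormedSpace ℝ E]
    {f : ℕ → ℝ → E} (hf : ∀ m, ∀ x ∈ I, HasDerivWithinAt (f m) (f (m + 1) x) I x) :
    ContDiffOn ℝ ∞ (f 0) I := by
  refine contDiffOn_infty.2 fun n => ?_
  suffices ∀ n m : ℕ, ContDiffOn ℝ n (f m) I from this n 0
  intro n
  induction n with
  | zero => exact fun m => contDiffOn_zero.2 fun x hx => (hf m x hx).continuousWithinAt
  | succ n ih =>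
    intro m
    push_cast
    refine (contDiffOn_succ_iff_derivWithin uniqueDiffOn_I).2
      ⟨fun x hx => (hf m x hx).differentiableWithinAt, fun hn => absurd hn (by simp), ?_⟩
    exact (ih (m + 1)).congr fun x hx => (hf m x hx).derivWithin (uniqueDiffOn_I x hx)

/-- The fundamental theorem of calculus passes to the limit by dominated convergence, and the limit
identity is differentiated again. -/
lemma hasDerivWithinAt_of_tendsto {E : Type*} [NormedAddCommGroup E] [NormedSpace ℝ E]
    [CompleteSpace E] {f f' : ℕ → ℝ → E} {g g' : ℝ → E} {C : ℝ}
    (hf : ∀ n, ∀ x ∈ I, HasDerivWithinAt (f n) (f' n x) I x) (hc : ∀ n, ContinuousOn (f' n) I)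
    (hb : ∀ n, ∀ x ∈ I, ‖f' n x‖ ≤ C) (hg : ∀ x ∈ I, Tendsto (fun n => f n x) atTop (nhds (g x)))
    (hg' : ∀ x ∈ I, Tendsto (fun n => f' n x) atTop (nhds (g' x))) (hgc : ContinuousOn g' I) :
    ∀ x ∈ I, HasDerivWithinAt g (g' x) I x := by
  have key : ∀ x ∈ I, g x = g 0 + ∫ y in (0 : ℝ)..x, g' y := by
    intro x hx
    have hsub : Icc 0 x ⊆ I := Icc_subset_Icc_right hx.2
    have hoc : uIoc 0 x ⊆ I := by
      rw [uIoc_of_le hx.1]; exact Ioc_subset_Icc_self.trans hsub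
    have h1 : ∀ n, ∫ y in (0 : ℝ)..x, f' n y = f n x - f n 0 := fun n =>
      intervalIntegral.integral_eq_sub_of_hasDeriv_right_of_le hx.1
        (fun y hy => ((hf n y (hsub hy)).continuousWithinAt).mono hsub)
        (fun y hy => ((hf n y (hsub (Ioo_subset_Icc_self hy))).hasDerivAt
          (Icc_mem_nhds hy.1 (hy.2.trans_le hx.2))).hasDerivWithinAt)
        (ContinuousOn.intervalIntegrable (by rw [uIcc_of_le hx.1]; exact (hc n).mono hsub))
    have h2 : Tendsto (fun n => ∫ y in (0 : ℝ)..x, f' n y) atTop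
        (nhds (∫ y in (0 : ℝ)..x, g' y)) := by
      refine intervalIntegral.tendsto_integral_filter_of_dominated_convergence (fun _ => C)
        (Eventually.of_forall fun n => ?_) (Eventually.of_forall fun n => Eventually.of_forall
          fun y hy => hb n y (hoc hy)) intervalIntegrable_const
        (Eventually.of_forall fun y hy => hg' y (hoc hy))
      exact (ContinuousOn.intervalIntegrable (by
        rw [uIcc_of_le hx.1]; exact (hc n).mono hsub)).def'.aestronglyMeasurable
    simp only [h1] at h2
    have h3 := tendsto_nhds_unique h2 ((hg x hx).sub (hg 0 ⟨le_rfl, zero_le_one⟩))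
    rw [h3]; abel
  set G : ℝ → E := IccExtend zero_le_one (I.domRestrict g') with hG
  have hGI : ∀ x ∈ I, G x = g' x := fun x hx => IccExtend_of_mem _ _ hx
  have hGc : Continuous G := (continuousOn_iff_continuous_domRestrict.1 hgc).Icc_extend'
  intro x hx
  have h4 : HasDerivAt (fun x => g 0 + ∫ y in (0 : ℝ)..x, G y) (G x) x :=
    (intervalIntegral.integral_hasDerivAt_right (hGc.intervalIntegrable _ _)
      (hGc.stronglyMeasurableAtFilter _ _) hGc.continuousAt).const_add _
  rw [hGI x hx] at h4
  have h5 : ∀ z ∈ I, g z = g 0 + ∫ y in (0 : ℝ)..z, G y := fun z hz => by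
    rw [key z hz]
    congr 1
    refine intervalIntegral.integral_congr fun y hy => ?_
    rw [uIcc_of_le hz.1] at hy
    exact (hGI y ⟨hy.1, hy.2.trans hz.2⟩).symm
  exact h4.hasDerivWithinAt.congr h5 (h5 x hx)

/-- Sequences of curves all of whose derivatives are bounded have smoothly convergent
subsequences. -/
theorem exists_smooth_limit {E : Type*} [NormedAddCommGroup E] [NormedSpace ℝ E] [ProperSpace E]
    {f : ℕ → ℕ → ℝ → E} (hf : ∀ n m, ∀ x ∈ I, HasDerivWithinAt (f n m) (f n (m + 1) x) I x)
    (hb : ∀ m, ∃ C, ∀ n, ∀ x ∈ I, ‖f n m x‖ ≤ C) :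
    ∃ (σ : ℕ → ℕ) (g : ℕ → ℝ → E), StrictMono σ ∧
      (∀ m, TendstoUniformlyOn (fun j => f (σ j) m) (g m) atTop I) ∧
      ∀ m, ∀ x ∈ I, HasDerivWithinAt (g m) (g (m + 1) x) I x := by
  choose C hC using hb
  have hc : ∀ n m, ContinuousOn (f n m) I := fun n m x hx => (hf n m x hx).continuousWithinAt
  let F : ℕ → ∀ _ : ℕ, BoundedContinuousFunction I E := fun n m =>
    BoundedContinuousFunction.mkOfCompact
      ⟨I.domRestrict (f n m), continuousOn_iff_continuous_domRestrict.1 (hc n m)⟩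
  have hF : ∀ n m (x : I), F n m x = f n m x := fun _ _ _ => rfl
  have hK : ∀ m, IsCompact (closure (range fun n => F n m)) := fun m => by
    refine BoundedContinuousFunction.arzela_ascoli (Metric.closedBall 0 (C m))
      (isCompact_closedBall _ _) _ ?_ ?_
    · rintro _ x ⟨n, rfl⟩
      rw [mem_closedBall_zero_iff]
      exact hC m n x x.2
    · have hC0 : 0 ≤ C (m + 1) := (norm_nonneg _).trans (hC (m + 1) 0 0 ⟨le_rfl, zero_le_one⟩)
      have hlip : ∀ A : range fun n => F n m, LipschitzWith (C (m + 1)).toNNReal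
          (A : BoundedContinuousFunction I E) := by
        rintro ⟨_, n, rfl⟩
        have := (convex_Icc (0 : ℝ) 1).lipschitzOnWith_of_nnnorm_hasDerivWithin_le
          (C := (C (m + 1)).toNNReal) (hf n m) fun x hx => by
            rw [← NNReal.coe_le_coe, coe_nnnorm, Real.coe_toNNReal _ hC0]
            exact hC (m + 1) n x hx
        exact (lipschitzOnWith_iff_restrict.1 this)
      exact (LipschitzWith.uniformEquicontinuous _ _ hlip).equicontinuous
  -- For each order Arzelà-Ascoli applies, since the next order bounds the Lipschitz constant.
  -- Compactness of the countable product yields one subsequence for all orders, in place of a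
  -- diagonal argument.
  obtain ⟨G, -, σ, hσ, hlim⟩ := (isCompact_univ_pi hK).tendsto_subseq (x := F)
    fun n m _ => subset_closure ⟨n, rfl⟩
  set g : ℕ → ℝ → E := fun m => IccExtend zero_le_one (G m) with hg
  have hgG : ∀ m (x : I), g m x = G m x := fun m x => IccExtend_val _ _ x
  have hgc : ∀ m, Continuous (g m) := fun m => (G m).continuous.Icc_extend'
  have hunif : ∀ m, TendstoUniformlyOn (fun j => f (σ j) m) (g m) atTop I := fun m => by
    have h1 := BoundedContinuousFunction.tendsto_iff_tendstoUniformly.1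
      ((tendsto_pi_nhds.1 hlim) m)
    rw [tendstoUniformlyOn_iff_tendstoUniformly_comp_coe]
    rwa [show g m ∘ ((↑) : I → ℝ) = G m from funext (hgG m)]
  refine ⟨σ, g, hσ, hunif, fun m => ?_⟩
  exact hasDerivWithinAt_of_tendsto (fun n => hf (σ n) m) (fun n => hc (σ n) (m + 1))
    (fun n => hC (m + 1) (σ n)) (fun x hx => (hunif m).tendsto_at hx)
    (fun x hx => (hunif (m + 1)).tendsto_at hx) (hgc (m + 1)).continuousOn

end

section

/-! ### The elastic energy of curves of class `C²` -/

lemma hasDerivAt_integral_of_continuousOn {f f' : ℝ → ℝ → ℝ} {δ : ℝ} (hδ : 0 < δ)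
    (hf : ∀ ε ∈ Icc (-δ) δ, ContinuousOn (f ε) I)
    (hf' : ContinuousOn (Function.uncurry f') (Icc (-δ) δ ×ˢ I))
    (hd : ∀ ε ∈ Icc (-δ) δ, ∀ x ∈ I, HasDerivAt (fun e => f e x) (f' ε x) ε) :
    HasDerivAt (fun ε => ∫ x in (0 : ℝ)..1, f ε x) (∫ x in (0 : ℝ)..1, f' 0 x) 0 := by
  have hI : uIoc (0 : ℝ) 1 ⊆ I := by
    rw [uIoc_of_le zero_le_one]; exact Ioc_subset_Icc_self
  have hII : uIcc (0 : ℝ) 1 = I := uIcc_of_le zero_le_one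
  have h0 : (0 : ℝ) ∈ Icc (-δ) δ := ⟨by linarith, hδ.le⟩
  have hs : Icc (-δ) δ ∈ nhds (0 : ℝ) := Icc_mem_nhds (by linarith) hδ
  obtain ⟨C, hC⟩ := (isCompact_Icc.prod isCompact_Icc).exists_bound_of_continuousOn hf'
  have hint : ∀ ε ∈ Icc (-δ) δ, IntervalIntegrable (f ε) MeasureTheory.volume 0 1 := fun ε hε =>
    ContinuousOn.intervalIntegrable (by rw [hII]; exact hf ε hε)
  have hint' : IntervalIntegrable (f' 0) MeasureTheory.volume 0 1 :=
    ContinuousOn.intervalIntegrable (by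
      rw [hII]
      exact hf'.comp (f := fun x => ((0 : ℝ), x)) (by fun_prop) fun x hx => ⟨h0, hx⟩)
  refine (intervalIntegral.hasDerivAt_integral_of_dominated_loc_of_deriv_le
    (bound := fun _ => C) hs ?_ (hint 0 h0) hint'.def'.aestronglyMeasurable ?_
    intervalIntegrable_const ?_).2
  · filter_upwards [hs] with s hs
    exact (hint s hs).def'.aestronglyMeasurable
  · exact Eventually.of_forall fun x hx s hs => hC (s, x) ⟨hs, hI hx⟩
  · exact Eventually.of_forall fun x hx s hs => hd s hs x (hI hx)

lemma arcDeriv_eq {F : Type*} [NormedAddCommGroup F] [NormedSpace ℝ F] {c : ℝ → Plane} {f : ℝ → F}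
    {x : ℝ} {v : Plane} {w : F} (hx : x ∈ I) (hc : HasDerivWithinAt c v I x)
    (hf : HasDerivWithinAt f w I x) : arcDeriv c f x = ‖v‖⁻¹ • w := by
  rw [arcDeriv, hc.derivWithin (uniqueDiffOn_I x hx), hf.derivWithin (uniqueDiffOn_I x hx)]

/-- Differentiating the factor `‖c₁‖⁻¹` in the tangent only adds a multiple of `c₁`, which is
orthogonal to the normal. -/
lemma curvature_eq_of_hasDerivWithinAt {c c₁ c₂ : ℝ → Plane}
    (h₁ : ∀ x ∈ I, HasDerivWithinAt c (c₁ x) I x) (h₂ : ∀ x ∈ I, HasDerivWithinAt c₁ (c₂ x) I x)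
    (h₀ : ∀ x ∈ I, c₁ x ≠ 0) {x : ℝ} (hx : x ∈ I) :
    curvature c x = inner ℝ (c₂ x) (rot (c₁ x)) * ‖c₁ x‖⁻¹ ^ 3 := by
  have ht : ∀ y ∈ I, tangent c y = ‖c₁ y‖⁻¹ • c₁ y := fun y hy =>
    arcDeriv_eq hy (h₁ y hy) (h₁ y hy)
  have hd : DifferentiableWithinAt ℝ (fun y => ‖c₁ y‖⁻¹) I x :=
    ((h₂ x hx).differentiableWithinAt.norm ℝ (h₀ x hx)).inv (norm_ne_zero_iff.2 (h₀ x hx))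
  have h3 := (hd.hasDerivWithinAt.smul (h₂ x hx)).congr ht (ht x hx)
  rw [curvature, normal, curvatureVector, arcDeriv_eq hx (h₁ x hx) h3, ht x hx, rot_smul]
  simp only [real_inner_smul_left, real_inner_smul_right, inner_add_left, inner_rot_self]
  ring

lemma elasticEnergy_eq (μ : ℝ) {c c₁ c₂ : ℝ → Plane}
    (h₁ : ∀ x ∈ I, HasDerivWithinAt c (c₁ x) I x) (h₂ : ∀ x ∈ I, HasDerivWithinAt c₁ (c₂ x) I x)
    (h₀ : ∀ x ∈ I, c₁ x ≠ 0) :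
    elasticEnergy μ c = ∫ x in (0 : ℝ)..1,
      ((inner ℝ (c₂ x) (rot (c₁ x)) * ‖c₁ x‖⁻¹ ^ 3) ^ 2 + μ) * ‖c₁ x‖ := by
  refine intervalIntegral.integral_congr fun x hx => ?_
  rw [uIcc_of_le zero_le_one] at hx
  simp only [curvature_eq_of_hasDerivWithinAt h₁ h₂ h₀ hx,
    (h₁ x hx).derivWithin (uniqueDiffOn_I x hx)]

/-- The derivative of the energy density along the variation `ε ↦ (v + ε p, w + ε q)` of the first
and second derivatives of the curve. -/
lemma hasDerivAt_density (μ : ℝ) {v w p q : Plane} {ε : ℝ} (h0 : v + ε • p ≠ 0) :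
    HasDerivAt (fun e : ℝ => ((inner ℝ (w + e • q) (rot (v + e • p)) * ‖v + e • p‖⁻¹ ^ 3) ^ 2 + μ)
        * ‖v + e • p‖)
      (2 * inner ℝ (w + ε • q) (rot (v + ε • p)) * (inner ℝ (w + ε • q) (rot p)
          + inner ℝ q (rot (v + ε • p))) * ‖v + ε • p‖⁻¹ ^ 5
        + (μ * ‖v + ε • p‖⁻¹ - 5 * inner ℝ (w + ε • q) (rot (v + ε • p)) ^ 2 * ‖v + ε • p‖⁻¹ ^ 7)
          * inner ℝ (v + ε • p) p) ε := by
  have hv : HasDerivAt (fun e : ℝ => v + e • p) p ε := by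
    simpa using ((hasDerivAt_id ε).smul_const p).const_add v
  have hw : HasDerivAt (fun e : ℝ => w + e • q) q ε := by
    simpa using ((hasDerivAt_id ε).smul_const q).const_add w
  have hr : HasDerivAt (fun e : ℝ => rot (v + e • p)) (rot p) ε :=
    rotL.hasFDerivAt.comp_hasDerivAt ε hv
  have hN0 : ‖v + ε • p‖ ≠ 0 := norm_ne_zero_iff.2 h0
  have hN : HasDerivAt (fun e : ℝ => ‖v + e • p‖) (inner ℝ (v + ε • p) p * ‖v + ε • p‖⁻¹) ε := by
    have h1 := hv.norm_sq.sqrt (pow_ne_zero 2 hN0)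
    simp only [Real.sqrt_sq (norm_nonneg _)] at h1
    convert h1 using 1
    field_simp
  have hu := hw.inner ℝ hr
  refine ((((hu.fun_mul ((hN.fun_inv hN0).fun_pow 3)).fun_pow 2).add_const μ).fun_mul hN).congr_deriv ?_
  push_cast
  field_simp
  ring

/-! ### Curves of constant speed -/

/-- `g m` is the derivative of order `m` of a curve `g 0` of constant speed `L`. -/
structure ConstSpeed (L : ℝ) (g : ℕ → ℝ → Plane) : Prop where
  pos : 0 < L
  deriv : ∀ m, ∀ x ∈ I, HasDerivWithinAt (g m) (g (m + 1) x) I x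
  norm : ∀ x ∈ I, ‖g 1 x‖ = L

lemma smul_eq_of_inner_eq_zero {v w : Plane} (h : (inner ℝ w v : ℝ) = 0) :
    ‖v‖ ^ 2 • w = (inner ℝ w (rot v) : ℝ) • rot v := by
  rw [plane_inner] at h
  rw [plane_norm_sq, plane_inner]
  ext i
  fin_cases i
  · simp; linear_combination v 0 * h
  · simp; linear_combination v 1 * h

namespace ConstSpeed

variable {L μ : ℝ} {g : ℕ → ℝ → Plane} (h : ConstSpeed L g) {x : ℝ}
include h

lemma cont (m : ℕ) : ContinuousOn (g m) I := fun x hx => (h.deriv m x hx).continuousWithinAt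

lemma ne_zero (hx : x ∈ I) : g 1 x ≠ 0 := norm_pos_iff.1 (by rw [h.norm x hx]; exact h.pos)

lemma isSmoothRegular : IsSmoothRegular (g 0) where
  smooth := contDiffOn_of_hasDerivWithinAt h.deriv
  regular x hx := by
    rw [(h.deriv 0 x hx).derivWithin (uniqueDiffOn_I x hx)]
    exact h.ne_zero hx

lemma hasDerivWithinAt_rot (m : ℕ) (hx : x ∈ I) :
    HasDerivWithinAt (fun y => rot (g m y)) (rot (g (m + 1) x)) I x :=
  rotL.hasFDerivAt.comp_hasDerivWithinAt x (h.deriv m x hx)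

lemma inner_eq_zero (hx : x ∈ I) : (inner ℝ (g 2 x) (g 1 x) : ℝ) = 0 := by
  have h1 : HasDerivWithinAt (fun y => ‖g 1 y‖ ^ 2) (2 * inner ℝ (g 1 x) (g 2 x)) I x :=
    (h.deriv 1 x hx).norm_sq
  have h2 : HasDerivWithinAt (fun y => ‖g 1 y‖ ^ 2) 0 I x :=
    (hasDerivWithinAt_const x I (L ^ 2)).congr (fun y hy => by rw [h.norm y hy])
      (by rw [h.norm x hx])
  have h3 := (uniqueDiffOn_I x hx).eq_deriv _ h1 h2
  rw [real_inner_comm]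
  linarith

lemma second_eq (hx : x ∈ I) :
    g 2 x = ((inner ℝ (g 2 x) (rot (g 1 x)) : ℝ) * L⁻¹ ^ 2) • rot (g 1 x) := by
  have h1 := smul_eq_of_inner_eq_zero (h.inner_eq_zero hx)
  rw [h.norm x hx] at h1
  rw [mul_comm, ← smul_smul, ← h1, smul_smul, ← mul_pow, inv_mul_cancel₀ h.pos.ne', one_pow,
    one_smul]

lemma rot_second_eq (hx : x ∈ I) :
    rot (g 2 x) = (-((inner ℝ (g 2 x) (rot (g 1 x)) : ℝ) * L⁻¹ ^ 2)) • g 1 x := by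
  conv_lhs => rw [h.second_eq hx, rot_smul, rot_rot]
  module

lemma arcDeriv_eq' {F : Type*} [NormedAddCommGroup F] [NormedSpace ℝ F] {f : ℝ → F} {w : F}
    (hx : x ∈ I) (hf : HasDerivWithinAt f w I x) : arcDeriv (g 0) f x = L⁻¹ • w := by
  rw [arcDeriv_eq hx (h.deriv 0 x hx) hf, h.norm x hx]

lemma tangent_eq (hx : x ∈ I) : tangent (g 0) x = L⁻¹ • g 1 x := h.arcDeriv_eq' hx (h.deriv 0 x hx)

lemma curvatureVector_eq (hx : x ∈ I) : curvatureVector (g 0) x = L⁻¹ • L⁻¹ • g 2 x :=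
  h.arcDeriv_eq' hx (((h.deriv 1 x hx).const_smul L⁻¹).congr (fun _ hy => h.tangent_eq hy)
    (h.tangent_eq hx))

lemma hasDerivWithinAt_inner₂ (hx : x ∈ I) :
    HasDerivWithinAt (fun y => (inner ℝ (g 2 y) (rot (g 1 y)) : ℝ))
      (inner ℝ (g 3 x) (rot (g 1 x))) I x := by
  have := (h.deriv 2 x hx).inner ℝ (h.hasDerivWithinAt_rot 1 hx)
  rwa [inner_rot_self, zero_add] at this

lemma hasDerivWithinAt_inner₃ (hx : x ∈ I) :
    HasDerivWithinAt (fun y => (inner ℝ (g 3 y) (rot (g 1 y)) : ℝ))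
      (inner ℝ (g 3 x) (rot (g 2 x)) + inner ℝ (g 4 x) (rot (g 1 x))) I x :=
  (h.deriv 3 x hx).inner ℝ (h.hasDerivWithinAt_rot 1 hx)

lemma curvature_eq (hx : x ∈ I) :
    curvature (g 0) x = L⁻¹ ^ 3 * inner ℝ (g 2 x) (rot (g 1 x)) := by
  rw [curvature_eq_of_hasDerivWithinAt (h.deriv 0) (h.deriv 1) (fun _ hy => h.ne_zero hy) hx,
    h.norm x hx, mul_comm]

lemma elasticGradient_eq (hx : x ∈ I) :
    elasticGradient μ (g 0) x = 2 * L⁻¹ ^ 5 * (inner ℝ (g 3 x) (rot (g 2 x))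
      + inner ℝ (g 4 x) (rot (g 1 x))) + (L⁻¹ ^ 3 * inner ℝ (g 2 x) (rot (g 1 x))) ^ 3
      - μ * (L⁻¹ ^ 3 * inner ℝ (g 2 x) (rot (g 1 x))) := by
  have h1 : ∀ y ∈ I, arcDeriv (g 0) (curvature (g 0)) y =
      L⁻¹ ^ 4 * inner ℝ (g 3 y) (rot (g 1 y)) := fun y hy => by
    rw [h.arcDeriv_eq' hy (((h.hasDerivWithinAt_inner₂ hy).const_mul (L⁻¹ ^ 3)).congr
      (fun _ hz => h.curvature_eq hz) (h.curvature_eq hy)), smul_eq_mul]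
    ring
  rw [elasticGradient, h.curvature_eq hx, h.arcDeriv_eq' hx
    (((h.hasDerivWithinAt_inner₃ hx).const_mul (L⁻¹ ^ 4)).congr h1 (h1 x hx)), smul_eq_mul]
  ring

/-- The first variation of the energy density is an exact derivative. -/
lemma hasDerivWithinAt_firstVariation (hel : ∀ x ∈ I, elasticGradient μ (g 0) x = 0)
    {ψ p : ℝ → Plane} {q : Plane} (hx : x ∈ I) (hp : HasDerivWithinAt ψ (p x) I x)
    (hq : HasDerivWithinAt p q I x) :
    HasDerivWithinAt (fun y => 2 * L⁻¹ ^ 5 * ((inner ℝ (g 2 y) (rot (g 1 y)) : ℝ)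
        * inner ℝ (p y) (rot (g 1 y)))
      + inner ℝ (ψ y) ((μ * L⁻¹ - L⁻¹ ^ 7 * inner ℝ (g 2 y) (rot (g 1 y)) ^ 2) • g 1 y
        - (2 * L⁻¹ ^ 5 * inner ℝ (g 3 y) (rot (g 1 y)) : ℝ) • rot (g 1 y)))
      (2 * inner ℝ (g 2 x) (rot (g 1 x)) * (inner ℝ (g 2 x) (rot (p x))
          + inner ℝ q (rot (g 1 x))) * L⁻¹ ^ 5
        + (μ * L⁻¹ - 5 * inner ℝ (g 2 x) (rot (g 1 x)) ^ 2 * L⁻¹ ^ 7) * inner ℝ (g 1 x) (p x))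
      I x := by
  have hu := h.hasDerivWithinAt_inner₂ hx
  have hu1 := h.hasDerivWithinAt_inner₃ hx
  have hr := h.hasDerivWithinAt_rot 1 hx
  have hY := ((((hu.fun_pow 2).const_mul (L⁻¹ ^ 7)).const_sub (μ * L⁻¹)).fun_smul (h.deriv 1 x hx)).fun_sub
    ((hu1.const_mul (2 * L⁻¹ ^ 5)).fun_smul hr)
  have hE := hel x hx
  rw [h.elasticGradient_eq hx] at hE
  have e2 := h.second_eq hx
  have e3 := h.rot_second_eq hx
  have er : (inner ℝ (g 2 x) (rot (p x)) : ℝ) =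
      (inner ℝ (g 2 x) (rot (g 1 x)) : ℝ) * L⁻¹ ^ 2 * inner ℝ (g 1 x) (p x) := by
    conv_lhs => rw [e2, real_inner_smul_left, inner_rot_rot]
  -- The vector field paired with `ψ` is the conserved current belonging to translations; its
  -- derivative is a multiple of the elastic gradient times the normal, hence zero.
  have hY0 : HasDerivWithinAt (fun y =>
      (μ * L⁻¹ - L⁻¹ ^ 7 * inner ℝ (g 2 y) (rot (g 1 y)) ^ 2) • g 1 y
        - (2 * L⁻¹ ^ 5 * inner ℝ (g 3 y) (rot (g 1 y)) : ℝ) • rot (g 1 y)) 0 I x := by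
    refine hY.congr_deriv ?_
    change _ • g 2 x + _ • g 1 x - (_ • rot (g 2 x) + _) = _
    generalize (inner ℝ (g 2 x) (rot (g 1 x)) : ℝ) = u at *
    generalize (inner ℝ (g 3 x) (rot (g 2 x)) : ℝ) = w at *
    rw [e3, e2]
    norm_num
    have e := congrArg (fun r : ℝ => (-r) • rot (g 1 x)) hE
    simp only [neg_zero, zero_smul] at e
    rw [← e]
    module
  have hH := ((hu.fun_mul (hq.inner ℝ hr)).const_mul (2 * L⁻¹ ^ 5)).fun_add (hp.inner ℝ hY0)
  refine hH.congr_deriv ?_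
  change _ * (_ + _ * ((inner ℝ (p x) (rot (g 2 x)) : ℝ) + _)) + _ = _
  rw [er, e3, inner_zero_right, zero_add]
  simp only [inner_sub_right, real_inner_smul_right]
  rw [real_inner_comm (g 1 x) (p x)]
  ring

/-- The first variation of the elastic energy at a solution of the Euler-Lagrange equation is a
boundary term. -/
lemma hasDerivAt_elasticEnergy (hel : ∀ x ∈ I, elasticGradient μ (g 0) x = 0)
    {ψ p q : ℝ → Plane} (hp : ∀ x ∈ I, HasDerivWithinAt ψ (p x) I x)
    (hq : ∀ x ∈ I, HasDerivWithinAt p (q x) I x) (hqc : ContinuousOn q I)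
    (h0 : ψ 0 = 0) (h1 : ψ 1 = 0)
    (hb : ∀ e ∈ ends, (inner ℝ (g 2 e) (rot (g 1 e)) : ℝ) * inner ℝ (p e) (rot (g 1 e)) = 0) :
    HasDerivAt (fun ε : ℝ => elasticEnergy μ (fun x => g 0 x + ε • ψ x)) 0 0 := by
  have hpc : ContinuousOn p I := fun x hx => (hq x hx).continuousWithinAt
  have c1 := h.cont 1
  have c2 := h.cont 2
  obtain ⟨A, hA⟩ := isCompact_Icc.exists_bound_of_continuousOn hpc
  have hA0 : 0 ≤ A := (norm_nonneg _).trans (hA 0 ⟨le_rfl, zero_le_one⟩)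
  have hL := h.pos
  -- For `|ε| ≤ δ` the perturbation of the velocity is at most `δ A < L`, so the varied curves stay
  -- regular.
  set δ := L / (2 * (A + 1)) with hδ
  have hδ0 : 0 < δ := by positivity
  have hreg : ∀ ε ∈ Icc (-δ) δ, ∀ x ∈ I, g 1 x + ε • p x ≠ 0 := fun ε hε x hx h2 => by
    have h3 : ‖g 1 x‖ ≤ δ * A := by
      rw [eq_neg_of_add_eq_zero_left h2, norm_neg, norm_smul, Real.norm_eq_abs]
      exact mul_le_mul (abs_le.2 hε) (hA x hx) (norm_nonneg _) hδ0.le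
    rw [h.norm x hx] at h3
    have h4 : δ * (2 * (A + 1)) = L := by rw [hδ]; field_simp
    linarith
  set D : ℝ → ℝ → ℝ := fun ε x => 2 * inner ℝ (g 2 x + ε • q x) (rot (g 1 x + ε • p x))
      * (inner ℝ (g 2 x + ε • q x) (rot (p x)) + inner ℝ (q x) (rot (g 1 x + ε • p x)))
        * ‖g 1 x + ε • p x‖⁻¹ ^ 5
        + (μ * ‖g 1 x + ε • p x‖⁻¹ - 5 * inner ℝ (g 2 x + ε • q x) (rot (g 1 x + ε • p x)) ^ 2
          * ‖g 1 x + ε • p x‖⁻¹ ^ 7) * inner ℝ (g 1 x + ε • p x) (p x) with hD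
  have hrc : Continuous rot := rotL.continuous
  have hDc : ContinuousOn (Function.uncurry D) (Icc (-δ) δ ×ˢ I) := by
    have cs : ContinuousOn (fun z : ℝ × ℝ => z.1) (Icc (-δ) δ ×ˢ I) := continuousOn_fst
    have lift : ∀ {f : ℝ → Plane}, ContinuousOn f I →
        ContinuousOn (fun z : ℝ × ℝ => f z.2) (Icc (-δ) δ ×ˢ I) := fun hf =>
      hf.comp continuousOn_snd fun z hz => hz.2
    have cp := lift hpc
    have cq := lift hqc
    have cv : ContinuousOn (fun z : ℝ × ℝ => g 1 z.2 + z.1 • p z.2) (Icc (-δ) δ ×ˢ I) :=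
      (lift c1).add (cs.smul cp)
    have cw : ContinuousOn (fun z : ℝ × ℝ => g 2 z.2 + z.1 • q z.2) (Icc (-δ) δ ×ˢ I) :=
      (lift c2).add (cs.smul cq)
    have cN := cv.norm.inv₀ fun z hz => norm_ne_zero_iff.2 (hreg z.1 hz.1 z.2 hz.2)
    have crv := hrc.comp_continuousOn cv
    have crp := hrc.comp_continuousOn cp
    have cu := cw.inner (𝕜 := ℝ) crv
    exact (((continuousOn_const.mul cu).mul ((cw.inner crp).add (cq.inner crv))).mul
      (cN.pow 5)).add (((continuousOn_const.mul cN).sub ((continuousOn_const.mul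
        (cu.pow 2)).mul (cN.pow 7))).mul (cv.inner cp))
  have hderiv := hasDerivAt_integral_of_continuousOn
    (f := fun ε x => ((inner ℝ (g 2 x + ε • q x) (rot (g 1 x + ε • p x))
      * ‖g 1 x + ε • p x‖⁻¹ ^ 3) ^ 2 + μ) * ‖g 1 x + ε • p x‖) (f' := D) hδ0 ?_ hDc
    fun ε hε x hx => hasDerivAt_density μ (hreg ε hε x hx)
  · have hz : ∫ x in (0 : ℝ)..1, D 0 x = 0 := by
      have hD0 : ∀ x ∈ I, HasDerivWithinAt _ (D 0 x) I x := fun x hx => by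
        have := h.hasDerivWithinAt_firstVariation hel hx (hp x hx) (hq x hx)
        convert this using 1
        simp only [hD, zero_smul, add_zero, h.norm x hx]
      rw [intervalIntegral.integral_eq_sub_of_hasDeriv_right_of_le zero_le_one
        (fun x hx => (hD0 x hx).continuousWithinAt)
        (fun x hx => ((hD0 x (Ioo_subset_Icc_self hx)).hasDerivAt
          (Icc_mem_nhds hx.1 hx.2)).hasDerivWithinAt)
        (ContinuousOn.intervalIntegrable (by
          rw [uIcc_of_le zero_le_one]
          exact hDc.comp (f := fun x => ((0 : ℝ), x)) (by fun_prop)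
            fun x hx => ⟨⟨by linarith, hδ0.le⟩, hx⟩))]
      simp only [hb 0 zero_mem_ends, hb 1 one_mem_ends, h0, h1, inner_zero_left, sub_self]
    rw [hz] at hderiv
    refine hderiv.congr_of_eventuallyEq ?_
    filter_upwards [Icc_mem_nhds (neg_lt_zero.2 hδ0) hδ0] with ε hε
    exact elasticEnergy_eq μ (fun x hx => (h.deriv 0 x hx).add ((hp x hx).const_smul ε))
      (fun x hx => (h.deriv 1 x hx).add ((hq x hx).const_smul ε)) (hreg ε hε)
  · intro ε hε
    have cv : ContinuousOn (fun x => g 1 x + ε • p x) I := by fun_prop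
    have cw : ContinuousOn (fun x => g 2 x + ε • q x) I := by fun_prop
    have cN := cv.norm.inv₀ fun x hx => norm_ne_zero_iff.2 (hreg ε hε x hx)
    exact ((((cw.inner (hrc.comp_continuousOn cv)).mul (cN.pow 3)).pow 2).add
      continuousOn_const).mul cv.norm

end ConstSpeed

end

section

/-! ### Subconvergence of the flow -/

/-- After this reparametrization `∂ₓ` is the length times `∂ₛ`, so bounds on arclength derivatives
become bounds on parameter derivatives of every order. -/
lemma RegularFamily.exists_constSpeed {Γ : ℝ × ℝ → Plane} (h : RegularFamily Γ) {t : ℝ}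
    (ht : 0 < t) : ∃ φ : ℝ → ℝ, IsReparametrization φ ∧ MapsTo φ I I ∧
      ConstSpeed (J Γ (fun _ => 1) t)
        (fun m x => J Γ (fun _ => 1) t ^ m • sder Γ m (t, φ x)) := by
  obtain ⟨φ, hφ, hmaps, hder⟩ := exists_isReparametrization (g := fun x => speed Γ (t, x))
    (h.sm_speed.comp (contDiffOn_const.prodMk contDiffOn_id) fun x hx => ⟨ht, hx⟩)
    fun x hx => h.speed_pos (p := (t, x)) ⟨ht, hx⟩
  have hL : J Γ (fun _ => 1) t = ∫ x in (0 : ℝ)..1, speed Γ (t, x) := by simp [J]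
  refine ⟨φ, hφ, hmaps, h.length_pos ht, fun m x hx => ?_, fun x hx => ?_⟩
  · have hp : (t, φ x) ∈ U := ⟨ht, hmaps hx⟩
    have h1 := ((hasDerivWithinAt_dX (h.sm_sder m) ht (hmaps hx)).scomp x (hder x hx)
      hmaps).const_smul (J Γ (fun _ => 1) t ^ m)
    refine h1.congr_deriv ?_
    rw [← hL, h.dX_eq _ hp, smul_smul, smul_smul, mul_assoc,
      div_mul_cancel₀ _ (h.speed_pos hp).ne', ← pow_succ]
    rfl
  · rw [pow_one, norm_smul, Real.norm_of_nonneg (h.length_pos ht).le]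
    exact (congrArg _ (h.norm_tau (p := (t, φ x)) ⟨ht, hmaps hx⟩)).trans (mul_one _)

namespace ConstSpeed

variable {L μ : ℝ} {g : ℕ → ℝ → Plane} (h : ConstSpeed L g)
include h

lemma isElastica {b : BoundaryCondition} (hb : b.Holds (g 0))
    (hel : ∀ x ∈ I, elasticGradient μ (g 0) x = 0) : IsElastica μ b (g 0) where
  toIsSmoothRegular := h.isSmoothRegular
  boundary := hb
  eulerLagrange := hel
  critical := by
    intro ψ hψ hadm
    have hψ1 := (contDiffOn_succ_iff_derivWithin (n := 1) uniqueDiffOn_I).1 (by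
      rwa [one_add_one_eq_two])
    have hψ2 := (contDiffOn_succ_iff_derivWithin (n := 0) uniqueDiffOn_I).1 (by
      rw [zero_add]; exact hψ1.2.2)
    have hψ01 : ψ 0 = 0 ∧ ψ 1 = 0 := by
      cases b with
      | navier P Q => exact hadm
      | clamped P Q τ₀ τ₁ => exact ⟨hadm.1, hadm.2.1⟩
    refine h.hasDerivAt_elasticEnergy hel (fun x hx => (hψ1.1 x hx).hasDerivWithinAt)
      (fun x hx => (hψ2.1 x hx).hasDerivWithinAt) hψ2.2.2.continuousOn hψ01.1 hψ01.2 ?_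
    -- In the boundary term the curvature factor vanishes in the Navier case and the factor with `∂ₓ
    -- ψ` in the clamped case.
    intro e he
    cases b with
    | navier P Q =>
      have hκ : curvatureVector (g 0) e = 0 := by
        rcases he with rfl | rfl
        · exact hb.2.2.1
        · exact hb.2.2.2
      rw [h.curvatureVector_eq (ends_subset he), smul_smul] at hκ
      have h2 := (smul_eq_zero.1 hκ).resolve_left
        (mul_ne_zero (inv_ne_zero h.pos.ne') (inv_ne_zero h.pos.ne'))
      rw [h2, inner_zero_left, zero_mul]
    | clamped P Q τ₀ τ₁ =>
      have hp : derivWithin ψ I e = 0 := by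
        rcases he with rfl | rfl
        · exact hadm.2.2.1
        · exact hadm.2.2.2
      rw [hp, inner_zero_left, mul_zero]

end ConstSpeed

lemma tendsto_elasticGradient {c : ℕ → ℕ → ℝ → Plane} {ℓ : ℕ → ℝ} {g : ℕ → ℝ → Plane} {L : ℝ}
    (hc : ∀ n, ConstSpeed (ℓ n) (c n)) (hg : ConstSpeed L g) (hℓ : Tendsto ℓ atTop (nhds L))
    {x : ℝ} (hx : x ∈ I) (hlim : ∀ m, Tendsto (fun n => c n m x) atTop (nhds (g m x))) (μ : ℝ) :
    Tendsto (fun n => elasticGradient μ (c n 0) x) atTop (nhds (elasticGradient μ (g 0) x)) := by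
  have hr : ∀ m, Tendsto (fun n => rot (c n m x)) atTop (nhds (rot (g m x))) := fun m =>
    (rotL.continuous.tendsto _).comp (hlim m)
  have hi := hℓ.inv₀ hg.pos.ne'
  have hu := ((hi.pow 3).mul ((hlim 2).inner (𝕜 := ℝ) (hr 1)))
  simp only [(hc _).elasticGradient_eq hx, hg.elasticGradient_eq hx]
  exact ((((hi.pow 5).const_mul 2).mul (((hlim 3).inner (hr 2)).add ((hlim 4).inner (hr 1)))).add
    (hu.pow 3)).sub (hu.const_mul μ)

/-- The powers of the length cancel, since the elastic gradient is geometric; what remains is the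
flow law. -/
lemma ElasticFamily.elasticGradient_reparam {μ : ℝ} {Γ : ℝ × ℝ → Plane} (h : ElasticFamily μ Γ)
    {t : ℝ} (ht : 0 < t) {φ : ℝ → ℝ} {c : ℕ → ℝ → Plane}
    (hc : ConstSpeed (J Γ (fun _ => 1) t) c)
    (hcφ : ∀ m x, c m x = J Γ (fun _ => 1) t ^ m • sder Γ m (t, φ x)) {x : ℝ} (hx : x ∈ I)
    (hφ : φ x ∈ I) : elasticGradient μ (c 0) x = -nvel Γ (t, φ x) := by
  rw [hc.elasticGradient_eq hx, ← h.law_sder (p := (t, φ x)) ⟨ht, hφ⟩]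
  have hL := hc.pos
  simp only [hcφ, rot_smul, real_inner_smul_left, real_inner_smul_right]
  field_simp
  ring

end

/-! ### The limit is an elastica -/

section

lemma IsGlobalElasticFlow.exists_elastica {μ : ℝ} {b : BoundaryCondition} {γ : ℝ → ℝ → Plane}
    (hγ : IsGlobalElasticFlow μ b γ) (hμ : 0 < μ) {t : ℕ → ℝ} (ht1 : ∀ n, 1 ≤ t n)
    (ht : Tendsto t atTop atTop) :
    ∃ (σ : ℕ → ℕ) (φ : ℕ → ℝ → ℝ) (c : ℝ → Plane), StrictMono σ ∧
      (∀ n, IsReparametrization (φ n)) ∧ IsElastica μ b c ∧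
      SmoothlyConverges (fun n x => γ (t (σ n)) (φ n x)) c := by
  set Γ := Function.uncurry γ with hΓ
  have h : ElasticFamily μ Γ := hγ.elasticFamily hμ
  have ht0 : ∀ n, 0 < t n := fun n => one_pos.trans_le (ht1 n)
  choose φ hφ hmaps hcs using fun n => h.exists_constSpeed (ht0 n)
  set ℓ : ℕ → ℝ := fun n => J Γ (fun _ => 1) (t n) with hℓ
  set f : ℕ → ℕ → ℝ → Plane := fun n m x => ℓ n ^ m • sder Γ m (t n, φ n x) with hf
  have hf0 : ∀ n, f n 0 = fun x => γ (t n) (φ n x) := fun n => funext fun x => by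
    simp only [hf, pow_zero, one_smul]; rfl
  obtain ⟨M, hM, hMb⟩ := h.exists_bounds
  obtain ⟨C, hC, hCb⟩ := h.exists_inv_length_le
  obtain ⟨σ, g, hσ, hunif, hg⟩ := exists_smooth_limit (fun n => (hcs n).deriv) fun m => by
    obtain ⟨B, hB⟩ := h.exists_sder_bound m
    refine ⟨M ^ m * B, fun n x hx => ?_⟩
    rw [norm_smul, norm_pow, Real.norm_of_nonneg (hcs n).pos.le]
    exact mul_le_mul (pow_le_pow_left₀ (hcs n).pos.le (hMb _ (ht1 n)).2 m)
      (hB _ (ht1 n) _ (hmaps n hx)) (norm_nonneg _) (by positivity)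
  have hpt : ∀ m, ∀ x ∈ I, Tendsto (fun j => f (σ j) m x) atTop (nhds (g m x)) := fun m x hx =>
    (hunif m).tendsto_at hx
  have h0I : (0 : ℝ) ∈ I := ends_subset zero_mem_ends
  have h1I : (1 : ℝ) ∈ I := ends_subset one_mem_ends
  -- The lengths have the limit `‖g 1 x‖` for every `x`, so the limit has constant speed. The speed
  -- is positive by the lower bound on the lengths.
  have hspeed : ∀ x ∈ I, Tendsto (fun j => ℓ (σ j)) atTop (nhds ‖g 1 x‖) := fun x hx =>
    (hpt 1 x hx).norm.congr fun j => (hcs (σ j)).norm x hx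
  have hcg : ConstSpeed ‖g 1 0‖ g := by
    refine ⟨?_, hg, fun x hx => tendsto_nhds_unique (hspeed x hx) (hspeed 0 h0I)⟩
    refine (inv_pos.2 hC).trans_le (ge_of_tendsto' (hspeed 0 h0I) fun j => ?_)
    exact inv_le_of_inv_le₀ (hcs (σ j)).pos (hCb _ (ht1 _))
  have hel : ∀ x ∈ I, elasticGradient μ (g 0) x = 0 := fun x hx => by
    refine tendsto_nhds_unique (tendsto_elasticGradient (fun j => hcs (σ j)) hcg (hspeed 0 h0I) hx
      (fun m => hpt m x hx) μ) ?_
    rw [Metric.tendsto_nhds]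
    intro ε hε
    have hev := ((ht.comp hσ.tendsto_atTop).eventually
      (h.nvel_tendsto_zero (ε / 2) (half_pos hε)))
    filter_upwards [hev] with j hj
    rw [h.elasticGradient_reparam (ht0 _) (φ := φ (σ j)) (hcs (σ j)) (fun _ _ => rfl) hx
      (hmaps _ hx), dist_zero_right, norm_neg, Real.norm_eq_abs]
    exact (hj _ (hmaps _ hx)).trans_lt (half_lt_self hε)
  have hval : ∀ e ∈ ends, ∀ v, (∀ t > 0, γ t e = v) → g 0 e = v := fun e he v hv => by
    refine tendsto_nhds_unique (hpt 0 e (ends_subset he)) (tendsto_const_nhds.congr fun j => ?_)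
    have hφe : φ (σ j) e = e := by
      rcases he with rfl | rfl
      · exact (hφ _).map_zero
      · exact (hφ _).map_one
    rw [hf0]
    simp only [hφe]
    exact (hv _ (ht0 _)).symm
  -- The reparametrizations fix the end points, so arclength derivatives that are constant in time
  -- there pass to the limit up to the power of the length.
  have hend : ∀ e ∈ ends, ∀ m v, (∀ t > 0, sder Γ m (t, e) = v) → g m e = ‖g 1 0‖ ^ m • v :=
    fun e he m v hv => by
    refine tendsto_nhds_unique (hpt m e (ends_subset he))
      ((((hspeed 0 h0I).pow m).smul_const v).congr fun j => ?_)
    have hφe : φ (σ j) e = e := by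
      rcases he with rfl | rfl
      · exact (hφ _).map_zero
      · exact (hφ _).map_one
    simp only [hf, hφe]
    rw [hv _ (ht0 _)]
  have htan : ∀ e ∈ ends, ∀ v, (∀ t > 0, tangent (γ t) e = v) → tangent (g 0) e = v :=
    fun e he v hv => by
    have he' := ends_subset he
    rw [hcg.tangent_eq he', hend e he 1 v fun t ht => (hγ.tangent_eq ht he').symm.trans (hv t ht),
      pow_one, smul_smul, inv_mul_cancel₀ hcg.pos.ne', one_smul]
  have hcurv : ∀ e ∈ ends, (∀ t > 0, curvatureVector (γ t) e = 0) → curvatureVector (g 0) e = 0 :=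
    fun e he hv => by
    have he' := ends_subset he
    rw [hcg.curvatureVector_eq he', hend e he 2 0 fun t ht =>
      (hγ.curvatureVector_eq ht he').symm.trans (hv t ht)]
    simp only [smul_zero]
  have hb : b.Holds (g 0) := by
    have hB := fun (t : ℝ) (ht : t > 0) => hγ.boundary t (le_of_lt ht)
    cases b with
    | navier P Q =>
      exact ⟨hval 0 zero_mem_ends P fun t ht => (hB t ht).1,
        hval 1 one_mem_ends Q fun t ht => (hB t ht).2.1,
        hcurv 0 zero_mem_ends fun t ht => (hB t ht).2.2.1,
        hcurv 1 one_mem_ends fun t ht => (hB t ht).2.2.2⟩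
    | clamped P Q τ₀ τ₁ =>
      exact ⟨hval 0 zero_mem_ends P fun t ht => (hB t ht).1,
        hval 1 one_mem_ends Q fun t ht => (hB t ht).2.1,
        htan 0 zero_mem_ends τ₀ fun t ht => (hB t ht).2.2.1,
        htan 1 one_mem_ends τ₁ fun t ht => (hB t ht).2.2.2⟩
  refine ⟨σ, fun j => φ (σ j), g 0, hσ, fun j => hφ _, hcg.isElastica hb hel, fun m => ?_⟩
  have hlim := ((hunif m).congr (Eventually.of_forall fun j =>
    (iteratedDerivWithin_of_hasDerivWithinAt (hcs (σ j)).deriv m).symm)).congr_right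
      (iteratedDerivWithin_of_hasDerivWithinAt hg m).symm
  refine hlim.congr (Eventually.of_forall fun j x _ => ?_)
  change iteratedDerivWithin m (f (σ j) 0) I x = _
  rw [hf0]

end

end ElasticFlow

end

theorem mainTheorem7 (μ : ℝ) (hμ : 0 < μ) (b : ElasticFlow.BoundaryCondition)
    (γ : ℝ → ℝ → ElasticFlow.Plane) (hγ : ElasticFlow.IsGlobalElasticFlow μ b γ)
    (t : ℕ → ℝ) (ht : Filter.Tendsto t Filter.atTop Filter.atTop) :
    ∃ (σ : ℕ → ℕ) (φ : ℕ → ℝ → ℝ) (γ_inf : ℝ → ElasticFlow.Plane),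
      StrictMono σ ∧
      (∀ n, ElasticFlow.IsReparametrization (φ n)) ∧
      ElasticFlow.IsElastica μ b γ_inf ∧
      ElasticFlow.SmoothlyConverges (fun n x => γ (t (σ n)) (φ n x)) γ_inf := by
  -- The uniform bounds hold for times at least `1`; finitely many terms of the sequence are
  -- dropped, and the shift is put back into the subsequence.
  obtain ⟨N, hN⟩ := Filter.eventually_atTop.1 (ht.eventually_ge_atTop 1)
  obtain ⟨σ, φ, c, hσ, hφ, hc, hlim⟩ := hγ.exists_elastica hμ (t := fun n => t (n + N))
    (fun n => hN _ (Nat.le_add_left N n)) (ht.comp (Filter.tendsto_add_atTop_nat N))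
  exact ⟨fun n => σ n + N, φ, c, fun m n hmn => Nat.add_lt_add_right (hσ hmn) N, hφ, hc, hlim⟩
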